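/- \textbf{Conventions.} Let $\mathrm{Homeo}^+(S^1)$ be the group of orientation-preserving homeomorphisms of the circle, with the compact-open topology. Two unordered pairs $\{a,b\}$, $\{c,d\}$ of distinct points of $S^1$ are \emph{linked} if each component of $S^1\setminus\{a,b\}$ contains exactly one of $c,d$. A \emph{lamination} $\Lambda$ is a closed set of pairwise unlinked elements (\emph{leaves}) of the space $(S^1\times S^1\setminus\Delta)/((x,y)\sim(y,x))$; it is \emph{dense} if the set of endpoints of its leaves is dense in $S^1$. Two laminations have \emph{distinct endpoints} if their endpoint sets are disjoint. Drawing the leaves as chords of the closed unit disk bounded by $S^1$, a \emph{gap} of $\Lambda$ is the closure of a connected component of the complement of the leaves in the open disk. $\Lambda$ is \emph{very full} if each gap is a finite-sided ideal polygon (with at least three vertices, all on $S^1$), and \emph{loose} if no two distinct leaves share an endpoint unless they are edges of the same gap. A subgroup $\Gamma\le\mathrm{Homeo}^+(S^1)$ is \emph{pseudo-fibered} if it is finitely generated and discrete, admits a dense $\Gamma$-invariant lamination, admits two $\Gamma$-invariant very full loose laminations $\Lambda_1,\Lambda_2$ with distinct endpoints, and each nontrivial element of $\Gamma$ has at most countably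 many fixed points in $S^1$. \textbf{Theorem.} Let $G$ and $H$ be any finite cyclic groups. Then there is an injective homomorphism $\rho\colon G*H\to\mathrm{Homeo}^+(S^1)$ whose image $\rho(G*H)$ is a pseudo-fibered group. Moreover, $\rho$ can be chosen such that, in addition, $\rho(w)$ has at most two fixed points in $S^1$ for every nontrivial $w\in G*H$. -/

import Mathlib

noncomputable section

namespace CircleLamination

/-- The oriented circle `S¹ = ℝ / ℤ`. Its circular order `sbtw a b c` says that `a, b, c` are
distinct and met in this order when going once around the circle in the positive direction. -/
abbrev S1 : Type := AddCircle (1 : ℝ)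

/-- The standard embedding of `S¹` in the plane, as the boundary of the unit disk. -/
def toPlane (x : S1) : ℂ := (AddCircle.toCircle x : ℂ)

/-- `Homeo⁺(S¹)`: the group (under composition) of homeomorphisms that preserve the cyclic order,
i.e. the orientation, of the circle. -/
def HomeoPlus : Subgroup (S1 ≃ₜ S1) where
  carrier := {f | ∀ a b c : S1, sbtw (f a) (f b) (f c) ↔ sbtw a b c}
  mul_mem' := by
    intro f g hf hg a b c
    exact (hf (g a) (g b) (g c)).trans (hg a b c)
  one_mem' := by
    intro a b c
    exact Iff.rfl
  inv_mem' := by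
    intro f hf a b c
    have h := hf (f.symm a) (f.symm b) (f.symm c)
    simp only [Homeomorph.apply_symm_apply] at h
    exact h.symm

/-- `Homeo⁺(S¹)` carries the compact-open topology (the topology of uniform convergence). -/
instance : TopologicalSpace HomeoPlus :=
  TopologicalSpace.induced (fun g : HomeoPlus => ((g : S1 ≃ₜ S1) : C(S1, S1))) inferInstance

/-- The set of fixed points of `g`. -/
def Fix (g : HomeoPlus) : Set S1 := {x | (g : S1 ≃ₜ S1) x = x}

/-- The space `ℳ = (S¹ × S¹ - Δ) / (x, y) ∼ (y, x)` of unordered pairs of distinct points, with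
its natural topology (`Sym2 S1` has the quotient topology of `S1 × S1`). -/
abbrev Pairs : Type := {s : Sym2 S1 // ¬ s.IsDiag}

/-- The action of a homeomorphism on `ℳ`. -/
def Pairs.map (f : S1 ≃ₜ S1) (l : Pairs) : Pairs :=
  ⟨Sym2.map f l.1, fun h => l.2 ((Sym2.isDiag_map f.injective).1 h)⟩

/-- Two pairs `{a, b}` and `{c, d}` are linked if each of the two components of `S¹ \ {a, b}`,
which are the open arcs from `a` to `b` and from `b` to `a`, contains exactly one of `c, d`. -/
def Linked (l m : Pairs) : Prop :=
  ∃ a b c d : S1, l.1 = s(a, b) ∧ m.1 = s(c, d) ∧ sbtw a c b ∧ sbtw b d a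

/-- The chord of the closed unit disk that joins the two points of a pair. -/
def Pairs.chord (l : Pairs) : Set ℂ := convexHull ℝ (toPlane '' {x | x ∈ l.1})

/-- A lamination of `S¹`: a closed subset of `ℳ` whose elements are pairwise unlinked. -/
structure Lamination where
  leaves : Set Pairs
  isClosed_leaves : IsClosed leaves
  unlinked : ∀ l ∈ leaves, ∀ m ∈ leaves, ¬ Linked l m

namespace Lamination

/-- The set of endpoints of the leaves. -/
def Ends (L : Lamination) : Set S1 := {x | ∃ l ∈ L.leaves, x ∈ l.1}

/-- A lamination is dense if its endpoints are dense in `S¹`. -/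
def IsDense (L : Lamination) : Prop := Dense L.Ends

/-- Two laminations have distinct endpoints if their sets of endpoints are disjoint. -/
def DistinctEndpoints (L M : Lamination) : Prop := Disjoint L.Ends M.Ends

/-- The lamination is preserved set-wise by every element of `Γ`. -/
def IsInvariant (L : Lamination) (Γ : Subgroup HomeoPlus) : Prop :=
  ∀ g ∈ Γ, Pairs.map (g : S1 ≃ₜ S1) '' L.leaves = L.leaves

/-- The complement, in the open unit disk, of the union of all leaves (drawn as chords). -/
def complementInDisk (L : Lamination) : Set ℂ :=
  Metric.ball (0 : ℂ) 1 \ ⋃ l ∈ L.leaves, l.chord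

/-- A gap is the closure of a connected component of the complement of the leaves in the disk. -/
def IsGap (L : Lamination) (P : Set ℂ) : Prop :=
  ∃ z ∈ L.complementInDisk, P = closure (connectedComponentIn L.complementInDisk z)

/-- A leaf (as a pair of points) is an edge of the gap `P` if its chord lies on the boundary
of `P`. -/
def IsEdge (l : Pairs) (P : Set ℂ) : Prop := l.chord ⊆ frontier P

/-- Finite-sided ideal polygons: convex hulls of finitely many, at least three, points of the
unit circle. -/
def IsIdealPolygon (P : Set ℂ) : Prop :=
  ∃ V : Finset S1, 3 ≤ V.card ∧ P = convexHull ℝ (toPlane '' (V : Set S1))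

/-- Very full: each gap is a finite-sided ideal polygon. -/
def IsVeryFull (L : Lamination) : Prop := ∀ P, L.IsGap P → IsIdealPolygon P

/-- Loose: no two distinct leaves share an endpoint unless they are edges of the same gap. -/
def IsLoose (L : Lamination) : Prop :=
  ∀ l ∈ L.leaves, ∀ m ∈ L.leaves, l ≠ m → (∃ x, x ∈ l.1 ∧ x ∈ m.1) →
    ∃ P, L.IsGap P ∧ IsEdge l P ∧ IsEdge m P

end Lamination

/-- A laminar group: a discrete subgroup of `Homeo⁺(S¹)` that admits a dense invariant
lamination. -/
structure IsLaminar (Γ : Subgroup HomeoPlus) : Prop where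
  discrete : DiscreteTopology Γ
  exists_dense : ∃ L : Lamination, L.IsDense ∧ L.IsInvariant Γ

/-- A pseudo-fibered triple: a finitely generated laminar group `Γ`, two `Γ`-invariant very full
loose laminations with distinct endpoints, and each nontrivial element of `Γ` has at most countably
many fixed points. -/
structure IsPseudoFiberedTriple (Γ : Subgroup HomeoPlus) (L₁ L₂ : Lamination) : Prop where
  fg : Γ.FG
  laminar : IsLaminar Γ
  veryFull₁ : L₁.IsVeryFull
  veryFull₂ : L₂.IsVeryFull
  loose₁ : L₁.IsLoose
  loose₂ : L₂.IsLoose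
  invariant₁ : L₁.IsInvariant Γ
  invariant₂ : L₂.IsInvariant Γ
  distinct : L₁.DistinctEndpoints L₂
  countable_fix : ∀ g ∈ Γ, g ≠ 1 → (Fix g).Countable

/-- A subgroup of `Homeo⁺(S¹)` is pseudo-fibered if it is part of a pseudo-fibered triple. -/
def IsPseudoFibered (Γ : Subgroup HomeoPlus) : Prop :=
  ∃ L₁ L₂ : Lamination, IsPseudoFiberedTriple Γ L₁ L₂

end CircleLamination

end

/-!
Let `N` be a multiple of `3 |G| |H|`. The group `spinFlip` is generated by the rotation of the
circle `ℝ / ℤ` by `1 / N` and by a piecewise linear involution `flip` that exchanges an arc of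
length `1 / (2 N)` with its complement. The group `G` acts by rotations, and `H` by the conjugates
of rotations by the involution (`rep`). The maps `step hN i`, a nontrivial rotation by `i / N`
followed by the involution, are affine contractions of a common arc (`step_coe`), and every
nontrivial element of `G * H` is conjugate to an element of a factor, which acts without fixed
points, or to an alternating product, which acts as a nonempty composition of these contractions.
Such a composition has at most one fixed point in the arc and, because its inverse is conjugate to a
map of the same kind, at most one outside (`Fix_steps`). So there are at most two fixed points, and
in particular the action is faithful.

The laminations are translates of a lamination of a fundamental region. The regular ideal `N`-gon
with vertices at `a + i / N` is invariant under the rotation; one of its edges and a chord that the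
involution flips bound an ideal rectangle (`base`), whose part on the circle consists of two
intervals. The translates of the polygon, of the flipped chord and of the rectangle by `spinFlip`
form the pattern of the Bass-Serre tree of `ℤ/N * ℤ/2`, with the rectangles as the edges of the
tree, and fill the disk. The rectangle is filled by ideal quadrilaterals recursively: removing a
central quadrilateral leaves two thinner rectangles and two caps, which are again rectangles
(`Rect.child`). The leaves of the lamination are the limits of the sides of these quadrilaterals; in
each rectangle of the recursion they contain a family of parallel leaves indexed by a Cantor set,
and in this way leaves share endpoints only if they are sides of one quadrilateral
(`Rect.compare_leaves`) or edges of one translate of the `N`-gon. Since a nontrivial translate of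
the rectangle lies on the other side of its outer or of its inner side (`classify`,
`sep_translate`), the translates of the leaves are unlinked, and only finitely many translates are
large, so that their union is closed (`lam`).

A point of the disk off the leaves lies in one of the polygons (`exists_polygon`): otherwise it
could be followed into ever smaller rectangles, which converge to a leaf or to a point of the
circle, or beyond ever shorter translates of the edges of the `N`-gon. Hence the gaps are the
polygons and the lamination is very full, loose and dense.

The polygon and the flipped chord, and with them the whole lamination, depend on a parameter `α`
that leaves the group unchanged. The Cantor sets are so thin that the product of two of them has
dimension less than one. Therefore the parameters for which an endpoint of a leaf coincides with an
endpoint of a leaf of the lamination for `α = 0` form a null set (`volume_meet`), and some parameter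
gives a lamination with distinct endpoints. Finally, the group is discrete because the translates of
an interval on the boundary of the rectangle do not overlap (`discreteTopology_of_le`).
-/

noncomputable section

namespace CircleLamination

open Set Topology MeasureTheory

/-! ### The cyclic order of the circle in real coordinates -/

theorem coe_add_one (x : ℝ) : ((x + 1 : ℝ) : S1) = (x : S1) :=
  AddCircle.coe_add_period 1 x

theorem coe_add_int (x : ℝ) (n : ℤ) : ((x + n : ℝ) : S1) = (x : S1) := by
  have h : ((n : ℝ) : S1) = 0 := AddCircle.coe_eq_zero_iff (p := (1 : ℝ)) |>.2 ⟨n, by simp⟩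
  rw [AddCircle.coe_add, h, add_zero]

theorem sbtw_coe_iff {x y z : ℝ} (hxy : x ≤ y) (hy : y < x + 1) (hxz : x ≤ z) (hz : z < x + 1) :
    sbtw (x : S1) (y : S1) (z : S1) ↔ x < y ∧ y < z := by
  have key : btw (z : S1) (y : S1) (x : S1) ↔ z ≤ toIocMod (one_pos : (0 : ℝ) < 1) x y := by
    have h1 : btw (z : S1) (y : S1) (x : S1) ↔ btw (x : S1) (z : S1) (y : S1) := btw_cyclic
    rw [h1]
    have h2 := QuotientAddGroup.btw_coe_iff (hp' := ⟨(one_pos : (0 : ℝ) < 1)⟩)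
      (x₁ := x) (x₂ := z) (x₃ := y)
    rw [(toIcoMod_eq_self (one_pos : (0 : ℝ) < 1)).2 ⟨hxz, hz⟩] at h2
    exact h2
  rw [sbtw_iff_not_btw, key, not_le]
  rcases hxy.eq_or_lt with rfl | h
  · rw [toIocMod_apply_left]
    constructor
    · intro h; linarith
    · rintro ⟨h, -⟩; exact absurd h (lt_irrefl _)
  · rw [(toIocMod_eq_self (one_pos : (0 : ℝ) < 1)).2 ⟨h, hy.le⟩]
    exact ⟨fun h' => ⟨h, h'⟩, fun h' => h'.2⟩

/-- Every point of the circle has a unique real coordinate in a half-open interval of length `1`. -/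
theorem exists_coe_Ico (w : ℝ) (t : S1) : ∃ x : ℝ, w ≤ x ∧ x < w + 1 ∧ (x : S1) = t :=
  ⟨AddCircle.equivIco 1 w t, (AddCircle.equivIco 1 w t).2.1, (AddCircle.equivIco 1 w t).2.2,
    AddCircle.coe_equivIco⟩

theorem coe_eq_coe_iff_of_window {w x y : ℝ} (hx : w ≤ x) (hx' : x < w + 1) (hy : w ≤ y)
    (hy' : y < w + 1) : (x : S1) = (y : S1) ↔ x = y :=
  AddCircle.coe_eq_coe_iff_of_mem_Ico (p := (1 : ℝ)) (a := w) ⟨hx, hx'⟩ ⟨hy, hy'⟩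

theorem coe_ne_coe {x y : ℝ} (h : x < y) (h' : y < x + 1) : (x : S1) ≠ (y : S1) := by
  rw [Ne, coe_eq_coe_iff_of_window le_rfl (by linarith) h.le h']
  exact h.ne

/-- The closed arc of the circle that is the image of a real interval. -/
def arc (x y : ℝ) : Set S1 := (fun t : ℝ => (t : S1)) '' Icc x y

theorem mem_arc_of {x y t : ℝ} (h : x ≤ t) (h' : t ≤ y) : (t : S1) ∈ arc x y := ⟨t, ⟨h, h'⟩, rfl⟩

/-- Points of a closed arc are not strictly inside the complementary arc. -/
theorem not_sbtw_of_mem_arc {x y : ℝ} (hxy : x ≤ y) (hy : y ≤ x + 1) {t : S1} (ht : t ∈ arc x y) :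
    ¬ sbtw (y : S1) t (x : S1) := by
  obtain ⟨t, ⟨h1, h2⟩, rfl⟩ := ht
  intro h
  rcases hy.eq_or_lt with rfl | hy
  · rw [coe_add_one] at h
    exact sbtw_irrefl_left_right h
  rcases h2.eq_or_lt with rfl | h2
  · exact sbtw_irrefl_left h
  · have h3 := sbtw_cyclic_right h
    rw [sbtw_coe_iff hxy hy h1 (by linarith)] at h3
    linarith

theorem mem_arc_or {x y : ℝ} (t : S1) : t ∈ arc x y ∨ t ∈ arc y (x + 1) := by
  obtain ⟨u, h1, h2, rfl⟩ := exists_coe_Ico x t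
  rcases le_total u y with h | h
  · exact Or.inl ⟨u, ⟨h1, h⟩, rfl⟩
  · exact Or.inr ⟨u, ⟨h, h2.le⟩, rfl⟩

theorem not_sbtw_and_sbtw {x y : ℝ} (hy : y ≤ x + 1) {P Q R T : S1}
    (hP : P ∈ arc x y) (hQ : Q ∈ arc x y) (hR : R ∈ arc y (x + 1)) (hT : T ∈ arc y (x + 1)) :
    ¬ (sbtw P R Q ∧ sbtw Q T P) := by
  obtain ⟨P, ⟨p1, p2⟩, rfl⟩ := hP
  obtain ⟨Q, ⟨q1, q2⟩, rfl⟩ := hQ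
  -- If `P ≤ Q` in the arc, then the open arc from `P` to `Q` misses the complementary closed arc.
  have key : ∀ P Q : ℝ, x ≤ P → Q ≤ y → P ≤ Q → ∀ R ∈ arc y (x + 1),
      ¬ sbtw (P : S1) R (Q : S1) := by
    rintro P Q hP hQ hPQ _ ⟨R, ⟨r1, r2⟩, rfl⟩ h
    rcases eq_or_lt_of_le (show Q ≤ P + 1 by linarith) with h1 | h1
    · rw [h1, coe_add_one] at h
      exact sbtw_irrefl_left_right h
    rcases lt_or_ge R (P + 1) with h2 | h2
    · have := (sbtw_coe_iff (by linarith) h2 hPQ h1).1 h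
      linarith
    · obtain rfl : R = P + 1 := by linarith
      simp only [coe_add_one] at h
      exact sbtw_irrefl_left h
  rintro ⟨h1, h2⟩
  rcases le_total P Q with h | h
  · exact key P Q p1 q2 h R hR h1
  · exact key Q P q1 p2 h T hT h2

/-- Two pairs of points that lie in complementary closed arcs are unlinked. -/
theorem not_linked_of_arc {x y : ℝ} (hy : y ≤ x + 1) {P Q R T : S1}
    (hP : P ∈ arc x y) (hQ : Q ∈ arc x y) (hR : R ∈ arc y (x + 1)) (hT : T ∈ arc y (x + 1))
    {l m : Pairs} (hl : l.1 = s(P, Q)) (hm : m.1 = s(R, T)) : ¬ Linked l m := by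
  rintro ⟨a, b, c, d, h1, h2, h3, h4⟩
  rw [hl, Sym2.eq_iff] at h1
  rw [hm, Sym2.eq_iff] at h2
  rcases h1 with ⟨rfl, rfl⟩ | ⟨rfl, rfl⟩ <;> rcases h2 with ⟨rfl, rfl⟩ | ⟨rfl, rfl⟩
  · exact not_sbtw_and_sbtw hy hP hQ hR hT ⟨h3, h4⟩
  · exact not_sbtw_and_sbtw hy hP hQ hT hR ⟨h3, h4⟩
  · exact not_sbtw_and_sbtw hy hQ hP hR hT ⟨h3, h4⟩
  · exact not_sbtw_and_sbtw hy hQ hP hT hR ⟨h3, h4⟩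

theorem Linked.symm {l m : Pairs} (h : Linked l m) : Linked m l := by
  obtain ⟨a, b, c, d, h1, h2, h3, h4⟩ := h
  exact ⟨c, d, b, a, h2, by rw [h1, Sym2.eq_swap],
    sbtw_cyclic_right (sbtw_trans_right h4 (sbtw_cyclic_right h3)),
    sbtw_cyclic_right (sbtw_trans_right h3 (sbtw_cyclic_right h4))⟩

theorem linked_map (g : HomeoPlus) (l m : Pairs) :
    Linked (l.map g) (m.map g) ↔ Linked l m := by
  have key : ∀ (g : HomeoPlus) (l m : Pairs), Linked l m → Linked (l.map g) (m.map g) := by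
    rintro g l m ⟨a, b, c, d, h1, h2, h3, h4⟩
    refine ⟨g.1 a, g.1 b, g.1 c, g.1 d, ?_, ?_, (g.2 _ _ _).2 h3, (g.2 _ _ _).2 h4⟩
    · simp [Pairs.map, h1]
    · simp [Pairs.map, h2]
  refine ⟨fun h => ?_, key g l m⟩
  have h' := key g⁻¹ _ _ h
  have e : ∀ l : Pairs, (l.map g).map ((g⁻¹ : HomeoPlus) : S1 ≃ₜ S1) = l := by
    intro l
    apply Subtype.ext
    simp only [Pairs.map, Sym2.map_map]
    have : (((g⁻¹ : HomeoPlus) : S1 ≃ₜ S1) : S1 → S1) ∘ ((g : S1 ≃ₜ S1) : S1 → S1) = id := by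
      ext t
      exact (g : S1 ≃ₜ S1).symm_apply_apply t
    rw [this, Sym2.map_id]
    rfl
  rwa [e, e] at h'

/-! ### Chords and sides of chords -/

theorem toPlane_coe (x : ℝ) : toPlane (x : S1) = Complex.exp (2 * Real.pi * x * Complex.I) := by
  simp [toPlane, AddCircle.toCircle_apply_mk, Circle.coe_exp]

theorem norm_toPlane (t : S1) : ‖toPlane t‖ = 1 := Circle.norm_coe _

theorem continuous_toPlane : Continuous toPlane :=
  continuous_subtype_val.comp AddCircle.continuous_toCircle

theorem toPlane_injective : Function.Injective toPlane := by
  intro x y h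
  exact AddCircle.injective_toCircle one_ne_zero (Subtype.ext h)

theorem toPlane_re_im (x : ℝ) : toPlane (x : S1) =
    ⟨Real.cos (2 * Real.pi * x), Real.sin (2 * Real.pi * x)⟩ := by
  rw [toPlane_coe]
  have : (2 * Real.pi * x * Complex.I : ℂ) = ((2 * Real.pi * x : ℝ) : ℂ) * Complex.I := by
    push_cast; ring
  rw [this]
  apply Complex.ext
  · rw [Complex.exp_ofReal_mul_I_re]
  · rw [Complex.exp_ofReal_mul_I_im]

/-- Twice the signed area of the triangle with vertices `x`, `y`, `z`, where `x` and `y` are on the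
circle and `z` is any point of the plane. It is positive when `z` is on the left of the chord from
`x` to `y`, and negative when `z` is beyond that chord, on the side of the arc from `x` to `y`. -/
def orient (x y : S1) (z : ℂ) : ℝ :=
  ((starRingEnd ℂ) (toPlane y - toPlane x) * (z - toPlane x)).im

theorem orient_eq (x y : S1) (z : ℂ) : orient x y z =
    ((toPlane y).re - (toPlane x).re) * (z.im - (toPlane x).im)
      - ((toPlane y).im - (toPlane x).im) * (z.re - (toPlane x).re) := by
  simp [orient]; ring

theorem orient_swap (x y : S1) (z : ℂ) : orient y x z = - orient x y z := by
  simp only [orient_eq]; ring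

theorem orient_left (x y : S1) : orient x y (toPlane x) = 0 := by simp [orient_eq]

theorem orient_right (x y : S1) : orient x y (toPlane y) = 0 := by simp only [orient_eq]; ring

theorem orient_combo (x y : S1) {z w : ℂ} {a b : ℝ} (h : a + b = 1) :
    orient x y (a • z + b • w) = a * orient x y z + b * orient x y w := by
  simp only [orient_eq, Complex.add_re, Complex.add_im, Complex.smul_re, Complex.smul_im,
    smul_eq_mul]
  obtain rfl : b = 1 - a := by linarith
  ring

theorem continuous_orient : Continuous fun p : (S1 × S1) × ℂ => orient p.1.1 p.1.2 p.2 := by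
  unfold orient
  have := continuous_toPlane
  fun_prop

theorem orient_coe (x y t : ℝ) : orient (x : S1) (y : S1) (toPlane (t : S1)) =
    4 * Real.sin (Real.pi * (y - x)) * Real.sin (Real.pi * (t - y)) *
      Real.sin (Real.pi * (t - x)) := by
  have h1 : orient (x : S1) (y : S1) (toPlane (t : S1)) =
      Real.sin (2 * (Real.pi * (y - x))) + Real.sin (2 * (Real.pi * (t - y)))
        - Real.sin (2 * (Real.pi * (y - x) + Real.pi * (t - y))) := by
    have e1 : 2 * (Real.pi * (y - x)) = 2 * Real.pi * y - 2 * Real.pi * x := by ring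
    have e2 : 2 * (Real.pi * (t - y)) = 2 * Real.pi * t - 2 * Real.pi * y := by ring
    have e3 : 2 * (Real.pi * (y - x) + Real.pi * (t - y)) = 2 * Real.pi * t - 2 * Real.pi * x := by
      ring
    rw [e1, e2, e3]
    simp only [orient_eq, toPlane_re_im, Real.sin_sub]
    ring
  have h2 : Real.pi * (t - x) = Real.pi * (y - x) + Real.pi * (t - y) := by ring
  rw [h1, h2]
  generalize Real.pi * (y - x) = u
  generalize Real.pi * (t - y) = w
  rw [Real.sin_two_mul (u + w), Real.sin_two_mul, Real.sin_two_mul, Real.sin_add, Real.cos_add]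
  linear_combination (-2 * Real.sin u * Real.cos u) * Real.sin_sq_add_cos_sq w
    + (-2 * Real.sin w * Real.cos w) * Real.sin_sq_add_cos_sq u

theorem orient_pos_iff (x y t : S1) : 0 < orient x y (toPlane t) ↔ sbtw x y t := by
  obtain ⟨x, -, -, rfl⟩ := exists_coe_Ico 0 x
  obtain ⟨y, y1, y2, rfl⟩ := exists_coe_Ico x y
  obtain ⟨t, t1, t2, rfl⟩ := exists_coe_Ico x t
  rw [sbtw_coe_iff y1 y2 t1 t2, orient_coe]
  have hpi := Real.pi_pos
  rcases y1.eq_or_lt with rfl | y1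
  · simp
  rcases t1.eq_or_lt with rfl | t1
  · simp [y1]
    linarith
  have h1 : 0 < Real.sin (Real.pi * (y - x)) :=
    Real.sin_pos_of_pos_of_lt_pi (by nlinarith) (by nlinarith)
  have h2 : 0 < Real.sin (Real.pi * (t - x)) :=
    Real.sin_pos_of_pos_of_lt_pi (by nlinarith) (by nlinarith)
  rw [mul_pos_iff_of_pos_right h2, mul_pos_iff_of_pos_left (by positivity)]
  constructor
  · intro h
    refine ⟨y1, ?_⟩
    by_contra h'
    have := Real.sin_nonpos_of_nonpos_of_neg_pi_le (x := Real.pi * (t - y)) (by nlinarith)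
      (by nlinarith)
    linarith
  · rintro ⟨-, h⟩
    exact Real.sin_pos_of_pos_of_lt_pi (by nlinarith) (by nlinarith)

theorem orient_nonneg_iff (x y t : S1) : 0 ≤ orient x y (toPlane t) ↔ ¬ sbtw y x t := by
  rw [← orient_pos_iff, orient_swap x y]
  simp

theorem orient_neg_iff (x y t : S1) : orient x y (toPlane t) < 0 ↔ sbtw x t y := by
  have h : sbtw x t y ↔ sbtw y x t := sbtw_cyclic
  rw [h, ← orient_pos_iff, orient_swap x y]
  simp

theorem chord_eq {l : Pairs} {x y : S1} (h : l.1 = s(x, y)) :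
    l.chord = segment ℝ (toPlane x) (toPlane y) := by
  have : {t | t ∈ l.1} = {x, y} := by ext t; simp [h]
  rw [Pairs.chord, this, image_pair, convexHull_pair]

theorem Pairs.ne {l : Pairs} {x y : S1} (h : l.1 = s(x, y)) : x ≠ y := by
  rintro rfl
  exact l.2 (by rw [h]; exact Sym2.mk_isDiag_iff.2 rfl)

theorem orient_mem_segment {x y : S1} {u v z : ℂ} {P : ℝ → Prop}
    (hP : ∀ a b r s : ℝ, 0 ≤ a → 0 ≤ b → a + b = 1 → P r → P s → P (a * r + b * s))
    (hu : P (orient x y u)) (hv : P (orient x y v)) (hz : z ∈ segment ℝ u v) :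
    P (orient x y z) := by
  obtain ⟨a, b, ha, hb, hab, rfl⟩ := hz
  rw [orient_combo x y hab]
  exact hP a b _ _ ha hb hab hu hv

theorem orient_nonneg_of_segment {x y : S1} {u v z : ℂ} (hu : 0 ≤ orient x y u)
    (hv : 0 ≤ orient x y v) (hz : z ∈ segment ℝ u v) : 0 ≤ orient x y z :=
  orient_mem_segment (P := fun r => 0 ≤ r) (fun _ _ _ _ _ _ _ _ _ => by positivity) hu hv hz

theorem orient_nonpos_of_segment {x y : S1} {u v z : ℂ} (hu : orient x y u ≤ 0)
    (hv : orient x y v ≤ 0) (hz : z ∈ segment ℝ u v) : orient x y z ≤ 0 :=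
  orient_mem_segment (P := fun r => r ≤ 0) (fun _ _ _ _ _ _ _ _ _ => by nlinarith) hu hv hz

theorem orient_neg_of_segment {x y : S1} {u v z : ℂ} (hu : orient x y u < 0)
    (hv : orient x y v < 0) (hz : z ∈ segment ℝ u v) : orient x y z < 0 :=
  orient_mem_segment (P := fun r => r < 0)
    (fun a b _ _ ha hb hab _ _ => by
      rcases ha.eq_or_lt with rfl | ha
      · obtain rfl : b = 1 := by linarith
        linarith
      · nlinarith) hu hv hz

theorem normSq_toPlane (x : S1) : (toPlane x).re ^ 2 + (toPlane x).im ^ 2 = 1 := by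
  have h := norm_toPlane x
  have h2 := Complex.sq_norm (toPlane x)
  rw [h, Complex.normSq_apply] at h2
  linarith

/-- A point of the closed disk on the line through two points of the circle is on their chord. -/
theorem mem_segment_of_orient_eq_zero {x y : S1} (hxy : x ≠ y) {z : ℂ} (hz : ‖z‖ ≤ 1)
    (h : orient x y z = 0) : z ∈ segment ℝ (toPlane x) (toPlane y) := by
  have hne : toPlane x ≠ toPlane y := fun h => hxy (toPlane_injective h)
  have hx := normSq_toPlane x
  have hy := normSq_toPlane y
  rw [orient_eq] at h
  have hz2 : z.re ^ 2 + z.im ^ 2 ≤ 1 := by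
    have h2 := Complex.sq_norm z
    rw [Complex.normSq_apply] at h2
    nlinarith [norm_nonneg z]
  have hpos : 0 < ((toPlane y).re - (toPlane x).re) ^ 2
      + ((toPlane y).im - (toPlane x).im) ^ 2 := by
    by_contra hc
    apply hne
    apply Complex.ext <;> nlinarith [sq_nonneg ((toPlane y).re - (toPlane x).re),
      sq_nonneg ((toPlane y).im - (toPlane x).im)]
  rw [segment_eq_image]
  generalize toPlane x = X at *
  generalize toPlane y = Y at *
  set q := (Y.re - X.re) ^ 2 + (Y.im - X.im) ^ 2 with hq
  set r := ((Y.re - X.re) * (z.re - X.re) + (Y.im - X.im) * (z.im - X.im)) / q with hr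
  have hrq : r * q = (Y.re - X.re) * (z.re - X.re) + (Y.im - X.im) * (z.im - X.im) :=
    div_mul_cancel₀ _ hpos.ne'
  have e1 : z.re = X.re + r * (Y.re - X.re) := by
    apply mul_right_cancel₀ hpos.ne'
    rw [add_mul, mul_right_comm, hrq, hq]
    linear_combination (-(Y.im - X.im)) * h
  have e2 : z.im = X.im + r * (Y.im - X.im) := by
    apply mul_right_cancel₀ hpos.ne'
    rw [add_mul, mul_right_comm, hrq, hq]
    linear_combination (Y.re - X.re) * h
  -- On the line, the norm squared is `1 - r (1 - r) q`.
  have h3 : 0 ≤ r * (1 - r) * q := by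
    have h5 : (X.re + r * (Y.re - X.re)) ^ 2 + (X.im + r * (Y.im - X.im)) ^ 2 =
        1 - r * (1 - r) * q := by
      rw [hq]; linear_combination (1 - r) * hx + r * hy
    rw [e1, e2, h5] at hz2
    linarith
  have h4 : 0 ≤ r * (1 - r) := nonneg_of_mul_nonneg_left h3 hpos
  refine ⟨r, ⟨?_, ?_⟩, ?_⟩
  · by_contra hc; nlinarith
  · by_contra hc; nlinarith
  · apply Complex.ext
    · simp only [Complex.add_re, Complex.smul_re, smul_eq_mul]; rw [e1]; ring
    · simp only [Complex.add_im, Complex.smul_im, smul_eq_mul]; rw [e2]; ring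

/-- A point of the closed disk lies on a chord that is perpendicular to a prescribed diameter. -/
theorem exists_mem_segment (m : ℝ) {z : ℂ} (hz : ‖z‖ ≤ 1) : ∃ θ : ℝ, 0 ≤ θ ∧ θ ≤ 1 / 2 ∧
    Real.cos (2 * Real.pi * θ) =
      z.re * Real.cos (2 * Real.pi * m) + z.im * Real.sin (2 * Real.pi * m) ∧
    z ∈ segment ℝ (toPlane ((m - θ : ℝ) : S1)) (toPlane ((m + θ : ℝ) : S1)) := by
  have hpi := Real.pi_pos
  have hz2 : z.re ^ 2 + z.im ^ 2 ≤ 1 := by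
    have h2 := Complex.sq_norm z
    rw [Complex.normSq_apply] at h2
    nlinarith [norm_nonneg z]
  have hm := Real.sin_sq_add_cos_sq (2 * Real.pi * m)
  simp only [toPlane_re_im, mul_sub, mul_add, Real.cos_sub, Real.cos_add, Real.sin_sub,
    Real.sin_add]
  generalize Real.cos (2 * Real.pi * m) = C at *
  generalize Real.sin (2 * Real.pi * m) = S at *
  set c := z.re * C + z.im * S with hc
  set d := z.im * C - z.re * S with hd
  have hcd : c ^ 2 + d ^ 2 ≤ 1 := by
    have : c ^ 2 + d ^ 2 = (z.re ^ 2 + z.im ^ 2) * (S ^ 2 + C ^ 2) := by rw [hc, hd]; ring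
    rw [this, hm]; linarith
  have hc1 : -1 ≤ c := by nlinarith [sq_nonneg d]
  have hc2 : c ≤ 1 := by nlinarith [sq_nonneg d]
  have hθ : 2 * Real.pi * (Real.arccos c / (2 * Real.pi)) = Real.arccos c := by field_simp
  refine ⟨Real.arccos c / (2 * Real.pi), by have := Real.arccos_nonneg c; positivity, ?_, ?_, ?_⟩
  · rw [div_le_iff₀ (by positivity)]
    have := Real.arccos_le_pi c
    linarith
  · rw [hθ, Real.cos_arccos hc1 hc2]
  · rw [hθ, Real.cos_arccos hc1 hc2, Real.sin_arccos]
    set T := √(1 - c ^ 2) with hT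
    have hT2 : T ^ 2 = 1 - c ^ 2 := Real.sq_sqrt (by nlinarith [sq_nonneg d])
    have hT0 : 0 ≤ T := Real.sqrt_nonneg _
    have hdT : d ^ 2 ≤ T ^ 2 := by linarith
    have hdT' := abs_le_of_sq_le_sq' hdT hT0
    have hdiv : d / T * T = d := by
      rcases hT0.eq_or_lt with h0 | h0
      · rw [← h0] at hdT ⊢
        have : d = 0 := by nlinarith
        rw [this]; simp
      · exact div_mul_cancel₀ _ h0.ne'
    have hq1 : d / T ≤ 1 := div_le_one_of_le₀ hdT'.2 hT0
    have hq2 : -1 ≤ d / T := by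
      rcases hT0.eq_or_lt with h0 | h0
      · rw [← h0]; simp
      · rw [le_div_iff₀ h0]; linarith
    generalize d / T = q at *
    refine ⟨(1 - q) / 2, (1 + q) / 2, by linarith, by linarith, by ring, ?_⟩
    have hz1 : z.re = c * C - d * S := by
      rw [hc, hd]; linear_combination (-z.re) * hm
    have hz3 : z.im = c * S + d * C := by
      rw [hc, hd]; linear_combination (-z.im) * hm
    apply Complex.ext
    · simp only [Complex.add_re, Complex.smul_re, smul_eq_mul]
      rw [hz1]; linear_combination (-S) * hdiv
    · simp only [Complex.add_im, Complex.smul_im, smul_eq_mul]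
      rw [hz3]; linear_combination C * hdiv

/-- The part of the disk beyond a chord is covered by the chords of pairs of points of the open
arc that the chord cuts off. -/
theorem exists_sbtw_of_orient_neg {x y : S1} {z : ℂ} (hz : ‖z‖ ≤ 1) (h : orient x y z < 0) :
    ∃ t u : S1, sbtw x t y ∧ sbtw x u y ∧ z ∈ segment ℝ (toPlane t) (toPlane u) := by
  obtain ⟨x, -, -, rfl⟩ := exists_coe_Ico 0 x
  obtain ⟨y, y1, y2, rfl⟩ := exists_coe_Ico x y
  rcases y1.eq_or_lt with rfl | y1
  · simp [orient_eq] at h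
  obtain ⟨θ, h0, h1, -, h2⟩ := exists_mem_segment ((x + y) / 2) hz
  rcases lt_or_ge θ ((y - x) / 2) with h3 | h3
  · refine ⟨_, _, ?_, ?_, h2⟩
    · exact (sbtw_coe_iff (by linarith) (by linarith) y1.le y2).2 ⟨by linarith, by linarith⟩
    · exact (sbtw_coe_iff (by linarith) (by linarith) y1.le y2).2 ⟨by linarith, by linarith⟩
  · exfalso
    have key : ∀ t ∈ arc y (x + 1), 0 ≤ orient (x : S1) (y : S1) (toPlane t) := by
      intro t ht
      rw [orient_nonneg_iff]
      intro hs
      have := not_sbtw_of_mem_arc (x := y) (y := x + 1) (by linarith) (by linarith) ht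
      rw [coe_add_one] at this
      exact this (sbtw_cyclic_left hs)
    have := orient_nonneg_of_segment (key _ ?_) (key _ ?_) h2
    · linarith
    · rw [← coe_add_one]
      exact mem_arc_of (by linarith) (by linarith)
    · exact mem_arc_of (by linarith) (by linarith)

/-- The pairs of cyclically consecutive points of a finite set of points of the circle. -/
def Edge (V : Finset S1) (x y : S1) : Prop :=
  x ∈ V ∧ y ∈ V ∧ x ≠ y ∧ ∀ t ∈ V, ¬ sbtw x t y

/-- The interior of the ideal polygon with vertex set `V`. -/
def polygonInterior (V : Finset S1) : Set ℂ :=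
  {z | ‖z‖ < 1 ∧ ∀ x y, Edge V x y → 0 < orient x y z}

theorem Edge.orient_nonneg {V : Finset S1} {x y : S1} (h : Edge V x y) {z : ℂ}
    (hz : z ∈ convexHull ℝ (toPlane '' (V : Set S1))) : 0 ≤ orient x y z := by
  have h1 : convexHull ℝ (toPlane '' (V : Set S1)) ⊆ {z | 0 ≤ orient x y z} := by
    apply convexHull_min
    · rintro _ ⟨t, ht, rfl⟩
      rw [mem_ofPred_eq, ← not_lt, orient_neg_iff]
      exact h.2.2.2 t ht
    · intro u hu v hv a b ha hb hab
      rw [mem_ofPred_eq] at *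
      rw [orient_combo x y hab]
      positivity
  exact h1 hz

theorem mem_convexHull_of_orient_nonneg {V : Finset S1} (hV : 2 ≤ V.card) {z : ℂ} (hz : ‖z‖ ≤ 1)
    (h : ∀ x y, Edge V x y → 0 ≤ orient x y z) :
    z ∈ convexHull ℝ (toPlane '' (V : Set S1)) := by
  by_contra hc
  -- Separate `z` from the hull by a linear form `w ↦ r Re (conj (exp (i φ)) w)`.
  obtain ⟨f, u, hf1, hf2⟩ := geometric_hahn_banach_closed_point (convex_convexHull ℝ _)
    ((V.finite_toSet.image toPlane).isClosed_convexHull ℝ) hc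
  have hfV : ∀ t ∈ V, f (toPlane t) < f z := fun t ht =>
    (hf1 _ (subset_convexHull ℝ _ ⟨t, ht, rfl⟩)).trans hf2
  have hf : ∀ w : ℂ, f w = w.re * f 1 + w.im * f Complex.I := by
    intro w
    have : w = w.re • (1 : ℂ) + w.im • Complex.I := by
      apply Complex.ext <;> simp
    conv_lhs => rw [this]
    simp only [map_add, map_smul, smul_eq_mul]
  set g : ℂ := ⟨f 1, f Complex.I⟩ with hg
  set r := ‖g‖ with hr
  set m := Complex.arg g / (2 * Real.pi) with hm
  have hpi := Real.pi_pos
  have hm2 : 2 * Real.pi * m = Complex.arg g := by rw [hm]; field_simp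
  have hf' : ∀ w : ℂ, f w =
      r * (w.re * Real.cos (2 * Real.pi * m) + w.im * Real.sin (2 * Real.pi * m)) := by
    intro w
    have e1 : r * Real.cos (Complex.arg g) = f 1 := Complex.norm_mul_cos_arg g
    have e2 : r * Real.sin (Complex.arg g) = f Complex.I := Complex.norm_mul_sin_arg g
    rw [hf, hm2, ← e1, ← e2]; ring
  obtain ⟨θ, h0, h1, h2, h3⟩ := exists_mem_segment m hz
  have hout : ∀ t : ℝ, (t : S1) ∈ V → m - θ ≤ t → t ≤ m + θ → False := by
    intro t ht t1 t2
    have h4 := hfV _ ht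
    rw [hf', hf', ← h2, toPlane_re_im] at h4
    have h5 : Real.cos (2 * Real.pi * t) * Real.cos (2 * Real.pi * m) +
        Real.sin (2 * Real.pi * t) * Real.sin (2 * Real.pi * m) =
        Real.cos (2 * Real.pi * |t - m|) := by
      rw [← Real.cos_sub, ← Real.cos_abs]
      congr 1
      rw [← mul_sub, abs_mul, abs_of_pos (by positivity : 0 < 2 * Real.pi)]
    rw [h5] at h4
    have h6 : |t - m| ≤ θ := abs_le.2 ⟨by linarith, by linarith⟩
    have h7 := Real.cos_le_cos_of_nonneg_of_le_pi (x := 2 * Real.pi * |t - m|)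
      (y := 2 * Real.pi * θ) (by positivity) (by nlinarith) (by gcongr)
    have := mul_le_mul_of_nonneg_left h7 (norm_nonneg g)
    linarith
  -- The vertices next to the arc that `z` cuts off span an edge with `z` beyond it.
  choose φ φ1 φ2 φ3 using fun t : S1 => exists_coe_Ico (m - θ) t
  have hφ : ∀ t ∈ V, m + θ < φ t := by
    intro t ht
    by_contra hc
    exact hout (φ t) (by rwa [φ3]) (φ1 t) (by linarith)
  have hne : V.Nonempty := Finset.card_pos.1 (by omega)
  obtain ⟨x, hx, hx'⟩ := V.exists_max_image φ hne
  obtain ⟨y, hy, hy'⟩ := V.exists_min_image φ hne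
  have hxy : x ≠ y := by
    rintro rfl
    obtain ⟨t, ht, htx⟩ := Finset.exists_mem_ne (by omega : 1 < V.card) x
    apply htx
    rw [← φ3 t, ← φ3 x, le_antisymm (hx' t ht) (hy' t ht)]
  have hlt : φ y < φ x := lt_of_le_of_ne (hy' x hx) (fun e => hxy (by rw [← φ3 x, ← φ3 y, e]))
  have key : ∀ t : ℝ, φ x ≤ t → t < φ x + 1 →
      (sbtw x (t : S1) y ↔ φ x < t ∧ t < φ y + 1) := by
    intro t t1 t2
    have := sbtw_coe_iff t1 t2 (z := φ y + 1) (by linarith [φ1 y, φ2 x]) (by linarith)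
    rwa [coe_add_one, φ3, φ3] at this
  have hedge : Edge V x y := by
    refine ⟨hx, hy, hxy, fun t ht hs => ?_⟩
    rcases (hx' t ht).eq_or_lt with e | e
    · rw [← φ3 t, e, φ3] at hs
      exact sbtw_irrefl_left hs
    · rw [← φ3 t, ← coe_add_one, key _ (by linarith [φ1 t, φ2 x]) (by linarith)] at hs
      linarith [hy' t ht]
  have hx2 := φ2 x
  have hy2 := hφ y hy
  have h8 := orient_neg_of_segment (x := x) (y := y) ?_ ?_ h3
  · linarith [h x y hedge]
  · rw [orient_neg_iff, ← coe_add_one, key _ (by linarith) (by linarith)]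
    exact ⟨by linarith, by linarith⟩
  · rw [orient_neg_iff, ← coe_add_one, key _ (by linarith) (by linarith)]
    exact ⟨by linarith, by linarith⟩

theorem sbtw_of_not_sbtw {x y t : S1} (hxy : x ≠ y) (hx : t ≠ x) (hy : t ≠ y)
    (h : ¬ sbtw x t y) : sbtw x y t := by
  rw [sbtw_iff_not_btw]
  intro h2
  rw [← btw_iff_not_sbtw] at h
  rcases h.antisymm (btw_cyclic_right h2) with e | e | e
  all_goals simp_all

theorem polygonInterior_nonempty {V : Finset S1} (hV : 3 ≤ V.card) :
    (polygonInterior V).Nonempty := by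
  classical
  have hopen : IsOpen {z : ℂ | ∀ x ∈ V, ∀ y ∈ V, Edge V x y → 0 < orient x y z} := by
    simp only [ofPred_forall]
    refine isOpen_biInter_finset fun x _ => isOpen_biInter_finset fun y _ => isOpen_iInter_of_finite
      fun _ => isOpen_lt continuous_const ?_
    exact continuous_orient.comp (by fun_prop : Continuous fun z : ℂ => ((x, y), z))
  set z₀ : ℂ := ∑ v ∈ V, (V.card : ℝ)⁻¹ • toPlane v with hz₀
  have hn : (0 : ℝ) < V.card := by exact_mod_cast (by omega : 0 < V.card)
  have hz1 : z₀ ∈ closure (Metric.ball (0 : ℂ) 1) := by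
    rw [closure_ball _ one_ne_zero, mem_closedBall_zero_iff, hz₀]
    refine (norm_sum_le _ _).trans ?_
    simp only [norm_smul, norm_toPlane, norm_inv, Real.norm_natCast, mul_one, Finset.sum_const,
      nsmul_eq_mul]
    rw [mul_inv_cancel₀ hn.ne']
  have hz2 : ∀ x ∈ V, ∀ y ∈ V, Edge V x y → 0 < orient x y z₀ := by
    intro x hx y hy hE
    have e : orient x y z₀ = ∑ v ∈ V, (V.card : ℝ)⁻¹ * orient x y (toPlane v) := by
      have hc : (1 : ℝ) = ∑ v ∈ V, (V.card : ℝ)⁻¹ := by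
        rw [Finset.sum_const, nsmul_eq_mul, mul_inv_cancel₀ hn.ne']
      have hre : z₀.re - (toPlane x).re =
          ∑ v ∈ V, (V.card : ℝ)⁻¹ * ((toPlane v).re - (toPlane x).re) := by
        simp only [hz₀, Complex.re_sum, Complex.smul_re, smul_eq_mul, mul_sub,
          Finset.sum_sub_distrib, ← Finset.sum_mul]
        rw [← hc, one_mul]
      have him : z₀.im - (toPlane x).im =
          ∑ v ∈ V, (V.card : ℝ)⁻¹ * ((toPlane v).im - (toPlane x).im) := by
        simp only [hz₀, Complex.im_sum, Complex.smul_im, smul_eq_mul, mul_sub,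
          Finset.sum_sub_distrib, ← Finset.sum_mul]
        rw [← hc, one_mul]
      rw [orient_eq, hre, him, Finset.mul_sum, Finset.mul_sum, ← Finset.sum_sub_distrib]
      refine Finset.sum_congr rfl fun v _ => ?_
      rw [orient_eq]; ring
    rw [e]
    obtain ⟨t, ht, ht'⟩ : ∃ t ∈ V, t ∉ ({x, y} : Finset S1) := by
      by_contra hc
      push Not at hc
      have := Finset.card_le_card (fun t ht => hc t ht : V ⊆ {x, y})
      have := Finset.card_le_two (a := x) (b := y)
      omega
    simp only [Finset.mem_insert, Finset.mem_singleton, not_or] at ht'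
    refine Finset.sum_pos' (fun v hv => ?_) ⟨t, ht, ?_⟩
    · have : 0 ≤ orient x y (toPlane v) := by
        rw [← not_lt, orient_neg_iff]
        exact hE.2.2.2 v hv
      positivity
    · have : 0 < orient x y (toPlane t) :=
        (orient_pos_iff _ _ _).2 (sbtw_of_not_sbtw hE.2.2.1 ht'.1 ht'.2 (hE.2.2.2 t ht))
      positivity
  obtain ⟨z, h1, h2⟩ := mem_closure_iff.1 hz1 _ hopen hz2
  exact ⟨z, by simpa using h2, fun x y h => h1 x h.1 y h.2.1 h⟩

theorem closure_polygonInterior {V : Finset S1} (hV : 3 ≤ V.card) :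
    closure (polygonInterior V) = convexHull ℝ (toPlane '' (V : Set S1)) := by
  apply Subset.antisymm
  · apply closure_minimal _ ((V.finite_toSet.image toPlane).isClosed_convexHull ℝ)
    intro z hz
    exact mem_convexHull_of_orient_nonneg (by omega) hz.1.le fun x y h => (hz.2 x y h).le
  · intro z hz
    obtain ⟨z₀, hz₀⟩ := polygonInterior_nonempty hV
    have hz1 : ‖z‖ ≤ 1 := by
      have : convexHull ℝ (toPlane '' (V : Set S1)) ⊆ Metric.closedBall 0 1 := by
        apply convexHull_min _ (convex_closedBall _ _)
        rintro _ ⟨t, -, rfl⟩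
        simp [norm_toPlane]
      simpa using this hz
    have hsub : openSegment ℝ z₀ z ⊆ polygonInterior V := by
      rintro _ ⟨a, b, ha, hb, hab, rfl⟩
      refine ⟨?_, fun x y h => ?_⟩
      · refine (norm_add_le _ _).trans_lt ?_
        rw [norm_smul, norm_smul, Real.norm_of_nonneg ha.le, Real.norm_of_nonneg hb.le]
        nlinarith [hz₀.1]
      · rw [orient_combo x y hab]
        have := hz₀.2 x y h
        have := h.orient_nonneg hz
        positivity
    exact closure_mono hsub (segment_subset_closure_openSegment (right_mem_segment ℝ z₀ z))

theorem convex_polygonInterior (V : Finset S1) : Convex ℝ (polygonInterior V) := by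
  intro u hu v hv a b ha hb hab
  refine ⟨?_, fun x y h => ?_⟩
  · have := convex_ball (0 : ℂ) 1 (mem_ball_zero_iff.2 hu.1) (mem_ball_zero_iff.2 hv.1) ha hb hab
    simpa using this
  · rw [orient_combo x y hab]
    have h1 := hu.2 x y h
    have h2 := hv.2 x y h
    rcases ha.eq_or_lt with rfl | ha
    · obtain rfl : b = 1 := by linarith
      linarith
    · positivity

namespace Lamination

/-- A finite set `V` of at least three points is a polygon of `L` if its edges are leaves and no
leaf crosses its interior, i.e. every leaf is on the far side of an edge. -/
structure IsPolygon (L : Lamination) (V : Finset S1) : Prop where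
  card : 3 ≤ V.card
  edge : ∀ x y, Edge V x y → ∃ l ∈ L.leaves, l.1 = s(x, y)
  side : ∀ l ∈ L.leaves, ∃ x y, Edge V x y ∧ ∀ t ∈ l.1, ¬ sbtw y t x

variable {L : Lamination} {V : Finset S1}

theorem IsPolygon.polygonInterior_subset (h : L.IsPolygon V) :
    polygonInterior V ⊆ L.complementInDisk := by
  intro z hz
  refine ⟨mem_ball_zero_iff.2 hz.1, ?_⟩
  simp only [mem_iUnion, not_exists]
  intro l hl hzl
  obtain ⟨x, y, hE, hs⟩ := h.side l hl
  obtain ⟨a, b, hab⟩ : ∃ a b, l.1 = s(a, b) := ⟨_, _, (Quot.out_eq l.1).symm⟩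
  rw [chord_eq hab] at hzl
  have key : ∀ t ∈ l.1, orient x y (toPlane t) ≤ 0 := by
    intro t ht
    rw [← not_lt, orient_pos_iff]
    intro h'
    exact hs t ht (sbtw_cyclic_left h')
  have := orient_nonpos_of_segment (key a (by simp [hab])) (key b (by simp [hab])) hzl
  linarith [hz.2 x y hE]

theorem IsPolygon.component_eq (h : L.IsPolygon V) {z : ℂ} (hz : z ∈ polygonInterior V) :
    connectedComponentIn L.complementInDisk z = polygonInterior V := by
  apply Subset.antisymm
  · intro w hw
    have hsub := connectedComponentIn_subset L.complementInDisk z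
    refine ⟨mem_ball_zero_iff.1 (hsub hw).1, fun x y hE => ?_⟩
    by_contra hc
    have hpre : IsPreconnected (connectedComponentIn L.complementInDisk z) :=
      isPreconnected_connectedComponentIn
    have hzz : z ∈ connectedComponentIn L.complementInDisk z :=
      mem_connectedComponentIn (h.polygonInterior_subset hz)
    have hcont : ContinuousOn (orient x y) (connectedComponentIn L.complementInDisk z) :=
      (continuous_orient.comp (by fun_prop : Continuous fun z : ℂ => ((x, y), z))).continuousOn
    obtain ⟨u, hu, hu0⟩ := hpre.intermediate_value hw hzz hcont
      (show (0 : ℝ) ∈ Icc _ _ from ⟨not_lt.1 hc, (hz.2 x y hE).le⟩)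
    obtain ⟨l, hl, hlxy⟩ := h.edge x y hE
    apply (hsub hu).2
    simp only [mem_iUnion]
    refine ⟨l, hl, ?_⟩
    rw [chord_eq hlxy]
    exact mem_segment_of_orient_eq_zero hE.2.2.1 (mem_ball_zero_iff.1 (hsub hu).1).le hu0
  · exact (convex_polygonInterior V).isPreconnected.subset_connectedComponentIn hz
      h.polygonInterior_subset

theorem IsPolygon.isGap (h : L.IsPolygon V) :
    L.IsGap (convexHull ℝ (toPlane '' (V : Set S1))) := by
  obtain ⟨z, hz⟩ := polygonInterior_nonempty h.card
  exact ⟨z, h.polygonInterior_subset hz, by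
    rw [h.component_eq hz, closure_polygonInterior h.card]⟩

theorem isEdge_of_edge {x y : S1} (hE : Edge V x y) (hV : 3 ≤ V.card) {l : Pairs}
    (hl : l.1 = s(x, y)) :
    IsEdge l (convexHull ℝ (toPlane '' (V : Set S1))) := by
  rw [IsEdge, chord_eq hl]
  intro z hz
  have hcl : z ∈ convexHull ℝ (toPlane '' (V : Set S1)) :=
    (convex_convexHull ℝ _).segment_subset
      (subset_convexHull ℝ _ (mem_image_of_mem toPlane hE.1))
      (subset_convexHull ℝ _ (mem_image_of_mem toPlane hE.2.1)) hz
  have h0 : orient x y z = 0 := by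
    apply le_antisymm
    · exact orient_nonpos_of_segment (orient_left x y).le (orient_right x y).le hz
    · exact orient_nonneg_of_segment (orient_left x y).ge (orient_right x y).ge hz
  rw [((V.finite_toSet.image toPlane).isClosed_convexHull ℝ).frontier_eq]
  refine ⟨hcl, fun hint => ?_⟩
  -- Moving from `z` slightly away from an interior point leaves the hull.
  obtain ⟨z₀, hz₀⟩ := polygonInterior_nonempty hV
  have hcont : Continuous fun r : ℝ => (1 + r) • z + (-r) • z₀ := by fun_prop
  have hmem : ∀ᶠ r in 𝓝 (0 : ℝ), (1 + r) • z + (-r) • z₀ ∈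
      convexHull ℝ (toPlane '' (V : Set S1)) := by
    apply hcont.continuousAt.eventually_mem
    simpa using mem_interior_iff_mem_nhds.1 hint
  obtain ⟨r, hr0, hr⟩ := ((hmem.filter_mono (nhdsWithin_le_nhds (s := Ioi 0))).and
    self_mem_nhdsWithin).exists
  have h1 := hE.orient_nonneg hr0
  rw [orient_combo x y (by ring), h0] at h1
  have h2 := hz₀.2 x y hE
  have hr' : (0 : ℝ) < r := hr
  nlinarith

/-- If polygons of `L` fill the complement of the leaves, all gaps are ideal polygons. -/
theorem isVeryFull_of_forall_mem (h : ∀ z ∈ L.complementInDisk,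
    ∃ V, L.IsPolygon V ∧ z ∈ polygonInterior V) : L.IsVeryFull := by
  rintro P ⟨z, hz, rfl⟩
  obtain ⟨V, hV, hzV⟩ := h z hz
  exact ⟨V, hV.card, by rw [hV.component_eq hzV, closure_polygonInterior hV.card]⟩

/-- Every vertex of a polygon of `L` is an endpoint of a leaf. -/
theorem IsPolygon.mem_ends (h : L.IsPolygon V) {v : S1} (hv : v ∈ V) : v ∈ L.Ends := by
  classical
  obtain ⟨w, -, -, rfl⟩ := exists_coe_Ico 0 v
  choose φ φ1 φ2 φ3 using fun t : S1 => exists_coe_Ico w t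
  have hne : (V.erase (w : S1)).Nonempty := by
    rw [← Finset.card_pos, Finset.card_erase_of_mem hv]
    have := h.card
    omega
  -- The edge leads from the vertex to the next one.
  obtain ⟨y, hy, hy'⟩ := (V.erase (w : S1)).exists_min_image φ hne
  have hyw := Finset.ne_of_mem_erase hy
  obtain ⟨l, hl, hle⟩ := h.edge w y ⟨hv, Finset.mem_of_mem_erase hy, hyw.symm, fun t ht hs => by
    have htw : t ≠ w := by
      rintro rfl
      exact sbtw_irrefl_left hs
    rw [← φ3 t, ← φ3 y, sbtw_coe_iff (φ1 t) (φ2 t) (φ1 y) (φ2 y)] at hs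
    linarith [hy' t (Finset.mem_erase.2 ⟨htw, ht⟩)]⟩
  exact ⟨l, hl, by simp [hle]⟩

/-- If polygons of `L` fill the complement of the leaves, the endpoints of the leaves are dense. -/
theorem isDense_of_forall_mem (h : ∀ z ∈ L.complementInDisk,
    ∃ V, L.IsPolygon V ∧ z ∈ polygonInterior V) : L.IsDense := by
  rw [IsDense, dense_iff_inter_open]
  rintro U hU ⟨t, ht⟩
  obtain ⟨x, -, -, rfl⟩ := exists_coe_Ico 0 t
  have hnhds : ∀ᶠ u : ℝ in 𝓝 x, (u : S1) ∈ U :=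
    (AddCircle.continuous_mk' (1 : ℝ)).continuousAt.eventually_mem (hU.mem_nhds ht)
  obtain ⟨ε, hε, hε'⟩ := Metric.eventually_nhds_iff.1 hnhds
  set δ := min (ε / 2) (1 / 4) with hδ
  have hδ0 : 0 < δ := by positivity
  have hδ1 : δ < ε := (min_le_left _ _).trans_lt (by linarith)
  have hδ2 : δ ≤ 1 / 4 := min_le_right _ _
  have hmemU : ∀ t : S1, sbtw ((x - δ : ℝ) : S1) t ((x + δ : ℝ) : S1) → t ∈ U := by
    intro t ht
    obtain ⟨u, u1, u2, rfl⟩ := exists_coe_Ico (x - δ) t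
    rw [sbtw_coe_iff u1 u2 (by linarith) (by linarith)] at ht
    apply hε'
    rw [Real.dist_eq, abs_lt]
    constructor <;> linarith
  -- A point of the open disk beyond the chord of a small arc around `x`.
  obtain ⟨z, hz1, hz2⟩ : ∃ z : ℂ, ‖z‖ < 1 ∧
      orient ((x - δ : ℝ) : S1) ((x + δ : ℝ) : S1) z < 0 := by
    have h1 : toPlane (x : S1) ∈ closure (Metric.ball (0 : ℂ) 1) := by
      rw [closure_ball _ one_ne_zero, mem_closedBall_zero_iff, norm_toPlane]
    have h2 : orient ((x - δ : ℝ) : S1) ((x + δ : ℝ) : S1) (toPlane x) < 0 := by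
      rw [orient_neg_iff, sbtw_coe_iff (by linarith) (by linarith) (by linarith) (by linarith)]
      constructor <;> linarith
    obtain ⟨z, h3, h4⟩ := mem_closure_iff.1 h1
      {z | orient ((x - δ : ℝ) : S1) ((x + δ : ℝ) : S1) z < 0}
      (isOpen_lt (continuous_orient.comp (by fun_prop : Continuous fun z : ℂ =>
        ((((x - δ : ℝ) : S1), ((x + δ : ℝ) : S1)), z))) continuous_const) h2
    exact ⟨z, by simpa using h4, h3⟩
  by_contra hc
  have hends : ∀ t ∈ L.Ends,
      0 ≤ orient ((x - δ : ℝ) : S1) ((x + δ : ℝ) : S1) (toPlane t) := by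
    intro t ht
    rw [← not_lt, orient_neg_iff]
    exact fun hs => hc ⟨t, hmemU t hs, ht⟩
  by_cases hz : z ∈ L.complementInDisk
  · obtain ⟨V, hV, hzV⟩ := h z hz
    have h1 := subset_closure hzV
    rw [closure_polygonInterior hV.card] at h1
    have h2 : convexHull ℝ (toPlane '' (V : Set S1)) ⊆
        {z | 0 ≤ orient ((x - δ : ℝ) : S1) ((x + δ : ℝ) : S1) z} := by
      apply convexHull_min
      · rintro _ ⟨t, ht, rfl⟩
        exact hends t (hV.mem_ends ht)
      · intro u hu v hv a b ha hb hab
        rw [mem_ofPred_eq] at *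
        rw [orient_combo _ _ hab]
        positivity
    exact absurd (h2 h1) (not_le.2 hz2)
  · simp only [complementInDisk, mem_sdiff, mem_ball_zero_iff, hz1, true_and, not_not,
      mem_iUnion] at hz
    obtain ⟨l, hl, hzl⟩ := hz
    obtain ⟨a, b, hab⟩ : ∃ a b, l.1 = s(a, b) := ⟨_, _, (Quot.out_eq l.1).symm⟩
    rw [chord_eq hab] at hzl
    have := orient_nonneg_of_segment (hends a ⟨l, hl, by simp [hab]⟩)
      (hends b ⟨l, hl, by simp [hab]⟩) hzl
    linarith

end Lamination

/-- Criterion for a symmetric relation on the circle to give a closed set of pairs. -/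
theorem isClosed_pairs {R : Set (S1 × S1)} (hsymm : ∀ x y, (x, y) ∈ R → (y, x) ∈ R)
    (hR : IsClosed (R ∪ {p | p.1 = p.2})) :
    IsClosed {l : Pairs | ∃ x y, l.1 = s(x, y) ∧ (x, y) ∈ R} := by
  have h1 : IsClosed {s : Sym2 S1 | ∃ x y, s = s(x, y) ∧ (x, y) ∈ R ∪ {p | p.1 = p.2}} := by
    have hq : IsQuotientMap (Quot.mk (Sym2.Rel S1) : S1 × S1 → Sym2 S1) := isQuotientMap_quot_mk
    rw [← hq.isClosed_preimage]
    convert hR using 1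
    ext ⟨a, b⟩
    constructor
    · rintro ⟨x, y, h, hxy⟩
      have h : s(a, b) = s(x, y) := h
      rw [Sym2.eq_iff] at h
      rcases h with ⟨rfl, rfl⟩ | ⟨rfl, rfl⟩
      · exact hxy
      · exact hxy.imp (hsymm _ _) Eq.symm
    · exact fun h => ⟨a, b, rfl, h⟩
  convert h1.preimage continuous_subtype_val using 1
  ext l
  constructor
  · rintro ⟨x, y, h, hR⟩
    exact ⟨x, y, h, Or.inl hR⟩
  · rintro ⟨x, y, h, hR | hR⟩
    · exact ⟨x, y, h, hR⟩
    · exact absurd hR (Pairs.ne h)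

/-- The union of a family of closed sets of pairs of points that accumulates only at the diagonal is
closed up to the diagonal. -/
theorem isClosed_iUnion_union_diagonal {X ι : Type*} [MetricSpace X] (F : ι → Set (X × X))
    (hF : ∀ i, IsClosed (F i))
    (hfin : ∀ δ > 0, {i | ∃ p ∈ F i, δ ≤ dist p.1 p.2}.Finite) :
    IsClosed ((⋃ i, F i) ∪ {p | p.1 = p.2}) := by
  rw [← isOpen_compl_iff, isOpen_iff_mem_nhds]
  intro p hp
  simp only [mem_compl_iff, mem_union, mem_iUnion, not_or, not_exists, mem_ofPred_eq] at hp
  have hd : 0 < dist p.1 p.2 := dist_pos.2 hp.2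
  have hfin' := hfin _ (half_pos hd)
  have h1 : (⋃ i ∈ {i | ∃ p' ∈ F i, dist p.1 p.2 / 2 ≤ dist p'.1 p'.2}, F i)ᶜ ∈ 𝓝 p := by
    apply (hfin'.isClosed_biUnion fun i _ => hF i).isOpen_compl.mem_nhds
    simp only [mem_compl_iff, mem_iUnion, not_exists]
    exact fun i _ => hp.1 i
  have h2 : {q : X × X | dist p.1 p.2 / 2 < dist q.1 q.2} ∈ 𝓝 p :=
    (isOpen_lt continuous_const (by fun_prop)).mem_nhds (by simpa using hp.2)
  filter_upwards [h1, h2] with q hq1 hq2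
  simp only [mem_compl_iff, mem_union, mem_iUnion, not_or, not_exists, mem_ofPred_eq] at hq1 hq2 ⊢
  refine ⟨fun i hi => hq1 i ⟨q, hi, hq2.le⟩ hi, fun e => ?_⟩
  rw [e, dist_self] at hq2
  linarith

/-! ### A thin Cantor set -/

/-- The point of `[0, 1]` whose expansion in base `8` has the digits `7` and `0` given by `β`. -/
def cantorPoint (β : ℕ → Bool) : ℝ := ∑' n, (if β n then 7 / 8 else 0) * (1 / 8 : ℝ) ^ n

/-- The Cantor set of all numbers in `[0, 1]` with digits `0` and `7` in base `8`. The set of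
differences of two affine copies of it is a null set. -/
def cantor : Set ℝ := range cantorPoint

theorem summable_cantorPoint (β : ℕ → Bool) :
    Summable fun n => (if β n then 7 / 8 else 0) * (1 / 8 : ℝ) ^ n := by
  refine Summable.of_nonneg_of_le (fun n => by split_ifs <;> positivity) (fun n => ?_)
    (summable_geometric_of_lt_one (r := (1 / 8 : ℝ)) (by norm_num) (by norm_num))
  have : (0 : ℝ) < (1 / 8) ^ n := by positivity
  split_ifs <;> linarith

theorem cantorPoint_succ (β : ℕ → Bool) :
    cantorPoint β = (if β 0 then 7 / 8 else 0) + cantorPoint (fun n => β (n + 1)) / 8 := by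
  unfold cantorPoint
  rw [(summable_cantorPoint β).tsum_eq_zero_add, pow_zero, mul_one, ← tsum_div_const]
  congr 1
  exact tsum_congr fun n => by rw [pow_succ]; ring

theorem cantorPoint_nonneg (β : ℕ → Bool) : 0 ≤ cantorPoint β :=
  tsum_nonneg fun n => by split_ifs <;> positivity

theorem cantorPoint_true : cantorPoint (fun _ => true) = 1 := by
  simp only [cantorPoint, if_true]
  rw [tsum_mul_left, tsum_geometric_of_lt_one (by norm_num) (by norm_num)]
  norm_num

theorem cantorPoint_false : cantorPoint (fun _ => false) = 0 := by simp [cantorPoint]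

theorem cantorPoint_le_one (β : ℕ → Bool) : cantorPoint β ≤ 1 := by
  rw [← cantorPoint_true]
  refine (summable_cantorPoint β).tsum_le_tsum (fun n => ?_) (summable_cantorPoint _)
  have : (0 : ℝ) < (1 / 8) ^ n := by positivity
  simp only [if_true]
  split_ifs <;> nlinarith

theorem cantor_nonneg {k : ℝ} (hk : k ∈ cantor) : 0 ≤ k := by
  obtain ⟨β, rfl⟩ := hk; exact cantorPoint_nonneg β

theorem cantor_le_one {k : ℝ} (hk : k ∈ cantor) : k ≤ 1 := by
  obtain ⟨β, rfl⟩ := hk; exact cantorPoint_le_one β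

theorem zero_mem_cantor : (0 : ℝ) ∈ cantor := ⟨_, cantorPoint_false⟩

theorem one_mem_cantor : (1 : ℝ) ∈ cantor := ⟨_, cantorPoint_true⟩

theorem cantor_left {k : ℝ} (hk : k ∈ cantor) : k / 8 ∈ cantor := by
  obtain ⟨β, rfl⟩ := hk
  refine ⟨fun n => Nat.casesOn n false β, ?_⟩
  rw [cantorPoint_succ]
  simp

theorem cantor_right {k : ℝ} (hk : k ∈ cantor) : 7 / 8 + k / 8 ∈ cantor := by
  obtain ⟨β, rfl⟩ := hk
  refine ⟨fun n => Nat.casesOn n true β, ?_⟩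
  rw [cantorPoint_succ]
  simp

theorem exists_of_mem_cantor {k : ℝ} (hk : k ∈ cantor) :
    ∃ l ∈ cantor, k = l / 8 ∨ k = 7 / 8 + l / 8 := by
  obtain ⟨β, rfl⟩ := hk
  refine ⟨_, ⟨fun n => β (n + 1), rfl⟩, ?_⟩
  rw [cantorPoint_succ]
  cases β 0 <;> simp

theorem abs_cantorPoint_sub_le (n : ℕ) : ∀ β γ : ℕ → Bool, (∀ i < n, β i = γ i) →
    |cantorPoint β - cantorPoint γ| ≤ (1 / 8) ^ n := by
  induction n with
  | zero =>
    intro β γ _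
    have := cantorPoint_nonneg β
    have := cantorPoint_nonneg γ
    have := cantorPoint_le_one β
    have := cantorPoint_le_one γ
    rw [pow_zero, abs_le]
    constructor <;> linarith
  | succ n ih =>
    intro β γ h
    rw [cantorPoint_succ β, cantorPoint_succ γ, h 0 (by omega), add_sub_add_left_eq_sub, ← sub_div,
      abs_div, abs_of_pos (by norm_num : (0 : ℝ) < 8), pow_succ]
    have := ih _ _ fun i hi => h (i + 1) (by omega)
    linarith

theorem isCompact_cantor : IsCompact cantor := by
  refine isCompact_range (continuous_tsum (fun n => ?_)
    (summable_geometric_of_lt_one (r := (1 / 8 : ℝ)) (by norm_num) (by norm_num)) fun n β => ?_)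
  · have h1 : Continuous fun b : Bool => (if b then 7 / 8 else 0 : ℝ) :=
      continuous_of_discreteTopology
    exact (h1.comp (continuous_apply n)).mul continuous_const
  · have : (0 : ℝ) < (1 / 8) ^ n := by positivity
    rw [Real.norm_of_nonneg (by split_ifs <;> positivity)]
    split_ifs <;> linarith

/-- The square of the Cantor set is covered by `4 ^ n` sets of diameter at most `2 * 8 ^ (-n)`, so
its image in the line under a Lipschitz (multivalued) map is a null set. -/
theorem volume_eq_zero_of_cantor {R : ℝ → ℝ → ℝ → Prop} {C : ℝ}
    (hR : ∀ α k l α' k' l', R α k l → R α' k' l' → k ∈ cantor → l ∈ cantor → k' ∈ cantor →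
      l' ∈ cantor → |α - α'| ≤ C * (|k - k'| + |l - l'|)) :
    volume {α | ∃ k ∈ cantor, ∃ l ∈ cantor, R α k l} = 0 := by
  set S := {α | ∃ k ∈ cantor, ∃ l ∈ cantor, R α k l} with hS
  have hbound : ∀ n : ℕ, volume S ≤ ENNReal.ofReal (2 * |C| * (1 / 2) ^ n) := by
    intro n
    let T : (Fin n → Bool) × (Fin n → Bool) → Set ℝ := fun p =>
      {α | ∃ β γ : ℕ → Bool, R α (cantorPoint β) (cantorPoint γ) ∧
        (fun i : Fin n => β i) = p.1 ∧ (fun i : Fin n => γ i) = p.2}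
    have hST : S ⊆ ⋃ p, T p := by
      rintro α ⟨_, ⟨β, rfl⟩, _, ⟨γ, rfl⟩, h⟩
      exact mem_iUnion.2 ⟨(_, _), β, γ, h, rfl, rfl⟩
    have hT : ∀ p, volume (T p) ≤ ENNReal.ofReal (2 * |C| * (1 / 8) ^ n) := by
      intro p
      refine (Real.volume_le_diam _).trans (Metric.ediam_le fun α hα α' hα' => ?_)
      obtain ⟨β, γ, h1, h2, h3⟩ := hα
      obtain ⟨β', γ', h1', h2', h3'⟩ := hα'
      rw [edist_dist, Real.dist_eq]
      apply ENNReal.ofReal_le_ofReal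
      have e1 := abs_cantorPoint_sub_le n β β' fun i hi => congrFun (h2.trans h2'.symm) ⟨i, hi⟩
      have e2 := abs_cantorPoint_sub_le n γ γ' fun i hi => congrFun (h3.trans h3'.symm) ⟨i, hi⟩
      have e3 := hR _ _ _ _ _ _ h1 h1' ⟨_, rfl⟩ ⟨_, rfl⟩ ⟨_, rfl⟩ ⟨_, rfl⟩
      have e4 : C * (|cantorPoint β - cantorPoint β'| + |cantorPoint γ - cantorPoint γ'|) ≤
          |C| * ((1 / 8) ^ n + (1 / 8) ^ n) :=
        mul_le_mul (le_abs_self C) (by linarith) (by positivity) (abs_nonneg _)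
      linarith
    calc volume S ≤ volume (⋃ p, T p) := measure_mono hST
      _ ≤ ∑ p, volume (T p) := measure_iUnion_fintype_le _ _
      _ ≤ ∑ _p : (Fin n → Bool) × (Fin n → Bool), ENNReal.ofReal (2 * |C| * (1 / 8) ^ n) :=
        Finset.sum_le_sum fun p _ => hT p
      _ = ENNReal.ofReal (2 * |C| * (1 / 2) ^ n) := by
        rw [Finset.sum_const, Finset.card_univ, Fintype.card_prod, Fintype.card_fun,
          Fintype.card_bool, Fintype.card_fin, nsmul_eq_mul, ← ENNReal.ofReal_natCast,
          ← ENNReal.ofReal_mul (by positivity)]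
        congr 1
        push_cast
        have : (1 / 2 : ℝ) ^ n = 2 ^ n * 2 ^ n * (1 / 8) ^ n := by
          rw [← mul_pow, ← mul_pow]; norm_num
        rw [this]; ring
  have hlim : Filter.Tendsto (fun n : ℕ => ENNReal.ofReal (2 * |C| * (1 / 2) ^ n)) Filter.atTop
      (𝓝 0) := by
    have h1 : Filter.Tendsto (fun n : ℕ => 2 * |C| * (1 / 2 : ℝ) ^ n) Filter.atTop (𝓝 0) := by
      simpa using (tendsto_pow_atTop_nhds_zero_of_lt_one (r := (1 / 2 : ℝ)) (by norm_num)
        (by norm_num)).const_mul (2 * |C|)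
    simpa using ENNReal.tendsto_ofReal h1
  exact le_antisymm (ge_of_tendsto' hlim hbound) zero_le

/-! ### The lamination of a rectangle -/

/-- An ideal rectangle, given by the real coordinates `a < b ≤ c < d` of its corners. It stands for
the part of the disk between the chord of `a`, `d` and the chord of `b`, `c`. -/
structure Rect where
  a : ℝ
  b : ℝ
  c : ℝ
  d : ℝ

namespace Rect

/-- The corners are in order. Only the inner side may be degenerate. -/
structure Ok (ρ : Rect) : Prop where
  ab : ρ.a < ρ.b
  bc : ρ.b ≤ ρ.c
  cd : ρ.c < ρ.d

/-- The first vertex of the central quadrilateral, near `a`. -/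
def s (ρ : Rect) : ℝ := ρ.a + (ρ.b - ρ.a) / 8
/-- The second vertex of the central quadrilateral, near `b`. -/
def t (ρ : Rect) : ℝ := ρ.b - (ρ.b - ρ.a) / 8
/-- The third vertex of the central quadrilateral, near `c`. -/
def t' (ρ : Rect) : ℝ := ρ.c + (ρ.d - ρ.c) / 8
/-- The fourth vertex of the central quadrilateral, near `d`. -/
def s' (ρ : Rect) : ℝ := ρ.d - (ρ.d - ρ.c) / 8

/-- The four rectangles that remain when the central quadrilateral is removed: the outer and the
inner one, and the two caps beyond the sides of the quadrilateral on the circle, each of which is a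
rectangle with a degenerate inner side. -/
def child (ρ : Rect) : Fin 4 → Rect
  | 0 => ⟨ρ.a, ρ.s, ρ.s', ρ.d⟩
  | 1 => ⟨ρ.t, ρ.b, ρ.c, ρ.t'⟩
  | 2 => ⟨ρ.s, (ρ.s + ρ.t) / 2, (ρ.s + ρ.t) / 2, ρ.t⟩
  | 3 => ⟨ρ.t', (ρ.t' + ρ.s') / 2, (ρ.t' + ρ.s') / 2, ρ.s'⟩

/-- The iterated subrectangle with a given address. -/
def sub (ρ : Rect) : List (Fin 4) → Rect
  | [] => ρ
  | i :: w => (ρ.child i).sub w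

/-- The parallel leaf at height `k`, from the outer side (`k = 0`) to the inner side (`k = 1`). -/
def leaf (ρ : Rect) (k : ℝ) : ℝ × ℝ := (ρ.a + k * (ρ.b - ρ.a), ρ.d - k * (ρ.d - ρ.c))

/-- The leaves of the lamination of a rectangle: the parallel leaves, at the heights in the Cantor
set, of all iterated subrectangles. -/
def leaves (ρ : Rect) : Set (ℝ × ℝ) := {q | ∃ w, ∃ k ∈ cantor, q = (ρ.sub w).leaf k}

/-- The part of the circle on the boundary of the rectangle. -/
def supp (ρ : Rect) : Set ℝ := Icc ρ.a ρ.b ∪ Icc ρ.c ρ.d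

/-- The larger of the lengths of the two boundary intervals. -/
def size (ρ : Rect) : ℝ := max (ρ.b - ρ.a) (ρ.d - ρ.c)

variable {ρ : Rect}

theorem Ok.child (h : ρ.Ok) (i : Fin 4) : (ρ.child i).Ok := by
  obtain ⟨h1, h2, h3⟩ := h
  fin_cases i <;> constructor <;> simp only [Rect.child, s, t, s', t'] <;> linarith

theorem Ok.sub (h : ρ.Ok) (w : List (Fin 4)) : (ρ.sub w).Ok := by
  induction w generalizing ρ with
  | nil => exact h
  | cons i w ih => exact ih (h.child i)

theorem sub_append (w u : List (Fin 4)) : ρ.sub (w ++ u) = (ρ.sub w).sub u := by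
  induction w generalizing ρ with
  | nil => rfl
  | cons i w ih => exact ih

theorem supp_child (h : ρ.Ok) (i : Fin 4) : (ρ.child i).supp ⊆ ρ.supp := by
  obtain ⟨h1, h2, h3⟩ := h
  rintro x (⟨hx, hx'⟩ | ⟨hx, hx'⟩) <;> fin_cases i <;>
    simp only [Rect.child, s, t, s', t', supp, mem_union, mem_Icc] at * <;>
    first
    | exact Or.inl ⟨by linarith, by linarith⟩
    | exact Or.inr ⟨by linarith, by linarith⟩

theorem supp_sub (h : ρ.Ok) (w : List (Fin 4)) : (ρ.sub w).supp ⊆ ρ.supp := by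
  induction w generalizing ρ with
  | nil => exact Subset.rfl
  | cons i w ih => exact (ih (h.child i)).trans (supp_child h i)

theorem size_child (h : ρ.Ok) (i : Fin 4) : (ρ.child i).size ≤ ρ.size / 2 := by
  obtain ⟨h1, h2, h3⟩ := h
  have h4 := le_max_left (ρ.b - ρ.a) (ρ.d - ρ.c)
  have h5 := le_max_right (ρ.b - ρ.a) (ρ.d - ρ.c)
  apply max_le <;> fin_cases i <;> simp only [Rect.child, s, t, s', t', size] <;> linarith

theorem size_sub (h : ρ.Ok) (w : List (Fin 4)) :
    (ρ.sub w).size ≤ ρ.size * (1 / 2) ^ w.length := by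
  induction w generalizing ρ with
  | nil => simp [sub]
  | cons i w ih =>
    refine (ih (h.child i)).trans ?_
    rw [List.length_cons, pow_succ]
    have h1 := size_child h i
    have : (0 : ℝ) < (1 / 2) ^ w.length := by positivity
    nlinarith

theorem leaf_child_zero (k : ℝ) : (ρ.child 0).leaf k = ρ.leaf (k / 8) := by
  simp only [leaf, Rect.child, s, s']
  ext <;> ring

theorem leaf_child_one (k : ℝ) : (ρ.child 1).leaf k = ρ.leaf (7 / 8 + k / 8) := by
  simp only [leaf, Rect.child, t, t']
  ext <;> ring

theorem leaf_mem_leaves {k : ℝ} (hk : k ∈ cantor) : ρ.leaf k ∈ ρ.leaves := ⟨[], k, hk, rfl⟩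

theorem leaves_child (i : Fin 4) : (ρ.child i).leaves ⊆ ρ.leaves := by
  rintro q ⟨w, k, hk, rfl⟩
  exact ⟨i :: w, k, hk, rfl⟩

theorem leaves_sub (w : List (Fin 4)) : (ρ.sub w).leaves ⊆ ρ.leaves := by
  induction w generalizing ρ with
  | nil => exact Subset.rfl
  | cons i w ih => exact ih.trans (leaves_child i)

/-- A parallel leaf lies in the outer or in the inner subrectangle. -/
theorem exists_leaf_eq {k : ℝ} (hk : k ∈ cantor) :
    ∃ i, ∃ l ∈ cantor, ρ.leaf k = (ρ.child i).leaf l := by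
  obtain ⟨l, hl, rfl | rfl⟩ := exists_of_mem_cantor hk
  · exact ⟨0, l, hl, (leaf_child_zero l).symm⟩
  · exact ⟨1, l, hl, (leaf_child_one l).symm⟩

theorem exists_mem_leaves_child {q : ℝ × ℝ} (hq : q ∈ ρ.leaves) : ∃ i, q ∈ (ρ.child i).leaves := by
  obtain ⟨w, k, hk, rfl⟩ := hq
  cases w with
  | nil =>
    obtain ⟨i, l, hl, h⟩ := exists_leaf_eq (ρ := ρ) hk
    exact ⟨i, [], l, hl, h⟩
  | cons i w => exact ⟨i, w, k, hk, rfl⟩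

theorem outer_mem_leaves : (ρ.a, ρ.d) ∈ ρ.leaves := ⟨[], 0, zero_mem_cantor, by simp [leaf, sub]⟩

theorem inner_mem_leaves : (ρ.b, ρ.c) ∈ ρ.leaves := ⟨[], 1, one_mem_cantor, by simp [leaf, sub]⟩

theorem leaf_mem_supp (h : ρ.Ok) {k : ℝ} (hk : k ∈ cantor) :
    (ρ.leaf k).1 ∈ Icc ρ.a ρ.b ∧ (ρ.leaf k).2 ∈ Icc ρ.c ρ.d := by
  obtain ⟨h1, h2, h3⟩ := h
  have h4 := cantor_nonneg hk
  have h5 := cantor_le_one hk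
  simp only [leaf, mem_Icc]
  refine ⟨⟨?_, ?_⟩, ?_, ?_⟩ <;> nlinarith

theorem mem_supp_of_mem_leaves (h : ρ.Ok) {q : ℝ × ℝ} (hq : q ∈ ρ.leaves) :
    q.1 ∈ ρ.supp ∧ q.2 ∈ ρ.supp := by
  obtain ⟨w, k, hk, rfl⟩ := hq
  have := leaf_mem_supp (h.sub w) hk
  exact ⟨supp_sub h w (Or.inl this.1), supp_sub h w (Or.inr this.2)⟩

theorem le_of_mem_leaves (h : ρ.Ok) {q : ℝ × ℝ} (hq : q ∈ ρ.leaves) : q.1 ≤ q.2 := by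
  obtain ⟨w, k, hk, rfl⟩ := hq
  have := leaf_mem_supp (h.sub w) hk
  have := (h.sub w).bc
  linarith [this, (leaf_mem_supp (h.sub w) hk).1.2, (leaf_mem_supp (h.sub w) hk).2.1]

theorem supp_subset (h : ρ.Ok) : ρ.supp ⊆ Icc ρ.a ρ.d := by
  obtain ⟨h1, h2, h3⟩ := h
  rintro x (⟨hx, hx'⟩ | ⟨hx, hx'⟩) <;> constructor <;> linarith

/-- The only leaf that ends in an outer corner is the outer side. -/
theorem eq_outer_of_mem (h : ρ.Ok) {q : ℝ × ℝ} (hq : q ∈ ρ.leaves)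
    (hx : q.1 = ρ.a ∨ q.2 = ρ.a ∨ q.1 = ρ.d ∨ q.2 = ρ.d) : q = (ρ.a, ρ.d) := by
  obtain ⟨w, k, hk, rfl⟩ := hq
  induction w generalizing ρ with
  | nil =>
    obtain ⟨h1, h2, h3⟩ := h
    have h4 := cantor_nonneg hk
    have h5 := cantor_le_one hk
    simp only [sub, leaf] at *
    have hk0 : k = 0 := by
      apply le_antisymm _ h4
      rcases hx with hx | hx | hx | hx <;> nlinarith
    simp [hk0]
  | cons i w ih =>
    have hmem := mem_supp_of_mem_leaves (h.child i) (⟨w, k, hk, rfl⟩ :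
      ((ρ.child i).sub w).leaf k ∈ (ρ.child i).leaves)
    have hi : i = 0 := by
      by_contra hi
      have h6 : ∀ x ∈ (ρ.child i).supp, x ≠ ρ.a ∧ x ≠ ρ.d := by
        obtain ⟨h1, h2, h3⟩ := h
        rintro x (⟨hx, hx'⟩ | ⟨hx, hx'⟩) <;> fin_cases i <;>
          simp only [Rect.child, s, t, s', t'] at * <;>
          first
          | exact absurd rfl hi
          | constructor <;> intro e <;> linarith
      rcases hx with hx | hx | hx | hx
      · exact (h6 _ hmem.1).1 hx
      · exact (h6 _ hmem.2).1 hx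
      · exact (h6 _ hmem.1).2 hx
      · exact (h6 _ hmem.2).2 hx
    subst hi
    exact ih (h.child 0) hx

/-- The only leaf that ends in an inner corner is the inner side. -/
theorem eq_inner_of_mem (h : ρ.Ok) {q : ℝ × ℝ} (hq : q ∈ ρ.leaves)
    (hx : q.1 = ρ.b ∨ q.2 = ρ.b ∨ q.1 = ρ.c ∨ q.2 = ρ.c) : q = (ρ.b, ρ.c) := by
  obtain ⟨w, k, hk, rfl⟩ := hq
  induction w generalizing ρ with
  | nil =>
    obtain ⟨h1, h2, h3⟩ := h
    have h4 := cantor_nonneg hk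
    have h5 := cantor_le_one hk
    simp only [sub, leaf] at *
    have hk0 : k = 1 := by
      apply le_antisymm h5
      rcases hx with hx | hx | hx | hx <;> nlinarith
    simp [hk0]
  | cons i w ih =>
    have hmem := mem_supp_of_mem_leaves (h.child i) (⟨w, k, hk, rfl⟩ :
      ((ρ.child i).sub w).leaf k ∈ (ρ.child i).leaves)
    have hi : i = 1 := by
      by_contra hi
      have h6 : ∀ x ∈ (ρ.child i).supp, x ≠ ρ.b ∧ x ≠ ρ.c := by
        obtain ⟨h1, h2, h3⟩ := h
        rintro x (⟨hx, hx'⟩ | ⟨hx, hx'⟩) <;> fin_cases i <;>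
          simp only [Rect.child, s, t, s', t'] at * <;>
          first
          | exact absurd rfl hi
          | constructor <;> intro e <;> linarith
      rcases hx with hx | hx | hx | hx
      · exact (h6 _ hmem.1).1 hx
      · exact (h6 _ hmem.2).1 hx
      · exact (h6 _ hmem.1).2 hx
      · exact (h6 _ hmem.2).2 hx
    subst hi
    exact ih (h.child 1) hx

/-- The points `x`, `y` are both separated from the rectangle by the inner side, or both by the
outer side. -/
def Sep (ρ : Rect) (x y : ℝ) : Prop :=
  ((ρ.b ≤ x ∧ x ≤ ρ.c) ∧ (ρ.b ≤ y ∧ y ≤ ρ.c)) ∨ ((x ≤ ρ.a ∨ ρ.d ≤ x) ∧ (y ≤ ρ.a ∨ ρ.d ≤ y))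

/-- No side of the central quadrilateral separates `x` from `y`, and the quadrilateral is on one
side of both points. -/
def Beside (ρ : Rect) (x y : ℝ) : Prop :=
  ((ρ.s ≤ x ∧ x ≤ ρ.t) ∧ (ρ.s ≤ y ∧ y ≤ ρ.t)) ∨ ((ρ.t ≤ x ∧ x ≤ ρ.t') ∧ (ρ.t ≤ y ∧ y ≤ ρ.t')) ∨
    ((ρ.t' ≤ x ∧ x ≤ ρ.s') ∧ (ρ.t' ≤ y ∧ y ≤ ρ.s')) ∨
    ((x ≤ ρ.s ∨ ρ.s' ≤ x) ∧ (y ≤ ρ.s ∨ ρ.s' ≤ y))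

theorem Sep.child (h : ρ.Ok) {x y : ℝ} (hs : ρ.Sep x y) (i : Fin 4) : (ρ.child i).Sep x y := by
  obtain ⟨h1, h2, h3⟩ := h
  rcases hs with ⟨⟨x1, x2⟩, y1, y2⟩ | ⟨hx, hy⟩
  · fin_cases i
    · left; simp only [Rect.child, s, s']; refine ⟨⟨?_, ?_⟩, ?_, ?_⟩ <;> linarith
    · left; simp only [Rect.child, t, t']; refine ⟨⟨?_, ?_⟩, ?_, ?_⟩ <;> linarith
    · right; simp only [Rect.child, s, t]; exact ⟨Or.inr (by linarith), Or.inr (by linarith)⟩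
    · right; simp only [Rect.child, s', t']; exact ⟨Or.inl (by linarith), Or.inl (by linarith)⟩
  · right
    fin_cases i <;> simp only [Rect.child, s, t, s', t'] <;>
      exact ⟨hx.imp (fun h => by linarith) (fun h => by linarith),
        hy.imp (fun h => by linarith) (fun h => by linarith)⟩

theorem Sep.sub (h : ρ.Ok) {x y : ℝ} (hs : ρ.Sep x y) (w : List (Fin 4)) : (ρ.sub w).Sep x y := by
  induction w generalizing ρ with
  | nil => exact hs
  | cons i w ih => exact ih (h.child i) (hs.child h i)

theorem Sep.beside (h : ρ.Ok) {x y : ℝ} (hs : ρ.Sep x y) : ρ.Beside x y := by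
  obtain ⟨h1, h2, h3⟩ := h
  rcases hs with ⟨⟨x1, x2⟩, y1, y2⟩ | ⟨hx, hy⟩
  · right; left; simp only [t, t']; refine ⟨⟨?_, ?_⟩, ?_, ?_⟩ <;> linarith
  · right; right; right; simp only [s, s']
    exact ⟨hx.imp (fun h => by linarith) (fun h => by linarith),
      hy.imp (fun h => by linarith) (fun h => by linarith)⟩

theorem sep_of_ne (h : ρ.Ok) {i j : Fin 4} (hij : i ≠ j) {x y : ℝ} (hx : x ∈ (ρ.child j).supp)
    (hy : y ∈ (ρ.child j).supp) : (ρ.child i).Sep x y := by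
  obtain ⟨h1, h2, h3⟩ := h
  have hmem : ∀ x ∈ (ρ.child j).supp,
      (i = 0 → ρ.s ≤ x ∧ x ≤ ρ.s') ∧ (i ≠ 0 → x ≤ (ρ.child i).a ∨ (ρ.child i).d ≤ x) := by
    rintro x (⟨hx, hx'⟩ | ⟨hx, hx'⟩) <;> fin_cases i <;> fin_cases j <;>
      simp [Rect.child, s, t, s', t'] at * <;>
      first
      | exact ⟨by linarith, by linarith⟩
      | exact Or.inl (by linarith)
      | exact Or.inr (by linarith)
  by_cases hi : i = 0
  · subst hi
    exact Or.inl ⟨(hmem x hx).1 rfl, (hmem y hy).1 rfl⟩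
  · exact Or.inr ⟨(hmem x hx).2 hi, (hmem y hy).2 hi⟩

/-- No leaf crosses the central quadrilateral of an iterated subrectangle. -/
theorem beside_of_mem_leaves (h : ρ.Ok) (w : List (Fin 4)) {q : ℝ × ℝ} (hq : q ∈ ρ.leaves) :
    (ρ.sub w).Beside q.1 q.2 := by
  induction w generalizing ρ with
  | nil =>
    obtain ⟨j, hj⟩ := exists_mem_leaves_child hq
    obtain ⟨hx, hy⟩ := mem_supp_of_mem_leaves (h.child j) hj
    obtain ⟨h1, h2, h3⟩ := h
    simp only [sub]
    generalize q.1 = x at *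
    generalize q.2 = y at *
    have key : ∀ x ∈ (ρ.child j).supp, (j = 0 → x ≤ ρ.s ∨ ρ.s' ≤ x) ∧
        (j = 1 → ρ.t ≤ x ∧ x ≤ ρ.t') ∧ (j = 2 → ρ.s ≤ x ∧ x ≤ ρ.t) ∧
        (j = 3 → ρ.t' ≤ x ∧ x ≤ ρ.s') := by
      rintro x (⟨hx, hx'⟩ | ⟨hx, hx'⟩) <;> fin_cases j <;>
        simp [Rect.child, s, t, s', t'] at * <;>
        first
        | exact ⟨by linarith, by linarith⟩
        | exact Or.inl (by linarith)
        | exact Or.inr (by linarith)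
    have k1 := key x hx
    have k2 := key y hy
    unfold Beside
    fin_cases j <;> simp at k1 k2 <;> tauto
  | cons i w ih =>
    obtain ⟨j, hj⟩ := exists_mem_leaves_child hq
    by_cases hij : i = j
    · subst hij
      exact ih (h.child i) hj
    · obtain ⟨hx, hy⟩ := mem_supp_of_mem_leaves (h.child j) hj
      exact ((sep_of_ne h hij hx hy).sub (h.child i) w).beside ((h.child i).sub w)

/-- The pair `q` is a side of the central quadrilateral. -/
def QuadSide (ρ : Rect) (q : ℝ × ℝ) : Prop :=
  q = (ρ.s, ρ.t) ∨ q = (ρ.t, ρ.t') ∨ q = (ρ.t', ρ.s') ∨ q = (ρ.s, ρ.s')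

/-- Some real number is a coordinate of both pairs. -/
def Share (q r : ℝ × ℝ) : Prop := ∃ x, (q.1 = x ∨ q.2 = x) ∧ (r.1 = x ∨ r.2 = x)

theorem quadSide_of_share_child (h : ρ.Ok) {i j : Fin 4} (hij : i < j) {q r : ℝ × ℝ}
    (hq : q ∈ (ρ.child i).leaves) (hr : r ∈ (ρ.child j).leaves) (hs : Share q r) :
    ρ.QuadSide q ∧ ρ.QuadSide r := by
  obtain ⟨x, hx, hy⟩ := hs
  have hxi : x ∈ (ρ.child i).supp := by
    rcases hx with rfl | rfl
    exacts [(mem_supp_of_mem_leaves (h.child i) hq).1, (mem_supp_of_mem_leaves (h.child i) hq).2]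
  have hxj : x ∈ (ρ.child j).supp := by
    rcases hy with rfl | rfl
    exacts [(mem_supp_of_mem_leaves (h.child j) hr).1, (mem_supp_of_mem_leaves (h.child j) hr).2]
  have outer : ∀ {i : Fin 4} {q : ℝ × ℝ}, q ∈ (ρ.child i).leaves → (q.1 = x ∨ q.2 = x) →
      (x = (ρ.child i).a ∨ x = (ρ.child i).d) → q = ((ρ.child i).a, (ρ.child i).d) := by
    intro i q hq hx hc
    apply eq_outer_of_mem (h.child i) hq
    rcases hx with rfl | rfl <;> tauto
  have inner : ∀ {i : Fin 4} {q : ℝ × ℝ}, q ∈ (ρ.child i).leaves → (q.1 = x ∨ q.2 = x) →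
      (x = (ρ.child i).b ∨ x = (ρ.child i).c) → q = ((ρ.child i).b, (ρ.child i).c) := by
    intro i q hq hx hc
    apply eq_inner_of_mem (h.child i) hq
    rcases hx with rfl | rfl <;> tauto
  obtain ⟨h1, h2, h3⟩ := h
  -- The possible common points of two subrectangles are vertices of the quadrilateral.
  have cases : (i = 0 ∧ j = 2 ∧ x = ρ.s) ∨ (i = 0 ∧ j = 3 ∧ x = ρ.s') ∨ (i = 1 ∧ j = 2 ∧ x = ρ.t) ∨
      (i = 1 ∧ j = 3 ∧ x = ρ.t') := by
    clear outer inner hq hr hx hy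
    rcases hxi with ⟨u1, u2⟩ | ⟨u1, u2⟩ <;> rcases hxj with ⟨v1, v2⟩ | ⟨v1, v2⟩ <;>
      fin_cases i <;> fin_cases j <;> simp [Rect.child, s, t, s', t'] at * <;>
      linarith
  unfold QuadSide
  rcases cases with ⟨rfl, rfl, e⟩ | ⟨rfl, rfl, e⟩ | ⟨rfl, rfl, e⟩ | ⟨rfl, rfl, e⟩
  · exact ⟨Or.inr (Or.inr (Or.inr (inner hq hx (Or.inl e)))), Or.inl (outer hr hy (Or.inl e))⟩
  · exact ⟨Or.inr (Or.inr (Or.inr (inner hq hx (Or.inr e)))),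
      Or.inr (Or.inr (Or.inl (outer hr hy (Or.inr e))))⟩
  · exact ⟨Or.inr (Or.inl (outer hq hx (Or.inl e))), Or.inl (outer hr hy (Or.inr e))⟩
  · exact ⟨Or.inr (Or.inl (outer hq hx (Or.inr e))),
      Or.inr (Or.inr (Or.inl (outer hr hy (Or.inl e))))⟩

theorem Share.symm {q r : ℝ × ℝ} (h : Share q r) : Share r q := by
  obtain ⟨x, h1, h2⟩ := h
  exact ⟨x, h2, h1⟩

/-- Two parallel leaves of a rectangle are separated by the rectangle between them. -/
theorem leaf_sep (h : ρ.Ok) {k l : ℝ} (hk : k ∈ cantor) (hl : l ∈ cantor) (hkl : k < l) :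
    (∃ σ : Rect, σ.Ok ∧ ρ.a ≤ σ.a ∧ σ.d ≤ ρ.d ∧ σ.Sep (ρ.leaf k).1 (ρ.leaf k).2 ∧
      (ρ.leaf l).1 ∈ σ.supp ∧ (ρ.leaf l).2 ∈ σ.supp) ∧ ¬ Share (ρ.leaf k) (ρ.leaf l) := by
  obtain ⟨h1, h2, h3⟩ := h
  have k0 := cantor_nonneg hk
  have k1 := cantor_le_one hk
  have l0 := cantor_nonneg hl
  have l1 := cantor_le_one hl
  have e1 : (ρ.leaf k).1 < (ρ.leaf l).1 := by simp only [leaf]; nlinarith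
  have e2 : (ρ.leaf l).2 < (ρ.leaf k).2 := by simp only [leaf]; nlinarith
  have e3 : (ρ.leaf l).1 ≤ ρ.b := by simp only [leaf]; nlinarith
  have e4 : ρ.c ≤ (ρ.leaf l).2 := by simp only [leaf]; nlinarith
  have e5 : ρ.a ≤ (ρ.leaf k).1 := by simp only [leaf]; nlinarith
  have e6 : (ρ.leaf k).2 ≤ ρ.d := by simp only [leaf]; nlinarith
  refine ⟨⟨⟨(ρ.leaf k).1, (ρ.leaf l).1, (ρ.leaf l).2, (ρ.leaf k).2⟩, ⟨e1, e3.trans (h2.trans e4),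
    e2⟩, e5, e6, Or.inr ⟨Or.inl le_rfl, Or.inr le_rfl⟩, Or.inl ⟨e1.le, le_rfl⟩,
    Or.inr ⟨le_rfl, e2.le⟩⟩, ?_⟩
  rintro ⟨x, hx | hx, hy | hy⟩ <;> linarith

/-- Two pairs are apart in a rectangle if some rectangle within it contains one of them and is
separated from the other, and if they can share an endpoint only as sides of the central
quadrilateral of one subrectangle. -/
def Apart (ρ : Rect) (q r : ℝ × ℝ) : Prop :=
  (∃ σ : Rect, σ.Ok ∧ ρ.a ≤ σ.a ∧ σ.d ≤ ρ.d ∧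
    ((σ.Sep q.1 q.2 ∧ r.1 ∈ σ.supp ∧ r.2 ∈ σ.supp) ∨
      (σ.Sep r.1 r.2 ∧ q.1 ∈ σ.supp ∧ q.2 ∈ σ.supp))) ∧
  (Share q r → ∃ w, (ρ.sub w).QuadSide q ∧ (ρ.sub w).QuadSide r)

/-- Distinct leaves are apart: they are parallel leaves of one subrectangle, or they lie in
different children of one subrectangle. -/
theorem compare_leaves (h : ρ.Ok) {q r : ℝ × ℝ} (hq : q ∈ ρ.leaves) (hr : r ∈ ρ.leaves) :
    q = r ∨ ρ.Apart q r := by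
  obtain ⟨w, k, hk, rfl⟩ := hq
  obtain ⟨u, l, hl, rfl⟩ := hr
  induction hn : w.length + u.length using Nat.strong_induction_on generalizing ρ w u k l with
  | _ n ih =>
    have amono : ∀ i, ρ.a ≤ (ρ.child i).a ∧ (ρ.child i).d ≤ ρ.d := by
      obtain ⟨h1, h2, h3⟩ := h
      intro i
      fin_cases i <;> simp only [Rect.child, s, t, s', t'] <;> constructor <;> linarith
    have same : ∀ (i : Fin 4) (w' u' : List (Fin 4)) (k' l' : ℝ), k' ∈ cantor → l' ∈ cantor →
        w'.length + u'.length < n → (ρ.sub w).leaf k = ((ρ.child i).sub w').leaf k' →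
        (ρ.sub u).leaf l = ((ρ.child i).sub u').leaf l' →
        (ρ.sub w).leaf k = (ρ.sub u).leaf l ∨ ρ.Apart ((ρ.sub w).leaf k) ((ρ.sub u).leaf l) := by
      intro i w' u' k' l' hk' hl' hn' e1 e2
      have := ih _ hn' (h.child i) w' k' hk' u' l' hl' rfl
      rw [← e1, ← e2] at this
      rcases this with h3 | ⟨⟨σ, h3, h4, h5, h6⟩, h7⟩
      · exact Or.inl h3
      · refine Or.inr ⟨⟨σ, h3, (amono i).1.trans h4, h5.trans (amono i).2, h6⟩, fun hs => ?_⟩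
        obtain ⟨w₀, h8⟩ := h7 hs
        exact ⟨i :: w₀, h8⟩
    have diff : ∀ (i j : Fin 4), i ≠ j → (ρ.sub w).leaf k ∈ (ρ.child i).leaves →
        (ρ.sub u).leaf l ∈ (ρ.child j).leaves →
        (ρ.sub w).leaf k = (ρ.sub u).leaf l ∨ ρ.Apart ((ρ.sub w).leaf k) ((ρ.sub u).leaf l) := by
      intro i j hij h3 h4
      have h5 := mem_supp_of_mem_leaves (h.child i) h3
      have h6 := mem_supp_of_mem_leaves (h.child j) h4
      refine Or.inr ⟨⟨ρ.child i, h.child i, (amono i).1, (amono i).2, Or.inr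
        ⟨sep_of_ne h hij h6.1 h6.2, h5.1, h5.2⟩⟩, fun hs => ⟨[], ?_⟩⟩
      rcases lt_or_gt_of_ne hij with hlt | hlt
      · exact quadSide_of_share_child h hlt h3 h4 hs
      · exact (quadSide_of_share_child h hlt h4 h3 hs.symm).symm
    cases w with
    | nil =>
      cases u with
      | nil =>
        rcases lt_trichotomy k l with hkl | rfl | hkl
        · obtain ⟨⟨σ, h3, h4, h5, h6⟩, h7⟩ := leaf_sep h hk hl hkl
          exact Or.inr ⟨⟨σ, h3, h4, h5, Or.inl h6⟩, fun hs => absurd hs h7⟩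
        · exact Or.inl rfl
        · obtain ⟨⟨σ, h3, h4, h5, h6⟩, h7⟩ := leaf_sep h hl hk hkl
          exact Or.inr ⟨⟨σ, h3, h4, h5, Or.inr h6⟩, fun hs => absurd hs.symm h7⟩
      | cons j u =>
        obtain ⟨i, k', hk', e⟩ := exists_leaf_eq (ρ := ρ) hk
        by_cases hij : i = j
        · subst hij
          exact same i [] u k' l hk' hl (by simp at hn ⊢; omega) e rfl
        · exact diff i j hij ⟨[], k', hk', e⟩ ⟨u, l, hl, rfl⟩
    | cons i w =>
      cases u with
      | nil =>
        obtain ⟨j, l', hl', e⟩ := exists_leaf_eq (ρ := ρ) hl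
        by_cases hij : i = j
        · subst hij
          exact same i w [] k l' hk hl' (by simp at hn ⊢; omega) rfl e
        · exact diff i j hij ⟨w, k, hk, rfl⟩ ⟨[], l', hl', e⟩
      | cons j u =>
        by_cases hij : i = j
        · subst hij
          exact same i w u k l hk hl (by simp at hn ⊢; omega) rfl rfl
        · exact diff i j hij ⟨w, k, hk, rfl⟩ ⟨u, l, hl, rfl⟩

theorem cap_length_le (h : ρ.Ok) (b : Bool) :
    (ρ.child (if b then 2 else 3)).d - (ρ.child (if b then 2 else 3)).a ≤ ρ.size := by
  have h5 := le_max_left (ρ.b - ρ.a) (ρ.d - ρ.c)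
  have h6 := le_max_right (ρ.b - ρ.a) (ρ.d - ρ.c)
  obtain ⟨o1, o2, o3⟩ := h
  cases b <;> simp only [if_true, Bool.false_eq_true, if_false, Rect.child, s, t, s', t', size] <;>
    linarith

/-- The parallel leaves of a rectangle. -/
def parallel (ρ : Rect) : Set (ℝ × ℝ) := ρ.leaf '' cantor

theorem isCompact_parallel : IsCompact ρ.parallel :=
  isCompact_cantor.image (by unfold leaf; fun_prop)

/-- Every leaf is a parallel leaf of the rectangle or of a cap of an iterated subrectangle. -/
theorem leaves_eq : ρ.leaves = ⋃ o : Option (List (Fin 4) × Bool),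
    (o.elim ρ fun p => (ρ.sub p.1).child (if p.2 then 2 else 3)).parallel := by
  apply Subset.antisymm
  · rintro q ⟨w, k, hk, rfl⟩
    rw [mem_iUnion]
    induction w generalizing ρ with
    | nil => exact ⟨none, k, hk, rfl⟩
    | cons i w ih =>
      obtain ⟨o, ho⟩ := ih (ρ := ρ.child i)
      cases o with
      | none =>
        obtain ⟨l, hl, e⟩ := ho
        rw [sub, ← e]
        fin_cases i
        · exact ⟨none, l / 8, cantor_left hl, (leaf_child_zero l).symm⟩
        · exact ⟨none, 7 / 8 + l / 8, cantor_right hl, (leaf_child_one l).symm⟩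
        · exact ⟨some ([], true), l, hl, rfl⟩
        · exact ⟨some ([], false), l, hl, rfl⟩
      | some p => exact ⟨some (i :: p.1, p.2), ho⟩
  · refine iUnion_subset fun o => ?_
    rintro _ ⟨k, hk, rfl⟩
    cases o with
    | none => exact leaf_mem_leaves hk
    | some p => exact leaves_sub p.1 (leaves_child _ (leaf_mem_leaves hk))

theorem isClosed_leaves (h : ρ.Ok) : IsClosed (ρ.leaves ∪ {q | q.1 = q.2}) := by
  rw [leaves_eq]
  refine isClosed_iUnion_union_diagonal _ (fun o => isCompact_parallel.isClosed) fun δ hδ => ?_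
  have hlim : Filter.Tendsto (fun n : ℕ => ρ.size * (1 / 2 : ℝ) ^ n) Filter.atTop (𝓝 0) := by
    simpa using (tendsto_pow_atTop_nhds_zero_of_lt_one (r := (1 / 2 : ℝ)) (by norm_num)
      (by norm_num)).const_mul ρ.size
  obtain ⟨n, hn⟩ := Filter.eventually_atTop.1 (hlim.eventually (gt_mem_nhds hδ))
  have hfin : ((fun p => some p) '' ({w : List (Fin 4) | w.length < n} ×ˢ (univ : Set Bool)) ∪
      {none}).Finite :=
    (((List.finite_length_lt (Fin 4) n).prod finite_univ).image _).union (finite_singleton _)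
  refine hfin.subset ?_
  rintro (_ | ⟨w, b⟩) ⟨q, ⟨k, hk, rfl⟩, hd⟩
  · exact Or.inr rfl
  · refine Or.inl ⟨(w, b), ⟨?_, mem_univ _⟩, rfl⟩
    by_contra hw
    have h1 := hn w.length (not_lt.1 hw)
    have h2 := size_sub h w
    have hok := (h.sub w).child (if b then 2 else 3)
    have h3 := leaf_mem_supp hok hk
    have h4 := cap_length_le (h.sub w) b
    have h7 := supp_subset hok (Or.inl h3.1)
    have h8 := supp_subset hok (Or.inr h3.2)
    simp only [Option.elim_some] at hd
    rw [Real.dist_eq] at hd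
    have h9 : |((((ρ.sub w).child (if b then 2 else 3)).leaf k).1 -
        (((ρ.sub w).child (if b then 2 else 3)).leaf k).2)| ≤ (ρ.sub w).size := by
      rw [abs_le]
      constructor <;> linarith [h7.1, h7.2, h8.1, h8.2]
    linarith

/-- If the corners of a rectangle all move by at least `δ`, so do the leaves with given address. -/
theorem le_leaf_sub {ρ σ : Rect} {δ : ℝ} (ha : ρ.a + δ ≤ σ.a) (hb : ρ.b + δ ≤ σ.b)
    (hc : ρ.c + δ ≤ σ.c) (hd : ρ.d + δ ≤ σ.d) (w : List (Fin 4)) {k : ℝ} (hk : k ∈ cantor) :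
    ((ρ.sub w).leaf k).1 + δ ≤ ((σ.sub w).leaf k).1 ∧
      ((ρ.sub w).leaf k).2 + δ ≤ ((σ.sub w).leaf k).2 := by
  induction w generalizing ρ σ with
  | nil =>
    have k0 := cantor_nonneg hk
    have k1 := cantor_le_one hk
    simp only [leaf, sub]
    constructor <;> nlinarith
  | cons i w ih =>
    apply ih <;> fin_cases i <;> simp only [Rect.child, s, t, s', t'] <;> linarith

theorem abs_leaf_sub_le (h : ρ.Ok) (hs : ρ.size ≤ 1) (w : List (Fin 4)) (k l : ℝ) :
    |((ρ.sub w).leaf k).1 - ((ρ.sub w).leaf l).1| ≤ |k - l| ∧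
      |((ρ.sub w).leaf k).2 - ((ρ.sub w).leaf l).2| ≤ |k - l| := by
  have h1 : (ρ.sub w).size ≤ 1 := by
    have h2 := size_sub h w
    have h3 : (1 / 2 : ℝ) ^ w.length ≤ 1 := pow_le_one₀ (by norm_num) (by norm_num)
    have h4 : 0 ≤ ρ.size := (sub_nonneg.2 h.ab.le).trans (le_max_left _ _)
    nlinarith
  obtain ⟨o1, o2, o3⟩ := h.sub w
  have h5 := (le_max_left _ _).trans h1
  have h6 := (le_max_right _ _).trans h1
  simp only [leaf]
  constructor
  · have e : (ρ.sub w).a + k * ((ρ.sub w).b - (ρ.sub w).a) -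
        ((ρ.sub w).a + l * ((ρ.sub w).b - (ρ.sub w).a)) =
        (k - l) * ((ρ.sub w).b - (ρ.sub w).a) := by ring
    rw [e, abs_mul, abs_of_pos (sub_pos.2 o1)]
    nlinarith [abs_nonneg (k - l)]
  · have e : (ρ.sub w).d - k * ((ρ.sub w).d - (ρ.sub w).c) -
        ((ρ.sub w).d - l * ((ρ.sub w).d - (ρ.sub w).c)) =
        -((k - l) * ((ρ.sub w).d - (ρ.sub w).c)) := by ring
    rw [e, abs_neg, abs_mul, abs_of_pos (sub_pos.2 o3)]
    nlinarith [abs_nonneg (k - l)]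

end Rect

/-! ### Homeomorphisms of the circle from lifts -/

/-- The orientation-preserving homeomorphism of the circle with a given lift to the line. -/
def ofLift (e : ℝ ≃o ℝ) (he : ∀ x, e (x + 1) = e x + 1) : HomeoPlus := by
  have he' : ∀ x, e.symm (x + 1) = e.symm x + 1 := by
    intro x
    apply e.injective
    rw [e.apply_symm_apply, he, e.apply_symm_apply]
  have per : ∀ e : ℝ ≃o ℝ, (∀ x, e (x + 1) = e x + 1) →
      Function.Periodic (fun x => ((e x : ℝ) : S1)) 1 := by
    intro e he x
    simp only [he, coe_add_one]
  have cont : ∀ (e : ℝ ≃o ℝ) (he : ∀ x, e (x + 1) = e x + 1), Continuous (per e he).lift := by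
    intro e he
    refine (QuotientAddGroup.isQuotientMap_mk
      (N := AddSubgroup.zmultiples (1 : ℝ))).continuous_iff.2 ?_
    exact (AddCircle.continuous_mk' 1).comp e.continuous
  exact
  { val :=
    { toFun := (per e he).lift
      invFun := (per e.symm he').lift
      left_inv := by
        intro t
        obtain ⟨x, -, -, rfl⟩ := exists_coe_Ico 0 t
        rw [Function.Periodic.lift_coe, Function.Periodic.lift_coe, e.symm_apply_apply]
      right_inv := by
        intro t
        obtain ⟨x, -, -, rfl⟩ := exists_coe_Ico 0 t
        rw [Function.Periodic.lift_coe, Function.Periodic.lift_coe, e.apply_symm_apply]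
      continuous_toFun := cont e he
      continuous_invFun := cont e.symm he' }
    property := by
      intro x y z
      change sbtw ((per e he).lift x) ((per e he).lift y) ((per e he).lift z) ↔ _
      obtain ⟨x, -, -, rfl⟩ := exists_coe_Ico 0 x
      obtain ⟨y, y1, y2, rfl⟩ := exists_coe_Ico x y
      obtain ⟨z, z1, z2, rfl⟩ := exists_coe_Ico x z
      rw [Function.Periodic.lift_coe, Function.Periodic.lift_coe, Function.Periodic.lift_coe,
        sbtw_coe_iff y1 y2 z1 z2, sbtw_coe_iff (e.monotone y1) (by rw [← he]; exact e.strictMono y2)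
          (e.monotone z1) (by rw [← he]; exact e.strictMono z2), e.lt_iff_lt, e.lt_iff_lt] }

theorem HomeoPlus.ext {f g : HomeoPlus} (h : ∀ x : ℝ, f.1 (x : S1) = g.1 (x : S1)) : f = g := by
  apply Subtype.ext
  apply Homeomorph.ext
  intro t
  obtain ⟨x, -, -, rfl⟩ := exists_coe_Ico 0 t
  exact h x

theorem mul_apply (f g : HomeoPlus) (t : S1) : (f * g).1 t = f.1 (g.1 t) := rfl

theorem one_apply (t : S1) : (1 : HomeoPlus).1 t = t := rfl

/-- The rotation by `i / N`. -/
def spin (N : ℕ) (i : ℤ) : HomeoPlus :=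
  ofLift (OrderIso.addRight ((i : ℝ) / N)) fun x => by simp; ring

theorem spin_coe (N : ℕ) (i : ℤ) (x : ℝ) : (spin N i).1 (x : S1) = ((x + i / N : ℝ) : S1) := rfl

theorem spin_add (N : ℕ) (i j : ℤ) : spin N (i + j) = spin N i * spin N j := by
  apply HomeoPlus.ext
  intro x
  rw [mul_apply, spin_coe, spin_coe, spin_coe]
  congr 1
  push_cast
  ring

theorem spin_eq_one {N : ℕ} (hN : N ≠ 0) {i : ℤ} (h : (N : ℤ) ∣ i) : spin N i = 1 := by
  obtain ⟨j, rfl⟩ := h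
  apply HomeoPlus.ext
  intro x
  have hN' : (N : ℝ) ≠ 0 := by exact_mod_cast hN
  rw [spin_coe, one_apply, ← coe_add_int x j]
  congr 1
  push_cast
  field_simp

theorem spin_inv {N : ℕ} (hN : N ≠ 0) (i : ℤ) : (spin N i)⁻¹ = spin N (-i) := by
  rw [inv_eq_iff_mul_eq_one, ← spin_add, add_neg_cancel, spin_eq_one hN (dvd_zero _)]

theorem spin_emod {N : ℕ} (hN : N ≠ 0) (i : ℤ) : spin N (i % N) = spin N i := by
  conv_rhs => rw [← Int.emod_add_mul_ediv i N, spin_add, spin_eq_one hN (Dvd.intro _ rfl), mul_one]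

theorem spin_pow {N : ℕ} (hN : N ≠ 0) (i : ℤ) (n : ℕ) : spin N i ^ n = spin N (n * i) := by
  induction n with
  | zero => simp [spin_eq_one hN]
  | succ n ih => rw [pow_succ, ih, ← spin_add]; congr 1; push_cast; ring

theorem spin_zpow {N : ℕ} (hN : N ≠ 0) (i n : ℤ) : spin N i ^ n = spin N (n * i) := by
  obtain ⟨n, rfl | rfl⟩ := n.eq_nat_or_neg
  · rw [zpow_natCast, spin_pow hN]
  · rw [zpow_neg, zpow_natCast, spin_pow hN, spin_inv hN]; congr 1; ring

theorem Fix_spin {N : ℕ} (hN : N ≠ 0) {i : ℤ} (hi : ¬ (N : ℤ) ∣ i) : Fix (spin N i) = ∅ := by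
  rw [eq_empty_iff_forall_notMem]
  intro t ht
  obtain ⟨x, -, -, rfl⟩ := exists_coe_Ico 0 t
  have hN' : (N : ℝ) ≠ 0 := by exact_mod_cast hN
  have h1 : ((x + i / N : ℝ) : S1) = (x : S1) := ht
  rw [AddCircle.coe_add, add_eq_left, AddCircle.coe_eq_zero_iff] at h1
  obtain ⟨n, hn⟩ := h1
  apply hi
  refine ⟨n, ?_⟩
  rw [eq_div_iff hN'] at hn
  have : (i : ℝ) = ((N * n : ℤ) : ℝ) := by rw [← hn]; push_cast; simp; ring
  exact_mod_cast this

/-! ### The involution -/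

section Involution

variable (N : ℕ)

/-- The lift of the involution. With `v = 1 / (2 N)` and slope `m = 2 N - 1`, it maps the short arc
`[0, v]` onto the complementary arc `[v, 1]` with slope `m`, and `[v, 1]` onto `[1, 1 + v]` with
slope `1 / m`. -/
def flipLift (x : ℝ) : ℝ :=
  (⌊x - 1 / (2 * N)⌋ + 1) + 1 / (2 * N) + max ((x - (⌊x - 1 / (2 * N)⌋ + 1)) / (2 * N - 1))
    ((2 * N - 1) * (x - (⌊x - 1 / (2 * N)⌋ + 1)))

variable {N}

theorem flipLift_eq (n : ℤ) {y : ℝ} (h1 : 1 / (2 * N : ℝ) - 1 ≤ y) (h2 : y < 1 / (2 * N : ℝ)) :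
    flipLift N (n + y) = n + 1 / (2 * N) + max (y / (2 * N - 1)) ((2 * N - 1) * y) := by
  have hf : ⌊(n : ℝ) + y - 1 / (2 * N)⌋ = n - 1 := by
    rw [Int.floor_eq_iff]
    push_cast
    constructor <;> linarith
  rw [flipLift, hf]
  push_cast
  have : (n : ℝ) + y - (n - 1 + 1) = y := by ring
  rw [this]
  ring

theorem exists_int_add (x w : ℝ) : ∃ (n : ℤ) (y : ℝ), w - 1 ≤ y ∧ y < w ∧ x = n + y := by
  refine ⟨⌊x - w⌋ + 1, x - (⌊x - w⌋ + 1), ?_, ?_, by push_cast; ring⟩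
  · have := Int.floor_le (x - w); linarith
  · have := Int.lt_floor_add_one (x - w); linarith

theorem flipLift_add_one (x : ℝ) : flipLift N (x + 1) = flipLift N x + 1 := by
  obtain ⟨n, y, h1, h2, rfl⟩ := exists_int_add x (1 / (2 * N))
  have : (n : ℝ) + y + 1 = ((n + 1 : ℤ) : ℝ) + y := by push_cast; ring
  rw [this, flipLift_eq _ h1 h2, flipLift_eq _ h1 h2]
  push_cast
  ring

variable (hN : 3 ≤ N)
include hN

theorem slope_ge : (5 : ℝ) ≤ 2 * N - 1 := by
  have : (3 : ℝ) ≤ N := by exact_mod_cast hN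
  linarith

theorem sq_slope : (0 : ℝ) ≤ (2 * N - 1) * (2 * N - 1) - 1 := by
  have := slope_ge hN
  nlinarith

theorem slope_mul : (2 * N - 1 : ℝ) * (1 / (2 * N)) = 1 - 1 / (2 * N) := by
  have : (0 : ℝ) < N := by exact_mod_cast (by omega : 0 < N)
  field_simp

theorem one_div_pos' : (0 : ℝ) < 1 / (2 * N) := by
  have : (0 : ℝ) < N := by exact_mod_cast (by omega : 0 < N)
  positivity

theorem one_div_lt : (1 : ℝ) / (2 * N) < 1 / 5 := by
  have := slope_ge hN
  exact one_div_lt_one_div_of_lt (by norm_num) (by linarith)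

theorem flipLift_neg (n : ℤ) {y : ℝ} (h1 : 1 / (2 * N : ℝ) - 1 ≤ y) (h2 : y ≤ 0) :
    flipLift N (n + y) = n + 1 / (2 * N) + y / (2 * N - 1) := by
  have := slope_ge hN
  have := one_div_pos' hN
  rw [flipLift_eq n h1 (by linarith), max_eq_left]
  rw [le_div_iff₀ (by linarith)]
  nlinarith [mul_nonneg (neg_nonneg.2 h2) (sq_slope hN)]

theorem flipLift_pos (n : ℤ) {y : ℝ} (h1 : 0 ≤ y) (h2 : y < 1 / (2 * N)) :
    flipLift N (n + y) = n + 1 / (2 * N) + (2 * N - 1) * y := by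
  have := slope_ge hN
  have := one_div_lt hN
  rw [flipLift_eq n (by linarith) h2, max_eq_right]
  rw [div_le_iff₀ (by linarith)]
  nlinarith [mul_nonneg h1 (sq_slope hN)]

theorem flipLift_flipLift (x : ℝ) : flipLift N (flipLift N x) = x + 1 := by
  have h5 := slope_ge hN
  have hv := one_div_pos' hN
  have hm := slope_mul hN
  have hv' := one_div_lt hN
  obtain ⟨n, y, h1, h2, rfl⟩ := exists_int_add x (1 / (2 * N))
  rcases lt_or_ge y 0 with hy | hy
  · rw [flipLift_neg hN n h1 hy.le]
    have h3 : -(1 / (2 * N)) ≤ y / (2 * N - 1) := by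
      rw [le_div_iff₀ (by linarith)]; linarith
    have h4 : y / (2 * N - 1) < 0 := div_neg_of_neg_of_pos hy (by linarith)
    have e : (n : ℝ) + 1 / (2 * N) + y / (2 * N - 1) = n + (1 / (2 * N) + y / (2 * N - 1)) := by
      ring
    rw [e, flipLift_pos hN n (by linarith) (by linarith), mul_add, hm,
      mul_div_cancel₀ y (by linarith)]
    ring
  · rw [flipLift_pos hN n hy h2]
    have h3 : (2 * N - 1) * y < 1 - 1 / (2 * N) := by rw [← hm]; gcongr
    have h4 : 0 ≤ (2 * N - 1) * y := mul_nonneg (by linarith) hy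
    have e : (n : ℝ) + 1 / (2 * N) + (2 * N - 1) * y =
        ((n + 1 : ℤ) : ℝ) + (1 / (2 * N) - 1 + (2 * N - 1) * y) := by push_cast; ring
    rw [e, flipLift_neg hN _ (by linarith) (by linarith)]
    have e2 : (1 / (2 * N) - 1 + (2 * N - 1) * y) / (2 * N - 1) = y - 1 / (2 * N) := by
      rw [div_eq_iff (by linarith)]
      linear_combination hm
    rw [e2]
    push_cast
    ring

theorem flipLift_strictMono : StrictMono (flipLift N) := by
  have h5 := slope_ge hN
  have hm := slope_mul hN
  have hv := one_div_pos' hN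
  intro x x' hx
  obtain ⟨n, y, h1, h2, rfl⟩ := exists_int_add x (1 / (2 * N))
  obtain ⟨n', y', h1', h2', rfl⟩ := exists_int_add x' (1 / (2 * N))
  rw [flipLift_eq n h1 h2, flipLift_eq n' h1' h2']
  rcases lt_trichotomy n n' with h | rfl | h
  · have h' : (n : ℝ) + 1 ≤ n' := by exact_mod_cast h
    have e1 : max (y / (2 * N - 1)) ((2 * N - 1) * y) < 1 - 1 / (2 * N) := by
      rw [max_lt_iff, div_lt_iff₀ (by linarith), ← hm]
      constructor
      · nlinarith
      · gcongr
    have e2 : -(1 / (2 * N)) ≤ max (y' / (2 * N - 1)) ((2 * N - 1) * y') := by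
      apply le_max_of_le_left
      rw [le_div_iff₀ (by linarith)]; linarith
    linarith
  · have hy : y < y' := by linarith
    have : max (y / (2 * N - 1)) ((2 * N - 1) * y) < max (y' / (2 * N - 1)) ((2 * N - 1) * y') := by
      apply max_lt_max
      · exact div_lt_div_of_pos_right hy (by linarith)
      · exact mul_lt_mul_of_pos_left hy (by linarith)
    linarith
  · have h' : (n' : ℝ) + 1 ≤ n := by exact_mod_cast h
    linarith

theorem flipLift_sub_le {x x' : ℝ} (hx : x ≤ x') :
    flipLift N x' - flipLift N x ≤ (2 * N - 1) * (x' - x) := by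
  have h5 := slope_ge hN
  have hm := slope_mul hN
  have hv := one_div_pos' hN
  have hs := sq_slope hN
  obtain ⟨n, y, h1, h2, rfl⟩ := exists_int_add x (1 / (2 * N))
  obtain ⟨n', y', h1', h2', rfl⟩ := exists_int_add x' (1 / (2 * N))
  rw [flipLift_eq n h1 h2, flipLift_eq n' h1' h2']
  generalize (2 * N - 1 : ℝ) = m at *
  generalize (1 / (2 * N) : ℝ) = v at *
  have hm0 : 0 < m := by linarith
  rcases lt_trichotomy n n' with h | rfl | h
  · have h' : (n : ℝ) + 1 ≤ n' := by exact_mod_cast h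
    have e1 : m * y ≤ max (y / m) (m * y) := le_max_right _ _
    have e2 : max (y' / m) (m * y') ≤ m * y' + (m * (1 - v) - v) := by
      apply max_le
      · rw [div_le_iff₀ hm0]
        nlinarith [mul_nonneg (sub_nonneg.2 h1') hs]
      · nlinarith
    nlinarith
  · have hy : y ≤ y' := by linarith
    have : max (y' / m) (m * y') ≤ m * (y' - y) + max (y / m) (m * y) := by
      apply max_le
      · have e1 : y / m ≤ max (y / m) (m * y) := le_max_left _ _
        have e2 : y' / m - y / m ≤ m * (y' - y) := by
          rw [← sub_div, div_le_iff₀ hm0]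
          nlinarith [mul_nonneg (sub_nonneg.2 hy) hs]
        linarith
      · have e1 : m * y ≤ max (y / m) (m * y) := le_max_right _ _
        linarith
    linarith
  · have h' : (n' : ℝ) + 1 ≤ n := by exact_mod_cast h
    linarith

/-- The involution of the circle with lift `flipLift`. -/
def flip : HomeoPlus :=
  ofLift
    { toFun := flipLift N
      invFun := fun x => flipLift N x - 1
      left_inv := fun x => by
        change flipLift N (flipLift N x) - 1 = x
        rw [flipLift_flipLift hN]; ring
      right_inv := fun x => by
        have h := flipLift_add_one (N := N) (flipLift N x - 1)
        rw [sub_add_cancel, flipLift_flipLift hN] at h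
        linarith
      map_rel_iff' := (flipLift_strictMono hN).le_iff_le }
    flipLift_add_one

theorem flip_coe (x : ℝ) : (flip hN).1 (x : S1) = ((flipLift N x : ℝ) : S1) := rfl

theorem flip_mul_flip : flip hN * flip hN = 1 := by
  apply HomeoPlus.ext
  intro x
  rw [mul_apply, flip_coe, flip_coe, flipLift_flipLift hN, coe_add_one, one_apply]

theorem flip_inv : (flip hN)⁻¹ = flip hN := inv_eq_of_mul_eq_one_right (flip_mul_flip hN)

end Involution

/-! ### The group generated by the rotation and the involution -/

section Group

variable {N : ℕ} (hN : 3 ≤ N)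

/-- The group generated by the rotation of order `N` and the involution. -/
def spinFlip : Subgroup HomeoPlus := Subgroup.closure (range (spin N) ∪ {flip hN})

theorem spin_mem (i : ℤ) : spin N i ∈ spinFlip hN := Subgroup.subset_closure (Or.inl ⟨i, rfl⟩)

theorem flip_mem : flip hN ∈ spinFlip hN := Subgroup.subset_closure (Or.inr rfl)

/-- A rotation followed by the involution. For exponents that are not divisible by `N`, these are
the contractions of an iterated function system. -/
def step (i : ℤ) : HomeoPlus := flip hN * spin N i

/-- The composition of the maps `step` along a word. -/
def steps (u : List ℤ) : HomeoPlus := (u.map (step hN)).prod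

theorem steps_cons (i : ℤ) (u : List ℤ) : steps hN (i :: u) = step hN i * steps hN u := by
  simp [steps]

theorem steps_append (u w : List ℤ) : steps hN (u ++ w) = steps hN u * steps hN w := by
  simp [steps]

/-- The words in exponents that are not divisible by `N`. -/
def Reduced (N : ℕ) (u : List ℤ) : Prop := ∀ i ∈ u, ¬ (N : ℤ) ∣ i

theorem Reduced.cons {i : ℤ} {u : List ℤ} (hi : ¬ (N : ℤ) ∣ i) (hu : Reduced N u) :
    Reduced N (i :: u) := by
  intro j hj
  rcases List.mem_cons.1 hj with rfl | hj
  exacts [hi, hu j hj]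

theorem flip_mul_flip_mul (g : HomeoPlus) : flip hN * (flip hN * g) = g := by
  rw [← mul_assoc, flip_mul_flip, one_mul]

/-- Every element of the group has the form of the normal form theorem for the free product of
`ℤ / N` and `ℤ / 2`. -/
theorem exists_normal_form {γ : HomeoPlus} (hγ : γ ∈ spinFlip hN) :
    ∃ (j : ℤ) (u : List ℤ) (e : ℕ), Reduced N u ∧ (e = 0 ∨ e = 1) ∧
      γ = spin N j * steps hN u * flip hN ^ e := by
  have hN0 : N ≠ 0 := by omega
  have key : ∀ x ∈ range (spin N) ∪ {flip hN}, ∀ y : HomeoPlus,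
      (∃ (j : ℤ) (u : List ℤ) (e : ℕ), Reduced N u ∧ (e = 0 ∨ e = 1) ∧
        y = spin N j * steps hN u * flip hN ^ e) →
      ∃ (j : ℤ) (u : List ℤ) (e : ℕ), Reduced N u ∧ (e = 0 ∨ e = 1) ∧
        x * y = spin N j * steps hN u * flip hN ^ e := by
    rintro x (⟨i, rfl⟩ | rfl) y ⟨j, u, e, hu, he, rfl⟩
    · exact ⟨i + j, u, e, hu, he, by rw [spin_add]; group⟩
    · by_cases hj : (N : ℤ) ∣ j
      · rw [spin_eq_one hN0 hj, one_mul]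
        cases u with
        | nil =>
          rcases he with rfl | rfl
          · exact ⟨0, [], 1, hu, Or.inr rfl, by simp [steps, spin_eq_one hN0]⟩
          · exact ⟨0, [], 0, hu, Or.inl rfl, by simp [steps, spin_eq_one hN0, flip_mul_flip]⟩
        | cons i u =>
          refine ⟨i, u, e, fun k hk => hu k (List.mem_cons_of_mem _ hk), he, ?_⟩
          rw [steps_cons, step, mul_assoc, mul_assoc, flip_mul_flip_mul, mul_assoc]
      · refine ⟨0, j :: u, e, hu.cons hj, he, ?_⟩
        rw [spin_eq_one hN0 (dvd_zero _), steps_cons, step]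
        group
  refine Subgroup.closure_induction_left (p := fun y _ => ∃ (j : ℤ) (u : List ℤ) (e : ℕ),
    Reduced N u ∧ (e = 0 ∨ e = 1) ∧ y = spin N j * steps hN u * flip hN ^ e)
    ?_ ?_ ?_ hγ
  · exact ⟨0, [], 0, by simp [Reduced], Or.inl rfl, by simp [steps, spin_eq_one hN0]⟩
  · exact fun x hx y _ h => key x hx y h
  · rintro x hx y _ h
    apply key _ _ y h
    rcases hx with ⟨i, rfl⟩ | hx
    · exact Or.inl ⟨-i, (spin_inv hN0 i).symm⟩
    · rw [mem_singleton_iff.1 hx]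
      exact Or.inr (flip_inv hN)

theorem countable_spinFlip : (spinFlip hN : Set HomeoPlus).Countable := by
  refine (countable_range fun p : ℤ × List ℤ × ℕ =>
    spin N p.1 * steps hN p.2.1 * flip hN ^ p.2.2).mono fun γ hγ => ?_
  obtain ⟨j, u, e, -, -, rfl⟩ := exists_normal_form hN hγ
  exact ⟨(j, u, e), rfl⟩

theorem steps_mem (u : List ℤ) : steps hN u ∈ spinFlip hN := by
  induction u with
  | nil => exact one_mem _
  | cons i u ih =>
    rw [steps_cons, step]
    exact mul_mem (mul_mem (flip_mem hN) (spin_mem hN i)) ih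

/-- Conjugation by the involution maps the inverses of the compositions of contractions to
compositions of contractions. -/
theorem flip_steps_inv_flip (u : List ℤ) :
    flip hN * (steps hN u)⁻¹ * flip hN = steps hN ((u.map fun i => -i).reverse) := by
  have hN0 : N ≠ 0 := by omega
  induction u with
  | nil => simp [steps, flip_mul_flip]
  | cons i u ih =>
    rw [List.map_cons, List.reverse_cons, steps_append, ← ih, steps_cons, step, steps_cons, step,
      mul_inv_rev, mul_inv_rev, flip_inv, spin_inv hN0]
    simp only [mul_assoc, flip_mul_flip_mul, flip_mul_flip]
    simp [steps]

/-- The base rectangle. The parameter `α` shifts its outer side, which is an edge of a regular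
polygon invariant under the rotation, and its inner side, which is invariant under the involution.
Its translates under the group fill the disk, up to the translates of the polygon. The formula for
`c` is the condition that the involution exchange `b` and `c`. -/
def base (N : ℕ) (α : ℝ) : Rect where
  a := -3 * (1 / (8 * N)) + α
  b := -2 * (1 / (8 * N)) + α
  c := 1 / (2 * N) + (-2 * (1 / (8 * N)) + α) / (2 * N - 1)
  d := 5 * (1 / (8 * N)) + α

variable {α : ℝ}

include hN

theorem eighth_pos : (0 : ℝ) < 1 / (8 * N) := by
  have : (0 : ℝ) < N := by exact_mod_cast (by omega : 0 < N)
  positivity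

theorem half_eq : (1 : ℝ) / (2 * N) = 4 * (1 / (8 * N)) := by
  have : (0 : ℝ) < N := by exact_mod_cast (by omega : 0 < N)
  field_simp
  norm_num

theorem one_div_eq : (1 : ℝ) / N = 8 * (1 / (8 * N)) := by
  have : (0 : ℝ) < N := by exact_mod_cast (by omega : 0 < N)
  field_simp

theorem eighth_le : (1 : ℝ) / (8 * N) ≤ 1 / 24 := by
  have : (3 : ℝ) ≤ N := by exact_mod_cast hN
  exact one_div_le_one_div_of_le (by norm_num) (by linarith)

variable (h0 : 0 ≤ α) (h1 : α ≤ 1 / (8 * N))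

theorem base_d : (base N α).d = (base N α).a + 1 / N := by
  rw [one_div_eq hN]; simp only [base]; ring

/-- A nontrivial rotation of the polygon moves the arc of an edge off itself, up to a common
vertex. -/
theorem spin_edge {i : ℤ} (hi : ¬ (N : ℤ) ∣ i) {x : ℝ} (hx : x ∈ Icc (base N α).a (base N α).d) :
    ∃ y, (base N α).d ≤ y ∧ y ≤ (base N α).a + 1 ∧ (spin N i).1 (x : S1) = (y : S1) ∧
      (y = (base N α).d → x = (base N α).a) ∧ (y = (base N α).a + 1 → x = (base N α).d) := by
  have hN0 : N ≠ 0 := by omega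
  have hNpos : (0 : ℝ) < N := by exact_mod_cast (by omega : 0 < N)
  have h6 := base_d hN (α := α)
  have hr0 : 0 ≤ i % N := Int.emod_nonneg _ (by exact_mod_cast hN0)
  have hr1 : i % N < N := Int.emod_lt_of_pos _ (by omega)
  have hr2 : i % N ≠ 0 := fun h => hi (Int.dvd_of_emod_eq_zero h)
  rw [← spin_emod hN0]
  generalize i % N = r at *
  have r1 : (1 : ℝ) ≤ r := by exact_mod_cast (by omega : 1 ≤ r)
  have r2 : (r : ℝ) + 1 ≤ N := by exact_mod_cast (by omega : r + 1 ≤ N)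
  have r3 : 1 / (N : ℝ) ≤ r / N := by gcongr
  have r4 : (r : ℝ) / N + 1 / N ≤ 1 := by
    rw [← add_div, div_le_one hNpos]; exact r2
  have hx1 := hx.1
  have hx2 := hx.2
  exact ⟨x + r / N, by linarith, by linarith, spin_coe N r x, fun e => by linarith,
    fun e => by linarith⟩

theorem base_length : (base N α).d < (base N α).a + 1 / 2 := by
  have h2 := eighth_le hN
  have h3 := base_d hN (α := α)
  rw [one_div_eq hN] at h3
  linarith

include h0 h1

theorem base_bounds : -(3 * (1 / (8 * N))) ≤ (base N α).a ∧
    (base N α).a + 1 / (8 * N) = (base N α).b ∧ (base N α).b ≤ -(1 / (8 * N)) ∧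
    0 < (base N α).c ∧ (base N α).c < 1 / (2 * N) ∧ 5 * (1 / (8 * N)) ≤ (base N α).d ∧
    (base N α).d ≤ 6 * (1 / (8 * N)) ∧
    (base N α).c = 1 / (2 * N) + (base N α).b / (2 * N - 1) := by
  have h2 := eighth_pos hN
  have h3 := half_eq hN
  have h5 := slope_ge hN
  have h6 : (-2 * (1 / (8 * N)) + α) / (2 * N - 1) < 0 :=
    div_neg_of_neg_of_pos (by linarith) (by linarith)
  have h7 : -2 * (1 / (8 * N)) ≤ (-2 * (1 / (8 * N)) + α) / (2 * N - 1) := by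
    rw [le_div_iff₀ (by linarith)]
    nlinarith
  simp only [base]
  refine ⟨by linarith, by ring, by linarith, by linarith, by linarith, by linarith, by linarith,
    trivial⟩

theorem base_ok : (base N α).Ok := by
  have h2 := eighth_pos hN
  have h3 := half_eq hN
  obtain ⟨b1, b2, b3, b4, b5, b6, b7, b8⟩ := base_bounds hN h0 h1
  constructor <;> linarith

theorem flipLift_c : flipLift N (base N α).c = (base N α).b + 1 := by
  have h2 := eighth_pos hN
  have hm := slope_mul hN
  have h5 := slope_ge hN
  obtain ⟨b1, b2, b3, b4, b5, b6, b7, b8⟩ := base_bounds hN h0 h1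
  have := flipLift_pos hN 0 b4.le b5
  push_cast at this
  rw [zero_add] at this
  rw [this, b8, mul_add, hm, mul_div_cancel₀ _ (by linarith)]
  ring

theorem flipLift_b : flipLift N (base N α).b = (base N α).c := by
  have h2 := eighth_pos hN
  have h3 := half_eq hN
  have h4 := eighth_le hN
  obtain ⟨b1, b2, b3, b4, b5, b6, b7, b8⟩ := base_bounds hN h0 h1
  have := flipLift_neg hN 0 (y := (base N α).b) (by linarith) (by linarith)
  push_cast at this
  rw [zero_add] at this
  rw [this, b8]
  ring

theorem flip_b : (flip hN).1 ((base N α).b : S1) = ((base N α).c : S1) := by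
  rw [flip_coe, flipLift_b hN h0 h1]

theorem flip_c : (flip hN).1 ((base N α).c : S1) = ((base N α).b : S1) := by
  rw [flip_coe, flipLift_c hN h0 h1, coe_add_one]

/-- The involution maps the base rectangle to the other side of its inner side. -/
theorem flip_supp {x : ℝ} (hx : x ∈ (base N α).supp) :
    ∃ y, (base N α).b ≤ y ∧ y ≤ (base N α).c ∧ (flip hN).1 (x : S1) = (y : S1) := by
  have hmono := (flipLift_strictMono hN).monotone
  have hok := base_ok hN h0 h1
  have h2 := base_length hN (α := α)
  have eb := flipLift_b hN h0 h1
  have ec := flipLift_c hN h0 h1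
  have key : ∀ x, (base N α).c ≤ x → x ≤ (base N α).b + 1 →
      ∃ y, (base N α).b ≤ y ∧ y ≤ (base N α).c ∧ (flip hN).1 (x : S1) = (y : S1) := by
    intro x x1 x2
    refine ⟨flipLift N x - 1, ?_, ?_, ?_⟩
    · have := hmono x1; linarith
    · have := hmono x2; rw [flipLift_add_one] at this; linarith
    · rw [flip_coe, ← coe_add_one (flipLift N x - 1), sub_add_cancel]
  obtain ⟨o1, o2, o3⟩ := hok
  rcases hx with ⟨x1, x2⟩ | ⟨x1, x2⟩
  · rw [← coe_add_one]
    exact key (x + 1) (by linarith) (by linarith)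
  · exact key x x1 (by linarith)

/-- A rotation that does not fix the polygon edge moves it to the complementary arc, on which the
involution is an affine contraction. -/
theorem step_coe {i : ℤ} (hi : ¬ (N : ℤ) ∣ i) : ∃ c : ℝ, ∀ x ∈ Icc (base N α).a (base N α).d,
    (step hN i).1 (x : S1) = ((c + x / (2 * N - 1) : ℝ) : S1) ∧
      0 < c + x / (2 * N - 1) ∧ c + x / (2 * N - 1) < (base N α).c := by
  have hN0 : N ≠ 0 := by omega
  have hNpos : (0 : ℝ) < N := by exact_mod_cast (by omega : 0 < N)
  have h2 := eighth_pos hN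
  have h3 := half_eq hN
  have h4 := eighth_le hN
  have h5 := slope_ge hN
  have h6 := base_d hN (α := α)
  obtain ⟨b1, b2, b3, b4, b5, b6, b7, b8⟩ := base_bounds hN h0 h1
  have hr0 : 0 ≤ i % N := Int.emod_nonneg _ (by exact_mod_cast hN0)
  have hr1 : i % N < N := Int.emod_lt_of_pos _ (by omega)
  have hr2 : i % N ≠ 0 := fun h => hi (Int.dvd_of_emod_eq_zero h)
  rw [step, ← spin_emod hN0]
  generalize i % N = r at *
  have r1 : (1 : ℝ) ≤ r := by exact_mod_cast (by omega : 1 ≤ r)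
  have r2 : (r : ℝ) + 1 ≤ N := by exact_mod_cast (by omega : r + 1 ≤ N)
  have r3 : 1 / (N : ℝ) ≤ r / N := by gcongr
  have r4 : (r : ℝ) / N + 1 / N ≤ 1 := by
    rw [← add_div, div_le_one hNpos]; exact r2
  refine ⟨1 / (2 * N) + (r / N - 1) / (2 * N - 1), fun x hx => ?_⟩
  have e : 1 / (2 * N : ℝ) + (r / N - 1) / (2 * N - 1) + x / (2 * N - 1) =
      1 / (2 * N) + (x + r / N - 1) / (2 * N - 1) := by ring
  rw [e]
  have hx1 := hx.1
  have hx2 := hx.2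
  have hm := slope_mul hN
  refine ⟨?_, ?_, ?_⟩
  · rw [mul_apply, spin_coe, flip_coe]
    have e2 : flipLift N (x + r / N) = flipLift N (((1 : ℤ) : ℝ) + (x + r / N - 1)) := by
      congr 1; push_cast; ring
    rw [e2, flipLift_neg hN 1 (by linarith) (by linarith),
      ← coe_add_one (1 / (2 * N) + (x + r / N - 1) / (2 * N - 1))]
    congr 1
    push_cast
    ring
  · have : -(1 / (2 * N)) < (x + r / N - 1) / (2 * N - 1) := by
      rw [lt_div_iff₀ (by linarith)]
      linarith
    linarith
  · rw [b8]
    have : (x + r / N - 1) / (2 * N - 1) < (base N α).b / (2 * N - 1) :=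
      div_lt_div_of_pos_right (by linarith) (by linarith)
    linarith

/-- A composition of contractions is affine on the arc of the polygon edge, which it maps to
itself. -/
theorem steps_coe {u : List ℤ} (hu : Reduced N u) : ∃ c : ℝ,
    ∀ x ∈ Icc (base N α).a (base N α).d,
    (steps hN u).1 (x : S1) = ((c + x / (2 * N - 1) ^ u.length : ℝ) : S1) ∧
      c + x / (2 * N - 1) ^ u.length ∈ Icc (base N α).a (base N α).d ∧
      (u ≠ [] → 0 < c + x / (2 * N - 1) ^ u.length ∧
        c + x / (2 * N - 1) ^ u.length < (base N α).c) := by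
  obtain ⟨b1, b2, b3, b4, b5, b6, b7, b8⟩ := base_bounds hN h0 h1
  obtain ⟨o1, o2, o3⟩ := base_ok hN h0 h1
  have h2 := eighth_pos hN
  induction u with
  | nil => exact ⟨0, fun x hx => by simpa [steps, one_apply] using hx⟩
  | cons i u ih =>
    obtain ⟨c, hc⟩ := ih fun k hk => hu k (List.mem_cons_of_mem _ hk)
    obtain ⟨c', hc'⟩ := step_coe hN h0 h1 (hu i List.mem_cons_self)
    refine ⟨c' + c / (2 * N - 1), fun x hx => ?_⟩
    have h3 := hc x hx
    have h4 := hc' _ h3.2.1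
    have e : c' + c / (2 * N - 1) + x / (2 * N - 1) ^ (i :: u).length =
        c' + (c + x / (2 * N - 1) ^ u.length) / (2 * N - 1) := by
      rw [List.length_cons, pow_succ, add_div, div_div]; ring
    rw [e, steps_cons, mul_apply, h3.1, h4.1]
    refine ⟨rfl, ⟨by linarith [h4.2.1], by linarith [h4.2.2]⟩, fun _ => h4.2⟩

/-- The position of a translate of the base rectangle, relative to the base rectangle. It is the
base rectangle, or its neighbour across the inner side, or another rectangle on an edge of the
polygon, or else it is strictly beyond the inner side, or strictly beyond another edge of the
polygon. -/
theorem classify {γ : HomeoPlus} (hγ : γ ∈ spinFlip hN) :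
    γ = 1 ∨ γ = flip hN ∨ (∃ j, ¬ (N : ℤ) ∣ j ∧ γ = spin N j) ∨
    (∀ x ∈ (base N α).supp, ∃ y, (base N α).b < y ∧ y < (base N α).c ∧ γ.1 (x : S1) = (y : S1)) ∨
    (∃ j, ¬ (N : ℤ) ∣ j ∧ ∀ x ∈ (base N α).supp, ∃ y, (base N α).a < y ∧ y < (base N α).d ∧
      γ.1 (x : S1) = (spin N j).1 (y : S1)) := by
  have hN0 : N ≠ 0 := by omega
  have hok := base_ok hN h0 h1
  obtain ⟨b1, b2, b3, b4, b5, b6, b7, b8⟩ := base_bounds hN h0 h1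
  have h2 := eighth_pos hN
  obtain ⟨j, u, e, hu, he, rfl⟩ := exists_normal_form hN hγ
  obtain ⟨c, hc⟩ := steps_coe hN h0 h1 hu
  have hsupp := Rect.supp_subset hok
  obtain ⟨o1, o2, o3⟩ := hok
  have hflip : ∀ x ∈ (base N α).supp, ∃ y ∈ Icc (base N α).a (base N α).d,
      (flip hN ^ e).1 (x : S1) = (y : S1) := by
    intro x hx
    rcases he with rfl | rfl
    · exact ⟨x, hsupp hx, rfl⟩
    · obtain ⟨y, y1, y2, hy⟩ := flip_supp hN h0 h1 hx
      exact ⟨y, ⟨by linarith, by linarith⟩, by rw [pow_one, hy]⟩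
  have hsteps : u ≠ [] → ∀ x ∈ (base N α).supp, ∃ y, (base N α).b < y ∧ y < (base N α).c ∧
      (steps hN u * flip hN ^ e).1 (x : S1) = (y : S1) := by
    intro hne x hx
    obtain ⟨y, hy, hy'⟩ := hflip x hx
    obtain ⟨e1, -, e2⟩ := hc y hy
    exact ⟨_, by linarith [(e2 hne).1], (e2 hne).2, by rw [mul_apply, hy', e1]⟩
  by_cases hj : (N : ℤ) ∣ j
  · rw [spin_eq_one hN0 hj, one_mul]
    by_cases hne : u = []
    · subst hne
      rcases he with rfl | rfl
      · exact Or.inl (by simp [steps])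
      · exact Or.inr (Or.inl (by simp [steps]))
    · exact Or.inr (Or.inr (Or.inr (Or.inl (hsteps hne))))
  · by_cases hne : u = []
    · subst hne
      rcases he with rfl | rfl
      · exact Or.inr (Or.inr (Or.inl ⟨j, hj, by simp [steps]⟩))
      · refine Or.inr (Or.inr (Or.inr (Or.inr ⟨j, hj, fun x hx => ?_⟩)))
        obtain ⟨y, y1, y2, hy⟩ := flip_supp hN h0 h1 hx
        exact ⟨y, by linarith, by linarith, by rw [← hy]; simp [steps]⟩
    · refine Or.inr (Or.inr (Or.inr (Or.inr ⟨j, hj, fun x hx => ?_⟩)))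
      obtain ⟨y, y1, y2, hy⟩ := hsteps hne x hx
      exact ⟨y, by linarith, by linarith, by rw [← hy, mul_assoc]; rfl⟩

/-! ### Fixed points -/

/-- The composition is a contraction of an arc, and its inverse is conjugate by the involution to a
contraction of the same arc. This leaves one fixed point for the arc and one for its complement. -/
theorem Fix_steps {u : List ℤ} (hu : Reduced N u) (hne : u ≠ []) :
    (Fix (steps hN u)).encard ≤ 2 := by
  have hok := base_ok hN h0 h1
  have hlen := base_length hN (α := α)
  have h5 := slope_ge hN
  -- A contraction of the arc of the polygon edge has at most one fixed point there.
  have key : ∀ w : List ℤ, Reduced N w → w ≠ [] →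
      (Fix (steps hN w) ∩ arc (base N α).a (base N α).d).Subsingleton := by
    rintro w hw hne _ ⟨ht, x, hx, rfl⟩ _ ⟨ht', y, hy, rfl⟩
    obtain ⟨c, hc⟩ := steps_coe hN h0 h1 hw
    have hp : (1 : ℝ) < (2 * N - 1) ^ w.length :=
      one_lt_pow₀ (by linarith) (by simpa using hne)
    have fix : ∀ x ∈ Icc (base N α).a (base N α).d, (x : S1) ∈ Fix (steps hN w) →
        c + x / (2 * N - 1) ^ w.length = x := by
      intro x hx ht
      obtain ⟨e1, e2, -⟩ := hc x hx
      have e3 : (steps hN w).1 (x : S1) = (x : S1) := ht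
      rw [e1, coe_eq_coe_iff_of_window e2.1 (by linarith [e2.2]) hx.1 (by linarith [hx.2])] at e3
      exact e3
    have f1 := fix x hx ht
    have f2 := fix y hy ht'
    have f3 : x - y = (x - y) / (2 * N - 1) ^ w.length := by rw [sub_div]; linarith
    rw [eq_div_iff (by linarith)] at f3
    have f4 : (x - y) * ((2 * N - 1 : ℝ) ^ w.length - 1) = 0 := by linarith
    rcases mul_eq_zero.1 f4 with f5 | f5
    · simp only; congr 1; linarith
    · linarith
  have hu' : Reduced N ((u.map fun i => -i).reverse) := by
    intro i hi
    simp only [List.mem_reverse, List.mem_map] at hi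
    obtain ⟨j, hj, rfl⟩ := hi
    rw [dvd_neg]
    exact hu j hj
  -- Off that arc, conjugation of the inverse by the involution leads back to the arc.
  have hsub : Fix (steps hN u) ⊆ (Fix (steps hN u) ∩ arc (base N α).a (base N α).d) ∪
      (flip hN).1 '' (Fix (steps hN ((u.map fun i => -i).reverse)) ∩
        arc (base N α).a (base N α).d) := by
    intro t ht
    by_cases hta : t ∈ arc (base N α).a (base N α).d
    · exact Or.inl ⟨ht, hta⟩
    · right
      refine ⟨(flip hN).1 t, ⟨?_, ?_⟩, ?_⟩
      · change (steps hN _).1 _ = _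
        rw [← flip_steps_inv_flip, ← mul_apply, mul_assoc, flip_mul_flip, mul_one, mul_apply]
        congr 1
        have : (steps hN u).1 t = t := ht
        conv_lhs => rw [← this]
        exact (steps hN u).1.symm_apply_apply t
      · rcases mem_arc_or (x := (base N α).a) (y := (base N α).d) t with h | h
        · exact absurd h hta
        · obtain ⟨x, ⟨x1, x2⟩, rfl⟩ := h
          have hmono := (flipLift_strictMono hN).monotone
          obtain ⟨o1, o2, o3⟩ := hok
          have e1 := hmono (show (base N α).c ≤ x by linarith)
          have e2 := hmono (show x ≤ (base N α).b + 1 by linarith)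
          rw [flipLift_c hN h0 h1] at e1
          rw [flipLift_add_one, flipLift_b hN h0 h1] at e2
          refine ⟨flipLift N x - 1, ⟨by linarith, by linarith⟩, ?_⟩
          simp only
          rw [flip_coe, ← coe_add_one (flipLift N x - 1), sub_add_cancel]
      · rw [← mul_apply, flip_mul_flip, one_apply]
  refine (encard_le_encard hsub).trans ((encard_union_le _ _).trans ?_)
  have e1 := encard_le_one_iff_subsingleton.2 (key u hu hne)
  have e2 := encard_le_one_iff_subsingleton.2
    ((key _ hu' (by simpa using hne)).image (flip hN).1)
  calc _ ≤ (1 : ℕ∞) + 1 := add_le_add e1 e2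
    _ = 2 := by norm_num

end Group

theorem Fix_conj (c g : HomeoPlus) : Fix (c * g * c⁻¹) = c.1 '' Fix g := by
  ext t
  constructor
  · intro ht
    refine ⟨(c⁻¹).1 t, ?_, c.1.apply_symm_apply t⟩
    have h : c.1 (g.1 ((c⁻¹).1 t)) = t := ht
    change g.1 ((c⁻¹).1 t) = (c⁻¹).1 t
    conv_rhs => rw [← h]
    exact (c.1.symm_apply_apply _).symm
  · rintro ⟨x, hx, rfl⟩
    change c.1 (g.1 ((c⁻¹).1 (c.1 x))) = c.1 x
    have h : (c⁻¹).1 (c.1 x) = x := c.1.symm_apply_apply x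
    have hx : g.1 x = x := hx
    rw [h, hx]

theorem encard_Fix_conj (c g : HomeoPlus) : (Fix (c * g * c⁻¹)).encard = (Fix g).encard := by
  rw [Fix_conj, c.1.injective.encard_image]

/-! ### Free products -/

section FreeProduct

open Monoid.Coprod

variable {G H : Type*} [Group G] [Group H]

/-- The alternating product of a list of pairs in a free product. -/
def altProd (L : List (G × H)) : Monoid.Coprod G H := (L.map fun x => inl x.1 * inr x.2).prod

/-- All letters of the alternating product are nontrivial. -/
def Alt (L : List (G × H)) : Prop := ∀ x ∈ L, x.1 ≠ 1 ∧ x.2 ≠ 1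

theorem altProd_cons (x : G × H) (L : List (G × H)) :
    altProd (x :: L) = inl x.1 * inr x.2 * altProd L := by simp [altProd]

theorem altProd_append (L M : List (G × H)) : altProd (L ++ M) = altProd L * altProd M := by
  simp [altProd]

theorem Alt.cons {x : G × H} {L : List (G × H)} (hx : x.1 ≠ 1 ∧ x.2 ≠ 1) (hL : Alt L) :
    Alt (x :: L) := by
  intro y hy
  rcases List.mem_cons.1 hy with rfl | hy
  exacts [hx, hL y hy]

theorem exists_alternating (w : Monoid.Coprod G H) : ∃ (h : H) (L : List (G × H)) (g : G),
    Alt L ∧ w = inr h * altProd L * inl g := by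
  classical
  induction w using Monoid.Coprod.induction_on' with
  | one => exact ⟨1, [], 1, by simp [Alt], by simp [altProd]⟩
  | inl_mul g' w ih =>
    obtain ⟨h, L, g, hL, rfl⟩ := ih
    by_cases hg' : g' = 1
    · exact ⟨h, L, g, hL, by simp [hg']⟩
    by_cases hh : h = 1
    · subst hh
      cases L with
      | nil => exact ⟨1, [], g' * g, hL, by simp [altProd]⟩
      | cons x L =>
        have hL' : Alt L := fun y hy => hL y (List.mem_cons_of_mem _ hy)
        by_cases hx : g' * x.1 = 1
        · refine ⟨x.2, L, g, hL', ?_⟩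
          rw [altProd_cons, map_one, one_mul]
          simp only [← mul_assoc]
          rw [← map_mul, hx, map_one, one_mul]
        · refine ⟨1, (g' * x.1, x.2) :: L, g, hL'.cons ⟨hx, (hL x List.mem_cons_self).2⟩, ?_⟩
          rw [altProd_cons, altProd_cons, map_mul]
          simp [mul_assoc]
    · refine ⟨1, (g', h) :: L, g, hL.cons ⟨hg', hh⟩, ?_⟩
      rw [altProd_cons]
      simp [mul_assoc]
  | inr_mul h' w ih =>
    obtain ⟨h, L, g, hL, rfl⟩ := ih
    exact ⟨h' * h, L, g, hL, by simp [mul_assoc]⟩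

/-- A nontrivial element of a free product is conjugate to a nontrivial element of a factor or to a
nonempty cyclically reduced alternating product. -/
theorem exists_conj {w : Monoid.Coprod G H} (hw : w ≠ 1) : ∃ c x, w = c * x * c⁻¹ ∧
    ((∃ g : G, g ≠ 1 ∧ x = inl g) ∨ (∃ h : H, h ≠ 1 ∧ x = inr h) ∨
      ∃ L : List (G × H), L ≠ [] ∧ Alt L ∧ x = altProd L) := by
  obtain ⟨h, L, g, hL, rfl⟩ := exists_alternating w
  induction hn : L.length using Nat.strong_induction_on generalizing h L g with
  | _ n ih =>
    by_cases hg : g = 1 <;> by_cases hh : h = 1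
    · subst hg hh
      refine ⟨1, altProd L, by simp, Or.inr (Or.inr ⟨L, ?_, hL, rfl⟩)⟩
      rintro rfl
      simp [altProd] at hw
    · subst hg
      rcases List.eq_nil_or_concat' L with rfl | ⟨M, x, rfl⟩
      · exact ⟨1, inr h, by simp [altProd], Or.inr (Or.inl ⟨h, hh, rfl⟩)⟩
      · -- Conjugate by the last letter.
        have hx := hL x (by simp)
        have hM : Alt M := fun y hy => hL y (by simp [hy])
        have e : inr h * altProd (M ++ [x]) * inl (1 : G) =
            (inr x.2)⁻¹ * (inr (x.2 * h) * altProd M * inl x.1) * ((inr x.2)⁻¹)⁻¹ := by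
          rw [altProd_append, altProd_cons, map_mul, map_one]
          simp only [altProd, List.map_nil, List.prod_nil]
          group
        obtain ⟨c, y, hy, hy'⟩ := ih M.length (by rw [← hn]; simp) (x.2 * h) M x.1 hM (by
          intro h1
          apply hw
          rw [e, h1]
          group) rfl
        exact ⟨(inr x.2)⁻¹ * c, y, by rw [e, hy]; group, hy'⟩
    · subst hh
      cases L with
      | nil => exact ⟨1, inl g, by simp [altProd], Or.inl ⟨g, hg, rfl⟩⟩
      | cons x M =>
        have hM : Alt M := fun y hy => hL y (List.mem_cons_of_mem _ hy)
        have e : inr (1 : H) * altProd (x :: M) * inl g =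
            inl x.1 * (inr x.2 * altProd M * inl (g * x.1)) * (inl x.1)⁻¹ := by
          rw [altProd_cons, map_mul, map_one]
          group
        obtain ⟨c, y, hy, hy'⟩ := ih M.length (by rw [← hn]; simp) x.2 M (g * x.1) hM (by
          intro h1
          apply hw
          rw [e, h1]
          group) rfl
        exact ⟨inl x.1 * c, y, by rw [e, hy]; group, hy'⟩
    · refine ⟨(inl g)⁻¹, altProd ((g, h) :: L), ?_, Or.inr (Or.inr ⟨_, by simp, hL.cons ⟨hg, hh⟩,
        rfl⟩)⟩
      rw [altProd_cons]
      group

end FreeProduct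

/-- A finite cyclic group acts faithfully by the rotations by multiples of `1 / N`, if its order
divides `N`. -/
theorem exists_spin_hom (G : Type*) [Group G] [Finite G] [IsCyclic G] {N : ℕ} (hN : N ≠ 0)
    (h : Nat.card G ∣ N) : ∃ f : G →* HomeoPlus, ∀ g, ∃ i, f g = spin N i ∧
      (g ≠ 1 → ¬ (N : ℤ) ∣ i) := by
  obtain ⟨M, rfl⟩ := h
  obtain ⟨g₀, hg₀⟩ := IsCyclic.exists_generator (α := G)
  have ho : orderOf g₀ = Nat.card G := orderOf_eq_card_of_forall_mem_zpowers hg₀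
  have hM : M ≠ 0 := by rintro rfl; simp at hN
  have hdvd : orderOf (spin (Nat.card G * M) M) ∣ orderOf g₀ := by
    rw [ho]
    apply orderOf_dvd_of_pow_eq_one
    rw [spin_pow hN]
    apply spin_eq_one hN
    push_cast
    exact dvd_rfl
  refine ⟨monoidHomOfForallMemZpowers hg₀ hdvd, fun g => ?_⟩
  obtain ⟨k, rfl⟩ := Subgroup.mem_zpowers_iff.1 (hg₀ g)
  refine ⟨k * M, ?_, fun hk hd => hk ?_⟩
  · rw [map_zpow, monoidHomOfForallMemZpowers_apply_gen, spin_zpow hN]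
  · rw [← orderOf_dvd_iff_zpow_eq_one, ho]
    push_cast at hd
    exact Int.dvd_of_mul_dvd_mul_right (by exact_mod_cast hM) hd

/-! ### The polygons -/

theorem Edge.image {V : Finset S1} [DecidableEq S1] (g : HomeoPlus) {x y : S1} (h : Edge V x y) :
    Edge (V.image g.1) (g.1 x) (g.1 y) := by
  refine ⟨Finset.mem_image_of_mem _ h.1, Finset.mem_image_of_mem _ h.2.1,
    fun e => h.2.2.1 (g.1.injective e), fun t ht => ?_⟩
  obtain ⟨t, ht', rfl⟩ := Finset.mem_image.1 ht
  rw [g.2]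
  exact h.2.2.2 t ht'

theorem exists_of_edge_image {V : Finset S1} [DecidableEq S1] (g : HomeoPlus) {x y : S1}
    (h : Edge (V.image g.1) x y) : ∃ a b, Edge V a b ∧ x = g.1 a ∧ y = g.1 b := by
  obtain ⟨h1, h2, h3, h4⟩ := h
  obtain ⟨a, ha, rfl⟩ := Finset.mem_image.1 h1
  obtain ⟨b, hb, rfl⟩ := Finset.mem_image.1 h2
  refine ⟨a, b, ⟨ha, hb, fun e => h3 (by rw [e]), fun t ht => ?_⟩, rfl, rfl⟩
  have := h4 _ (Finset.mem_image_of_mem _ ht)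
  rwa [g.2] at this

theorem Pairs.map_val {l : Pairs} {x y : S1} (h : l.1 = s(x, y)) (g : S1 ≃ₜ S1) :
    (l.map g).1 = s(g x, g y) := by
  simp [Pairs.map, h]

theorem exists_eq_mk (l : Pairs) : ∃ x y, x ≠ y ∧ l.1 = s(x, y) := by
  obtain ⟨l, hl⟩ := l
  induction l using Sym2.ind with
  | _ x y => exact ⟨x, y, fun e => hl (Sym2.mk_isDiag_iff.2 e), rfl⟩

theorem Pairs.map_mul (g h : HomeoPlus) (l : Pairs) :
    l.map (g * h).1 = (l.map h.1).map g.1 := by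
  obtain ⟨x, y, -, e⟩ := exists_eq_mk l
  apply Subtype.ext
  rw [Pairs.map_val e, Pairs.map_val (Pairs.map_val e _), mul_apply, mul_apply]

theorem Pairs.map_one (l : Pairs) : l.map (1 : HomeoPlus).1 = l := by
  obtain ⟨x, y, -, e⟩ := exists_eq_mk l
  apply Subtype.ext
  rw [Pairs.map_val e, e, one_apply, one_apply]

theorem Lamination.IsPolygon.image {L : Lamination} {V : Finset S1} [DecidableEq S1]
    (hV : L.IsPolygon V) (g : HomeoPlus) (hg : ∀ l, l.map g.1 ∈ L.leaves ↔ l ∈ L.leaves) :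
    L.IsPolygon (V.image g.1) where
  card := by
    rw [Finset.card_image_of_injective _ g.1.injective]
    exact hV.card
  edge x y h := by
    obtain ⟨a, b, hE, rfl, rfl⟩ := exists_of_edge_image g h
    obtain ⟨l, hl, e⟩ := hV.edge a b hE
    exact ⟨l.map g.1, (hg l).2 hl, Pairs.map_val e g.1⟩
  side l hl := by
    have hl' : (l.map (g⁻¹).1) ∈ L.leaves := by
      rw [← hg]
      convert hl using 1
      rw [← Pairs.map_mul, mul_inv_cancel, Pairs.map_one]
    obtain ⟨x, y, hE, h⟩ := hV.side _ hl'
    refine ⟨g.1 x, g.1 y, hE.image g, fun t ht hs => ?_⟩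
    apply h ((g⁻¹).1 t) (Sym2.mem_map.2 ⟨t, ht, rfl⟩)
    rw [← g.2]
    have : g.1 ((g⁻¹).1 t) = t := g.1.apply_symm_apply t
    rwa [this]

open Classical in
/-- The vertex set of an ideal quadrilateral with given real coordinates of the vertices. -/
def quad (e₀ e₁ e₂ e₃ : ℝ) : Finset S1 := {(e₀ : S1), (e₁ : S1), (e₂ : S1), (e₃ : S1)}

theorem mem_quad {e₀ e₁ e₂ e₃ : ℝ} {t : S1} :
    t ∈ quad e₀ e₁ e₂ e₃ ↔ t = e₀ ∨ t = e₁ ∨ t = e₂ ∨ t = e₃ := by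
  simp [quad]

theorem quad_rotate (e₀ e₁ e₂ e₃ : ℝ) : quad e₁ e₂ e₃ (e₀ + 1) = quad e₀ e₁ e₂ e₃ := by
  ext t
  rw [mem_quad, mem_quad, coe_add_one]
  tauto

section Quad

variable {e₀ e₁ e₂ e₃ : ℝ}

theorem edge_quad (h01 : e₀ < e₁) (h12 : e₁ < e₂) (h23 : e₂ < e₃) (h30 : e₃ < e₀ + 1) :
    Edge (quad e₀ e₁ e₂ e₃) e₀ e₁ := by
  refine ⟨mem_quad.2 (Or.inl rfl), mem_quad.2 (Or.inr (Or.inl rfl)), coe_ne_coe h01 (by linarith),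
    fun t ht hs => ?_⟩
  rcases mem_quad.1 ht with rfl | rfl | rfl | rfl
  all_goals
    rw [sbtw_coe_iff (by linarith) (by linarith) (by linarith) (by linarith)] at hs
    linarith [hs.1, hs.2]

theorem eq_of_edge_quad (h01 : e₀ < e₁) (h12 : e₁ < e₂) (h23 : e₂ < e₃) (h30 : e₃ < e₀ + 1) {y : S1}
    (h : Edge (quad e₀ e₁ e₂ e₃) e₀ y) : y = e₁ := by
  have h1 := h.2.2.2 e₁ (mem_quad.2 (Or.inr (Or.inl rfl)))
  rcases mem_quad.1 h.2.1 with rfl | rfl | rfl | rfl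
  · exact absurd rfl h.2.2.1
  · rfl
  all_goals
    rw [sbtw_coe_iff (by linarith) (by linarith) (by linarith) (by linarith)] at h1
    exact absurd ⟨by linarith, by linarith⟩ h1

theorem edge_quad_iff (h01 : e₀ < e₁) (h12 : e₁ < e₂) (h23 : e₂ < e₃) (h30 : e₃ < e₀ + 1)
    {x y : S1} : Edge (quad e₀ e₁ e₂ e₃) x y ↔ (x = e₀ ∧ y = e₁) ∨ (x = e₁ ∧ y = e₂) ∨
      (x = e₂ ∧ y = e₃) ∨ (x = e₃ ∧ y = e₀) := by
  have r1 := quad_rotate e₀ e₁ e₂ e₃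
  have r2 := quad_rotate e₁ e₂ e₃ (e₀ + 1)
  have r3 := quad_rotate e₂ e₃ (e₀ + 1) (e₁ + 1)
  constructor
  · intro h
    rcases mem_quad.1 h.1 with rfl | rfl | rfl | rfl
    · exact Or.inl ⟨rfl, eq_of_edge_quad h01 h12 h23 h30 h⟩
    · rw [← r1] at h
      exact Or.inr (Or.inl ⟨rfl, eq_of_edge_quad h12 h23 h30 (by linarith) h⟩)
    · rw [← r1, ← r2] at h
      exact Or.inr (Or.inr (Or.inl ⟨rfl, eq_of_edge_quad h23 h30 (by linarith) (by linarith) h⟩))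
    · rw [← r1, ← r2, ← r3] at h
      have := eq_of_edge_quad h30 (by linarith) (by linarith) (by linarith) h
      rw [coe_add_one] at this
      exact Or.inr (Or.inr (Or.inr ⟨rfl, this⟩))
  · rintro (⟨rfl, rfl⟩ | ⟨rfl, rfl⟩ | ⟨rfl, rfl⟩ | ⟨rfl, rfl⟩)
    · exact edge_quad h01 h12 h23 h30
    · rw [← r1]
      exact edge_quad h12 h23 h30 (by linarith)
    · rw [← r1, ← r2]
      exact edge_quad h23 h30 (by linarith) (by linarith)
    · rw [← r1, ← r2, ← r3]
      have := edge_quad h30 (show e₀ + 1 < e₁ + 1 by linarith) (show e₁ + 1 < e₂ + 1 by linarith)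
        (by linarith)
      rwa [coe_add_one e₀] at this

theorem card_quad (h01 : e₀ < e₁) (h12 : e₁ < e₂) (h23 : e₂ < e₃) (h30 : e₃ < e₀ + 1) :
    3 ≤ (quad e₀ e₁ e₂ e₃).card := by
  classical
  have hsub : ({(e₀ : S1), (e₁ : S1), (e₂ : S1)} : Finset S1) ⊆ quad e₀ e₁ e₂ e₃ := by
    intro t ht
    simp only [Finset.mem_insert, Finset.mem_singleton] at ht
    rw [mem_quad]
    tauto
  refine le_trans (le_of_eq ?_) (Finset.card_le_card hsub)
  rw [Finset.card_eq_three.2 ⟨_, _, _, coe_ne_coe h01 (by linarith),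
    coe_ne_coe (by linarith) (by linarith), coe_ne_coe h12 (by linarith), rfl⟩]

end Quad

open Classical in
/-- The vertex set of the regular ideal `N`-gon with the vertex `x`. -/
def regular (N : ℕ) (x : ℝ) : Finset S1 :=
  (Finset.range N).image fun i : ℕ => (spin N i).1 (x : S1)

theorem mem_regular {N : ℕ} (hN : N ≠ 0) {x : ℝ} {t : S1} :
    t ∈ regular N x ↔ ∃ i : ℤ, t = (spin N i).1 (x : S1) := by
  simp only [regular, Finset.mem_image, Finset.mem_range]
  constructor
  · rintro ⟨i, -, rfl⟩
    exact ⟨i, rfl⟩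
  · rintro ⟨i, rfl⟩
    have h0 : 0 ≤ i % N := Int.emod_nonneg _ (by exact_mod_cast hN)
    have h1 : i % N < N := Int.emod_lt_of_pos _ (by omega)
    refine ⟨(i % N).toNat, by omega, ?_⟩
    rw [Int.toNat_of_nonneg h0, spin_emod hN]

theorem card_regular {N : ℕ} (hN : N ≠ 0) (x : ℝ) : (regular N x).card = N := by
  classical
  rw [regular, Finset.card_image_of_injOn, Finset.card_range]
  intro i hi j hj h
  have hN' : (0 : ℝ) < N := by exact_mod_cast Nat.pos_of_ne_zero hN
  have key : ∀ i ∈ Finset.range N, 0 ≤ (i : ℝ) / N ∧ (i : ℝ) / N < 1 := by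
    intro i hi
    refine ⟨by positivity, (div_lt_one hN').2 ?_⟩
    exact_mod_cast Finset.mem_range.1 hi
  have h1 := key i hi
  have h2 := key j hj
  simp only [spin_coe] at h
  push_cast at h
  rw [coe_eq_coe_iff_of_window (w := x) (by linarith) (by linarith) (by linarith)
    (by linarith)] at h
  have h3 : (i : ℝ) / N = j / N := by linarith
  rw [div_left_inj' hN'.ne'] at h3
  exact_mod_cast h3

theorem edge_regular_iff {N : ℕ} (hN : 3 ≤ N) {x : ℝ} {t u : S1} :
    Edge (regular N x) t u ↔
      ∃ i : ℤ, t = (spin N i).1 (x : S1) ∧ u = (spin N i).1 ((x + 1 / N : ℝ) : S1) := by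
  have hN0 : N ≠ 0 := by omega
  have hNpos : (0 : ℝ) < N := by exact_mod_cast (by omega : 0 < N)
  have hinv : (1 : ℝ) / N < 1 := by
    rw [div_lt_one hNpos]; exact_mod_cast (by omega : 1 < N)
  have hinv0 : (0 : ℝ) < 1 / N := by positivity
  have hnext : ∀ i : ℤ, (spin N i).1 ((x + 1 / N : ℝ) : S1) = (spin N (i + 1)).1 (x : S1) := by
    intro i
    rw [spin_coe, spin_coe]
    congr 1
    push_cast
    ring
  -- Coordinates of the vertices, relative to one of them.
  have hcoord : ∀ i k : ℤ, ∃ r : ℤ, 0 ≤ r ∧ r < N ∧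
      (spin N k).1 (x : S1) = ((x + i / N + r / N : ℝ) : S1) := by
    intro i k
    refine ⟨(k - i) % N, Int.emod_nonneg _ (by exact_mod_cast hN0),
      Int.emod_lt_of_pos _ (by omega), ?_⟩
    rw [← spin_coe, spin_emod hN0, ← spin_coe, ← mul_apply, ← spin_add, sub_add_cancel]
  have hr : ∀ r : ℤ, r < N → (r : ℝ) / N < 1 := by
    intro r hr
    rw [div_lt_one hNpos]
    exact_mod_cast hr
  constructor
  · rintro ⟨h1, h2, h3, h4⟩
    obtain ⟨i, rfl⟩ := (mem_regular hN0).1 h1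
    obtain ⟨k, rfl⟩ := (mem_regular hN0).1 h2
    refine ⟨i, rfl, ?_⟩
    have h5 := h4 _ ((mem_regular hN0).2 ⟨i + 1, rfl⟩)
    rw [← hnext] at h5
    obtain ⟨r, r0, r1, hk⟩ := hcoord i k
    rw [hk] at h3 h5 ⊢
    rw [spin_coe, spin_coe] at h5
    rw [spin_coe] at h3 ⊢
    have hr0 : r ≠ 0 := by
      rintro rfl
      simp at h3
    by_cases hr1 : r = 1
    · subst hr1
      congr 1
      push_cast
      ring
    · exfalso
      apply h5
      have h6 : (2 : ℝ) ≤ r := by exact_mod_cast (by omega : 2 ≤ r)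
      have h7 : (2 : ℝ) / N ≤ r / N := by gcongr
      have h8 : (2 : ℝ) / N = 1 / N + 1 / N := by ring
      have h9 := hr r r1
      rw [sbtw_coe_iff (by linarith) (by linarith) (by linarith) (by linarith)]
      constructor <;> linarith
  · rintro ⟨i, rfl, rfl⟩
    rw [hnext]
    refine ⟨(mem_regular hN0).2 ⟨i, rfl⟩, (mem_regular hN0).2 ⟨i + 1, rfl⟩, ?_, ?_⟩
    · rw [← hnext, spin_coe, spin_coe]
      exact coe_ne_coe (by linarith) (by linarith)
    · intro t ht hs
      obtain ⟨k, rfl⟩ := (mem_regular hN0).1 ht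
      obtain ⟨r, r0, r1, hk⟩ := hcoord i k
      have h9 := hr r r1
      have h10 : (0 : ℝ) ≤ r / N := div_nonneg (by exact_mod_cast r0) hNpos.le
      rw [← hnext, hk, spin_coe, spin_coe, sbtw_coe_iff (by linarith) (by linarith) (by linarith)
        (by linarith)] at hs
      have h11 : (0 : ℝ) / N < r / N := by rw [zero_div]; linarith [hs.1]
      have h12 : (r : ℝ) / N < 1 / N := by linarith [hs.2]
      rw [div_lt_div_iff_of_pos_right hNpos] at h11 h12
      have h13 : 0 < r := by exact_mod_cast h11
      have h14 : r < 1 := by exact_mod_cast h12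
      omega

/-! ### The translates of the base rectangle -/

section Translates

variable {N : ℕ} (hN : 3 ≤ N) {α : ℝ}

theorem dist_coe_le (x y : ℝ) : dist (x : S1) (y : S1) ≤ |x - y| := by
  rw [dist_eq_norm, ← AddCircle.coe_sub, AddCircle.norm_eq, inv_one, one_mul, mul_one]
  exact (round_le (x - y) 0).trans (by simp)

theorem dist_spin (i : ℤ) (x y : S1) : dist ((spin N i).1 x) ((spin N i).1 y) = dist x y := by
  induction x using QuotientAddGroup.induction_on with
  | H x =>
  induction y using QuotientAddGroup.induction_on with
  | H y =>
  change dist ((spin N i).1 (x : S1)) ((spin N i).1 (y : S1)) = dist (x : S1) (y : S1)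
  rw [spin_coe, spin_coe, AddCircle.coe_add, AddCircle.coe_add, dist_add_right]

theorem steps_emod (u : List ℤ) : steps hN (u.map (· % (N : ℤ))) = steps hN u := by
  have hN0 : N ≠ 0 := by omega
  induction u with
  | nil => rfl
  | cons i u ih => rw [List.map_cons, steps_cons, steps_cons, ih, step, step, spin_emod hN0]

variable (h0 : 0 ≤ α) (h1 : α ≤ 1 / (8 * N))

include h0 h1

/-- Only finitely many translates of the base rectangle are large, since the normal form of a large
translate contains a short word in the contractions. -/
theorem finite_large {δ : ℝ} (hδ : 0 < δ) : {γ : spinFlip hN | ∃ x ∈ (base N α).supp,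
    ∃ y ∈ (base N α).supp, δ ≤ dist (γ.1.1 (x : S1)) (γ.1.1 (y : S1))}.Finite := by
  have hN0 : N ≠ 0 := by omega
  have h5 := slope_ge hN
  have hlen := base_length hN (α := α)
  have hok := base_ok hN h0 h1
  obtain ⟨n, hn⟩ := exists_pow_lt_of_lt_one hδ (show (1 / 5 : ℝ) < 1 by norm_num)
  have hfin : ((fun p : Fin N × List (Fin N) × Bool =>
      spin N (p.1.1 : ℤ) * steps hN (p.2.1.map fun i => (i.1 : ℤ)) *
        flip hN ^ (if p.2.2 then 1 else 0)) ''
      ((univ : Set (Fin N)) ×ˢ ({w : List (Fin N) | w.length < n} ×ˢ (univ : Set Bool)))).Finite :=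
    (finite_univ.prod ((List.finite_length_lt (Fin N) n).prod finite_univ)).image _
  refine (hfin.preimage Subtype.val_injective.injOn).subset ?_
  rintro ⟨γ, hγ⟩ ⟨x, hx, y, hy, hd⟩
  obtain ⟨j, u, e, hu, he, rfl⟩ := exists_normal_form hN hγ
  have hmod : ∀ i : ℤ, ∃ k : Fin N, (k.1 : ℤ) = i % N := by
    intro i
    have r0 : 0 ≤ i % N := Int.emod_nonneg _ (by exact_mod_cast hN0)
    have r1 : i % N < N := Int.emod_lt_of_pos _ (by omega)
    exact ⟨⟨(i % N).toNat, by omega⟩, by simp [Int.toNat_of_nonneg r0]⟩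
  choose f hf using hmod
  refine ⟨(f j, u.map f, decide (e = 1)), ⟨mem_univ _, ?_, mem_univ _⟩, ?_⟩
  · rw [mem_ofPred_eq, List.length_map]
    by_contra hlt
    push Not at hlt
    have hflip : ∀ x ∈ (base N α).supp, ∃ y ∈ Icc (base N α).a (base N α).d,
        (flip hN ^ e).1 (x : S1) = (y : S1) := by
      intro x hx
      rcases he with rfl | rfl
      · exact ⟨x, Rect.supp_subset hok hx, rfl⟩
      · obtain ⟨y, y1, y2, hy⟩ := flip_supp hN h0 h1 hx
        exact ⟨y, ⟨by linarith [hok.ab], by linarith [hok.cd]⟩, by rw [pow_one, hy]⟩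
    obtain ⟨x', hx', ex⟩ := hflip x hx
    obtain ⟨y', hy', ey⟩ := hflip y hy
    obtain ⟨c, hc⟩ := steps_coe hN h0 h1 hu
    simp only [mul_assoc] at hd
    rw [mul_apply, mul_apply, mul_apply, mul_apply, dist_spin, ex, ey, (hc _ hx').1,
      (hc _ hy').1] at hd
    have hd1 := hd.trans (dist_coe_le _ _)
    have e1 : c + x' / (2 * N - 1) ^ u.length - (c + y' / (2 * N - 1) ^ u.length) =
        (x' - y') / (2 * N - 1 : ℝ) ^ u.length := by ring
    have hp : (0 : ℝ) < (2 * N - 1) ^ u.length := pow_pos (by linarith) _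
    have hxy : |x' - y'| ≤ 1 := by
      rw [abs_le]
      constructor <;> linarith [hx'.1, hx'.2, hy'.1, hy'.2]
    have e2 : (1 / 5 : ℝ) ^ u.length ≤ (1 / 5) ^ n :=
      pow_le_pow_of_le_one (by norm_num) (by norm_num) hlt
    have e3 : |x' - y'| / (2 * N - 1 : ℝ) ^ u.length ≤ (1 / 5) ^ u.length := by
      rw [one_div_pow]
      exact div_le_div₀ zero_le_one hxy (by positivity) (pow_le_pow_left₀ (by norm_num) h5 _)
    rw [e1, abs_div, abs_of_pos hp] at hd1
    linarith
  · simp only [hf, List.map_map]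
    have e1 : ((fun i : Fin N => (i.1 : ℤ)) ∘ f) = (· % (N : ℤ)) := by
      ext i; exact hf i
    rw [e1, steps_emod, spin_emod hN0]
    rcases he with rfl | rfl <;> simp

/-- A nontrivial translate of the base rectangle is on the other side of the outer or of the inner
side of the base rectangle. -/
theorem sep_translate {γ : HomeoPlus} (hγ : γ ∈ spinFlip hN) :
    γ = 1 ∨ ∀ x ∈ (base N α).supp, ∀ x' ∈ (base N α).supp,
      ∃ y ∈ Icc (base N α).a ((base N α).a + 1), ∃ y' ∈ Icc (base N α).a ((base N α).a + 1),
        (base N α).Sep y y' ∧ γ.1 (x : S1) = (y : S1) ∧ γ.1 (x' : S1) = (y' : S1) := by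
  have hlen := base_length hN (α := α)
  have hok := base_ok hN h0 h1
  have hin : (∀ x ∈ (base N α).supp, ∃ y, (base N α).b ≤ y ∧ y ≤ (base N α).c ∧
      γ.1 (x : S1) = (y : S1)) → ∀ x ∈ (base N α).supp, ∀ x' ∈ (base N α).supp,
      ∃ y ∈ Icc (base N α).a ((base N α).a + 1), ∃ y' ∈ Icc (base N α).a ((base N α).a + 1),
        (base N α).Sep y y' ∧ γ.1 (x : S1) = (y : S1) ∧ γ.1 (x' : S1) = (y' : S1) := by
    intro h x hx x' hx'
    obtain ⟨y, y1, y2, hy⟩ := h x hx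
    obtain ⟨y', y1', y2', hy'⟩ := h x' hx'
    obtain ⟨o1, o2, o3⟩ := hok
    exact ⟨y, ⟨by linarith, by linarith⟩, y', ⟨by linarith, by linarith⟩,
      Or.inl ⟨⟨y1, y2⟩, y1', y2'⟩, hy, hy'⟩
  have hout : (∀ x ∈ (base N α).supp, ∃ y, (base N α).d ≤ y ∧ y ≤ (base N α).a + 1 ∧
      γ.1 (x : S1) = (y : S1)) → ∀ x ∈ (base N α).supp, ∀ x' ∈ (base N α).supp,
      ∃ y ∈ Icc (base N α).a ((base N α).a + 1), ∃ y' ∈ Icc (base N α).a ((base N α).a + 1),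
        (base N α).Sep y y' ∧ γ.1 (x : S1) = (y : S1) ∧ γ.1 (x' : S1) = (y' : S1) := by
    intro h x hx x' hx'
    obtain ⟨y, y1, y2, hy⟩ := h x hx
    obtain ⟨y', y1', y2', hy'⟩ := h x' hx'
    obtain ⟨o1, o2, o3⟩ := hok
    exact ⟨y, ⟨by linarith, by linarith⟩, y', ⟨by linarith, by linarith⟩,
      Or.inr ⟨Or.inr y1, Or.inr y1'⟩, hy, hy'⟩
  rcases classify hN h0 h1 hγ with rfl | rfl | ⟨j, hj, rfl⟩ | h | ⟨j, hj, h⟩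
  · exact Or.inl rfl
  · exact Or.inr (hin fun x hx => flip_supp hN h0 h1 hx)
  · refine Or.inr (hout fun x hx => ?_)
    obtain ⟨y, y1, y2, hy, -⟩ := spin_edge hN hj (Rect.supp_subset hok hx)
    exact ⟨y, y1, y2, hy⟩
  · refine Or.inr (hin fun x hx => ?_)
    obtain ⟨y, y1, y2, hy⟩ := h x hx
    exact ⟨y, y1.le, y2.le, hy⟩
  · refine Or.inr (hout fun x hx => ?_)
    obtain ⟨y, y1, y2, hy⟩ := h x hx
    obtain ⟨z, z1, z2, hz, -⟩ := spin_edge hN hj ⟨y1.le, y2.le⟩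
    exact ⟨z, z1, z2, by rw [hy, hz]⟩

omit h0 h1 in
/-- A pair separated from a rectangle is unlinked with the pairs on its boundary. The coordinates of
the separated pair are taken in an interval of length `1`, as `Sep` depends on their choice. -/
theorem not_linked_of_sep {σ : Rect} (hσ : σ.Ok) {w x y u v : ℝ} (hw : w ≤ σ.a)
    (hw' : σ.d ≤ w + 1) (hx : x ∈ Icc w (w + 1)) (hy : y ∈ Icc w (w + 1)) (hs : σ.Sep x y)
    (hu : u ∈ σ.supp) (hv : v ∈ σ.supp) {l m : Pairs} (hl : l.1 = s((x : S1), (y : S1)))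
    (hm : m.1 = s((u : S1), (v : S1))) : ¬ Linked l m := by
  obtain ⟨o1, o2, o3⟩ := hσ
  have hsub := Rect.supp_subset ⟨o1, o2, o3⟩
  rcases hs with ⟨⟨x1, x2⟩, y1, y2⟩ | ⟨sx, sy⟩
  · have key : ∀ u ∈ σ.supp, (u : S1) ∈ arc σ.c (σ.b + 1) := by
      rintro u (⟨u1, u2⟩ | ⟨u1, u2⟩)
      · exact ⟨u + 1, ⟨by linarith, by linarith⟩, coe_add_one u⟩
      · exact ⟨u, ⟨by linarith, by linarith⟩, rfl⟩
    exact not_linked_of_arc (x := σ.b) (y := σ.c) (by linarith) ⟨x, ⟨x1, x2⟩, rfl⟩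
      ⟨y, ⟨y1, y2⟩, rfl⟩ (key u hu) (key v hv) hl hm
  · have key : ∀ x ∈ Icc w (w + 1), x ≤ σ.a ∨ σ.d ≤ x → (x : S1) ∈ arc σ.d (σ.a + 1) := by
      rintro x ⟨w1, w2⟩ (h | h)
      · exact ⟨x + 1, ⟨by linarith, by linarith⟩, coe_add_one x⟩
      · exact ⟨x, ⟨by linarith, by linarith⟩, rfl⟩
    intro hlm
    exact not_linked_of_arc (x := σ.a) (y := σ.d) (by linarith) ⟨u, hsub hu, rfl⟩
      ⟨v, hsub hv, rfl⟩ (key x hx sx) (key y hy sy) hm hl hlm.symm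

theorem not_linked_translate {γ : HomeoPlus} (hγ : γ ∈ spinFlip hN) {q r : ℝ × ℝ}
    (hq : q ∈ (base N α).leaves) (hr : r ∈ (base N α).leaves) {l m : Pairs}
    (hl : l.1 = s((q.1 : S1), (q.2 : S1))) (hm : m.1 = s(γ.1 (r.1 : S1), γ.1 (r.2 : S1))) :
    ¬ Linked l m := by
  have hlen := base_length hN (α := α)
  have hok := base_ok hN h0 h1
  have q' := Rect.mem_supp_of_mem_leaves hok hq
  have r' := Rect.mem_supp_of_mem_leaves hok hr
  have hin : ∀ x ∈ (base N α).supp, x ∈ Icc (base N α).a ((base N α).a + 1) := by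
    intro x hx
    have := Rect.supp_subset hok hx
    exact ⟨this.1, by linarith [this.2]⟩
  rcases sep_translate hN h0 h1 hγ with rfl | h
  · simp only [one_apply] at hm
    rcases Rect.compare_leaves hok hq hr with rfl | ⟨⟨σ, hσ, s1, s2, h⟩, -⟩
    · have q1 := Rect.supp_subset hok q'.1
      have q2 := Rect.supp_subset hok q'.2
      have q3 := Rect.le_of_mem_leaves hok hq
      exact not_linked_of_arc (x := q.1) (y := q.2) (by linarith [q1.1, q2.2])
        ⟨q.1, ⟨le_rfl, q3⟩, rfl⟩ ⟨q.2, ⟨q3, le_rfl⟩, rfl⟩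
        ⟨q.1 + 1, ⟨by linarith [q1.1, q2.2], le_rfl⟩, coe_add_one _⟩
        ⟨q.2, ⟨le_rfl, by linarith [q1.1, q2.2]⟩, rfl⟩ hl hm
    · rcases h with ⟨hs, hr1, hr2⟩ | ⟨hs, hr1, hr2⟩
      · exact not_linked_of_sep hσ s1 (by linarith) (hin _ q'.1) (hin _ q'.2) hs hr1 hr2 hl hm
      · exact fun h => not_linked_of_sep hσ s1 (by linarith) (hin _ r'.1) (hin _ r'.2) hs hr1 hr2
          hm hl h.symm
  · obtain ⟨y, hy, y', hy', hs, e, e'⟩ := h _ r'.1 _ r'.2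
    rw [e, e'] at hm
    exact fun h => not_linked_of_sep hok le_rfl (by linarith) hy hy' hs q'.1 q'.2 hm hl h.symm

end Translates

/-! ### The lamination -/

section Lam

variable {N : ℕ} (hN : 3 ≤ N) {α : ℝ} (h0 : 0 ≤ α) (h1 : α ≤ 1 / (8 * N))

/-- The lamination of all translates of the leaves of the base rectangle. -/
def lam : Lamination where
  leaves := {l | ∃ γ ∈ spinFlip hN, ∃ q ∈ (base N α).leaves,
    l.1 = s(γ.1 (q.1 : S1), γ.1 (q.2 : S1))}
  isClosed_leaves := by
    have hok := base_ok hN h0 h1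
    let K : Set (ℝ × ℝ) := ((base N α).leaves ∪ {q | q.1 = q.2}) ∩
      (Icc (base N α).a (base N α).d ×ˢ Icc (base N α).a (base N α).d)
    have hK : IsCompact K :=
      (isCompact_Icc.prod isCompact_Icc).inter_left (Rect.isClosed_leaves hok)
    let f : spinFlip hN × Bool → ℝ × ℝ → S1 × S1 := fun i q =>
      if i.2 then (i.1.1.1 (q.1 : S1), i.1.1.1 (q.2 : S1))
      else (i.1.1.1 (q.2 : S1), i.1.1.1 (q.1 : S1))
    have hf : ∀ i, Continuous (f i) := by
      rintro ⟨γ, b⟩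
      have c1 : Continuous fun q : ℝ × ℝ => γ.1.1 (q.1 : S1) :=
        γ.1.1.continuous.comp ((AddCircle.continuous_mk' 1).comp continuous_fst)
      have c2 : Continuous fun q : ℝ × ℝ => γ.1.1 (q.2 : S1) :=
        γ.1.1.continuous.comp ((AddCircle.continuous_mk' 1).comp continuous_snd)
      cases b
      · exact c2.prodMk c1
      · exact c1.prodMk c2
    have hclosed := isClosed_iUnion_union_diagonal (fun i => f i '' K)
      (fun i => (hK.image (hf i)).isClosed) (fun δ hδ => by
        refine ((finite_large hN h0 h1 hδ).prod (finite_univ (α := Bool))).subset ?_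
        rintro ⟨γ, b⟩ ⟨_, ⟨q, ⟨hq | hq, -⟩, rfl⟩, hd⟩
        · obtain ⟨q1, q2⟩ := Rect.mem_supp_of_mem_leaves hok hq
          refine ⟨⟨q.1, q1, q.2, q2, ?_⟩, mem_univ _⟩
          cases b
          · rw [dist_comm]; exact hd
          · exact hd
        · rw [mem_ofPred_eq] at hq
          exfalso
          cases b <;> simp [f, hq] at hd <;> linarith)
    convert isClosed_pairs (R := ⋃ i, f i '' K) ?_ hclosed using 1
    · ext l
      constructor
      · rintro ⟨γ, hγ, q, hq, e⟩
        obtain ⟨q1, q2⟩ := Rect.mem_supp_of_mem_leaves hok hq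
        exact ⟨_, _, e, mem_iUnion.2 ⟨(⟨γ, hγ⟩, true), q,
          ⟨Or.inl hq, Rect.supp_subset hok q1, Rect.supp_subset hok q2⟩, rfl⟩⟩
      · rintro ⟨x, y, e, h⟩
        obtain ⟨⟨γ, b⟩, q, ⟨hq | hq, -⟩, hxy⟩ := mem_iUnion.1 h
        · refine ⟨γ.1, γ.2, q, hq, ?_⟩
          rw [e]
          cases b
          · simp only [f, Prod.mk.injEq, Bool.false_eq_true, if_false] at hxy
            rw [← hxy.1, ← hxy.2, Sym2.eq_swap]
          · simp only [f, Prod.mk.injEq, if_true] at hxy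
            rw [← hxy.1, ← hxy.2]
        · rw [mem_ofPred_eq] at hq
          exfalso
          apply Pairs.ne e
          cases b <;> simp [f, hq] at hxy <;> rw [← hxy.1, ← hxy.2]
    · intro x y h
      obtain ⟨⟨γ, b⟩, q, hq, hxy⟩ := mem_iUnion.1 h
      refine mem_iUnion.2 ⟨(γ, !b), q, hq, ?_⟩
      cases b <;> simp [f] at hxy ⊢ <;> exact ⟨hxy.2, hxy.1⟩
  unlinked := by
    rintro l ⟨γ, hγ, q, hq, hl⟩ m ⟨γ', hγ', r, hr, hm⟩ h
    rw [← linked_map γ⁻¹] at h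
    refine not_linked_translate hN h0 h1 (mul_mem (inv_mem hγ) hγ') hq hr ?_ ?_ h
    · rw [Pairs.map_val hl, ← mul_apply, ← mul_apply, inv_mul_cancel, one_apply, one_apply]
    · rw [Pairs.map_val hm, ← mul_apply, ← mul_apply]

theorem map_mem_lam {g : HomeoPlus} (hg : g ∈ spinFlip hN) {l : Pairs} :
    l.map g.1 ∈ (lam hN h0 h1).leaves ↔ l ∈ (lam hN h0 h1).leaves := by
  have key : ∀ g ∈ spinFlip hN, ∀ l ∈ (lam hN h0 h1).leaves,
      Pairs.map g.1 l ∈ (lam hN h0 h1).leaves := by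
    rintro g hg l ⟨γ, hγ, q, hq, hl⟩
    exact ⟨g * γ, mul_mem hg hγ, q, hq, by rw [Pairs.map_val hl, mul_apply, mul_apply]⟩
  refine ⟨fun h => ?_, key g hg l⟩
  have := key g⁻¹ (inv_mem hg) _ h
  rwa [← Pairs.map_mul, inv_mul_cancel, Pairs.map_one] at this

theorem isInvariant_lam {Γ : Subgroup HomeoPlus} (hΓ : Γ ≤ spinFlip hN) :
    (lam hN h0 h1).IsInvariant Γ := by
  intro g hg
  apply Subset.antisymm
  · rintro _ ⟨l, hl, rfl⟩
    exact (map_mem_lam hN h0 h1 (hΓ hg)).2 hl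
  · intro l hl
    refine ⟨l.map g⁻¹.1, (map_mem_lam hN h0 h1 (inv_mem (hΓ hg))).2 hl, ?_⟩
    rw [← Pairs.map_mul, mul_inv_cancel, Pairs.map_one]

theorem exists_leaf {q : ℝ × ℝ} (hq : q ∈ (base N α).leaves) (hlt : q.1 < q.2) :
    ∃ l ∈ (lam hN h0 h1).leaves, l.1 = s((q.1 : S1), (q.2 : S1)) := by
  have hlen := base_length hN (α := α)
  have hok := base_ok hN h0 h1
  obtain ⟨q1, q2⟩ := Rect.mem_supp_of_mem_leaves hok hq
  have q3 := Rect.supp_subset hok q1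
  have q4 := Rect.supp_subset hok q2
  have hne : (q.1 : S1) ≠ (q.2 : S1) := coe_ne_coe hlt (by linarith [q3.1, q4.2])
  exact ⟨⟨s((q.1 : S1), (q.2 : S1)), fun h => hne (Sym2.mk_isDiag_iff.1 h)⟩,
    ⟨1, one_mem _, q, hq, rfl⟩, rfl⟩

theorem isPolygon_quad (w : List (Fin 4)) : (lam hN h0 h1).IsPolygon
    (quad ((base N α).sub w).s ((base N α).sub w).t ((base N α).sub w).t'
      ((base N α).sub w).s') := by
  have hlen := base_length hN (α := α)
  have hok := base_ok hN h0 h1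
  have hσ := hok.sub w
  have hsup : ∀ x ∈ ((base N α).sub w).supp, x ∈ Icc (base N α).a (base N α).d :=
    fun x hx => Rect.supp_subset hok (Rect.supp_sub hok w hx)
  have hsub := Rect.leaves_sub (ρ := base N α) w
  have hbes := fun q (hq : q ∈ (base N α).leaves) => Rect.beside_of_mem_leaves hok w hq
  have hsep : ∀ x y, (base N α).Sep x y → ((base N α).sub w).Beside x y :=
    fun x y h => (h.sub hok w).beside hσ
  obtain ⟨o1, o2, o3⟩ := hσ
  have ha := (hsup _ (Or.inl ⟨le_rfl, o1.le⟩)).1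
  have hd := (hsup _ (Or.inr ⟨o3.le, le_rfl⟩)).2
  generalize (base N α).sub w = σ at *
  have e1 : σ.s < σ.t := by simp only [Rect.s, Rect.t]; linarith
  have e2 : σ.t < σ.t' := by simp only [Rect.t', Rect.t]; linarith
  have e3 : σ.t' < σ.s' := by simp only [Rect.t', Rect.s']; linarith
  have e4 : σ.s' < σ.s + 1 := by simp only [Rect.s, Rect.s']; linarith
  have hin := fun x y => edge_quad_iff e1 e2 e3 e4 (x := x) (y := y)
  refine ⟨card_quad e1 e2 e3 e4, fun x y h => ?_, fun l hl => ?_⟩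
  · rcases (hin _ _).1 h with ⟨rfl, rfl⟩ | ⟨rfl, rfl⟩ | ⟨rfl, rfl⟩ | ⟨rfl, rfl⟩
    · exact exists_leaf hN h0 h1 (hsub (Rect.leaves_child 2 Rect.outer_mem_leaves)) e1
    · exact exists_leaf hN h0 h1 (hsub (Rect.leaves_child 1 Rect.outer_mem_leaves)) e2
    · exact exists_leaf hN h0 h1 (hsub (Rect.leaves_child 3 Rect.outer_mem_leaves)) e3
    · rw [Sym2.eq_swap]
      exact exists_leaf hN h0 h1 (hsub (Rect.leaves_child 0 Rect.inner_mem_leaves))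
        (show σ.s < σ.s' by linarith)
  · obtain ⟨γ, hγ, q, hq, hl⟩ := hl
    obtain ⟨q1, q2⟩ := Rect.mem_supp_of_mem_leaves hok hq
    obtain ⟨y, hy, y', hy', hb, e⟩ : ∃ y ∈ Icc (base N α).a ((base N α).a + 1),
        ∃ y' ∈ Icc (base N α).a ((base N α).a + 1), σ.Beside y y' ∧
        l.1 = s((y : S1), (y' : S1)) := by
      rcases sep_translate hN h0 h1 hγ with rfl | h
      · have q3 := Rect.supp_subset hok q1
        have q4 := Rect.supp_subset hok q2
        exact ⟨q.1, ⟨q3.1, by linarith [q3.2]⟩, q.2, ⟨q4.1, by linarith [q4.2]⟩, hbes q hq, hl⟩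
      · obtain ⟨y, hy, y', hy', hs, e, e'⟩ := h _ q1 _ q2
        exact ⟨y, hy, y', hy', hsep _ _ hs, by rw [hl, e, e']⟩
    have fin : ∀ u v : ℝ, u ≤ v → v ≤ u + 1 → Edge (quad σ.s σ.t σ.t' σ.s') u v →
        (y : S1) ∈ arc u v → (y' : S1) ∈ arc u v → ∃ x z, Edge (quad σ.s σ.t σ.t' σ.s') x z ∧
          ∀ t ∈ l.1, ¬ sbtw z t x := by
      intro u v huv huv' hE m1 m2
      refine ⟨u, v, hE, fun t ht => ?_⟩
      rw [e, Sym2.mem_iff] at ht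
      rcases ht with rfl | rfl
      exacts [not_sbtw_of_mem_arc huv huv' m1, not_sbtw_of_mem_arc huv huv' m2]
    rcases hb with ⟨b1, b2⟩ | ⟨b1, b2⟩ | ⟨b1, b2⟩ | ⟨b1, b2⟩
    · exact fin _ _ e1.le (by linarith) ((hin _ _).2 (Or.inl ⟨rfl, rfl⟩)) ⟨y, b1, rfl⟩ ⟨y', b2, rfl⟩
    · exact fin _ _ e2.le (by linarith) ((hin _ _).2 (Or.inr (Or.inl ⟨rfl, rfl⟩))) ⟨y, b1, rfl⟩
        ⟨y', b2, rfl⟩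
    · exact fin _ _ e3.le (by linarith) ((hin _ _).2 (Or.inr (Or.inr (Or.inl ⟨rfl, rfl⟩))))
        ⟨y, b1, rfl⟩ ⟨y', b2, rfl⟩
    · have key : ∀ y ∈ Icc (base N α).a ((base N α).a + 1), y ≤ σ.s ∨ σ.s' ≤ y →
          (y : S1) ∈ arc σ.s' (σ.s + 1) := by
        have f1 : σ.a ≤ σ.s := by simp only [Rect.s]; linarith
        have f2 : σ.s' ≤ σ.d := by simp only [Rect.s']; linarith
        rintro y ⟨y1, y2⟩ (h | h)
        · exact ⟨y + 1, ⟨by linarith, by linarith⟩, coe_add_one y⟩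
        · exact ⟨y, ⟨h, by linarith⟩, rfl⟩
      refine fin _ (σ.s + 1) e4.le (by linarith) ?_ (key y hy b1) (key y' hy' b2)
      rw [coe_add_one]
      exact (hin _ _).2 (Or.inr (Or.inr (Or.inr ⟨rfl, rfl⟩)))

include h0 h1 in
/-- Every translate of the base rectangle is beyond some edge of the regular polygon. -/
theorem exists_spin_translate {γ : HomeoPlus} (hγ : γ ∈ spinFlip hN) :
    ∃ i, ∀ x ∈ (base N α).supp, ∃ y ∈ Icc (base N α).a (base N α).d,
      γ.1 (x : S1) = (spin N i).1 (y : S1) := by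
  have hN0 : N ≠ 0 := by omega
  have hok := base_ok hN h0 h1
  have hone : ∀ y : S1, (spin N 0).1 y = y := by
    intro y; rw [spin_eq_one hN0 (dvd_zero _), one_apply]
  have o := hok
  obtain ⟨o1, o2, o3⟩ := o
  rcases classify hN h0 h1 hγ with rfl | rfl | ⟨j, hj, rfl⟩ | h | ⟨j, hj, h⟩
  · exact ⟨0, fun x hx => ⟨x, Rect.supp_subset hok hx, by rw [hone, one_apply]⟩⟩
  · refine ⟨0, fun x hx => ?_⟩
    obtain ⟨y, y1, y2, hy⟩ := flip_supp hN h0 h1 hx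
    exact ⟨y, ⟨by linarith, by linarith⟩, by rw [hone, hy]⟩
  · exact ⟨j, fun x hx => ⟨x, Rect.supp_subset hok hx, rfl⟩⟩
  · refine ⟨0, fun x hx => ?_⟩
    obtain ⟨y, y1, y2, hy⟩ := h x hx
    exact ⟨y, ⟨by linarith, by linarith⟩, by rw [hone, hy]⟩
  · refine ⟨j, fun x hx => ?_⟩
    obtain ⟨y, y1, y2, hy⟩ := h x hx
    exact ⟨y, ⟨y1.le, y2.le⟩, hy⟩

include hN in
theorem edge_regular_base {x y : S1} : Edge (regular N (base N α).a) x y ↔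
    ∃ i, x = (spin N i).1 ((base N α).a : S1) ∧ y = (spin N i).1 ((base N α).d : S1) := by
  rw [edge_regular_iff hN, base_d hN]

theorem isPolygon_regular : (lam hN h0 h1).IsPolygon (regular N (base N α).a) := by
  have hlen := base_length hN (α := α)
  have hok := base_ok hN h0 h1
  have o := hok
  obtain ⟨o1, o2, o3⟩ := o
  refine ⟨by rw [card_regular (by omega)]; exact hN, fun x y h => ?_, fun l hl => ?_⟩
  · obtain ⟨i, rfl, rfl⟩ := (edge_regular_base hN).1 h
    obtain ⟨l, hl, e⟩ := exists_leaf hN h0 h1 Rect.outer_mem_leaves (by linarith)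
    exact ⟨l.map (spin N i).1, (map_mem_lam hN h0 h1 (spin_mem hN i)).2 hl, Pairs.map_val e _⟩
  · obtain ⟨γ, hγ, q, hq, hl⟩ := hl
    obtain ⟨q1, q2⟩ := Rect.mem_supp_of_mem_leaves hok hq
    obtain ⟨i, hi⟩ := exists_spin_translate hN h0 h1 hγ
    refine ⟨_, _, (edge_regular_base hN).2 ⟨i, rfl, rfl⟩, fun t ht => ?_⟩
    rw [hl, Sym2.mem_iff] at ht
    obtain ⟨y, hy, rfl⟩ : ∃ y ∈ Icc (base N α).a (base N α).d, t = (spin N i).1 (y : S1) := by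
      rcases ht with rfl | rfl
      exacts [hi _ q1, hi _ q2]
    rw [(spin N i).2]
    exact not_sbtw_of_mem_arc (by linarith) (by linarith) ⟨y, hy, rfl⟩

end Lam

/-! ### The gaps -/

section Gaps

/-- A point of the open disk is not beyond a sufficiently short chord. -/
theorem exists_le_of_orient_neg {z : ℂ} (hz : ‖z‖ < 1) (g : HomeoPlus) : ∃ δ > 0, ∀ x y : ℝ, x ≤ y →
    y < x + 1 → orient (g.1 (x : S1)) (g.1 (y : S1)) z < 0 → δ ≤ y - x := by
  have huc : UniformContinuous fun t : S1 => toPlane (g.1 t) :=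
    CompactSpace.uniformContinuous_of_continuous (continuous_toPlane.comp g.1.continuous)
  obtain ⟨δ, hδ, h⟩ := Metric.uniformContinuous_iff.1 huc (1 - ‖z‖) (by linarith)
  refine ⟨δ, hδ, fun x y hxy hy ho => ?_⟩
  by_contra hlt
  push Not at hlt
  obtain ⟨t, u, ht, hu, hzs⟩ := exists_sbtw_of_orient_neg hz.le ho
  have key : ∀ t, sbtw (g.1 (x : S1)) t (g.1 (y : S1)) → ∃ τ, x < τ ∧ τ < y ∧ t = g.1 (τ : S1) := by
    intro t ht
    obtain ⟨t, rfl⟩ := g.1.surjective t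
    rw [g.2] at ht
    obtain ⟨τ, t1, t2, rfl⟩ := exists_coe_Ico x t
    have := (sbtw_coe_iff t1 t2 hxy hy).1 ht
    exact ⟨τ, this.1, this.2, rfl⟩
  obtain ⟨τ, t1, t2, rfl⟩ := key t ht
  obtain ⟨υ, u1, u2, rfl⟩ := key u hu
  have hd : dist (toPlane (g.1 (τ : S1))) (toPlane (g.1 (υ : S1))) < 1 - ‖z‖ := by
    apply h
    refine (dist_coe_le _ _).trans_lt ?_
    rw [abs_lt]
    constructor <;> linarith
  have h1 : dist (toPlane (g.1 (τ : S1))) z ≤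
      dist (toPlane (g.1 (τ : S1))) (toPlane (g.1 (υ : S1))) := by
    rw [← dist_add_dist_of_mem_segment hzs]
    linarith [dist_nonneg (x := z) (y := toPlane (g.1 (υ : S1)))]
  have h2 : ‖toPlane (g.1 (τ : S1))‖ ≤ dist (toPlane (g.1 (τ : S1))) z + ‖z‖ := by
    rw [dist_eq_norm]
    exact norm_le_norm_sub_add _ _
  rw [norm_toPlane] at h2
  linarith

variable {N : ℕ} (hN : 3 ≤ N) {α : ℝ} (h0 : 0 ≤ α) (h1 : α ≤ 1 / (8 * N)) {z : ℂ}

theorem orient_ne_zero (hz : z ∈ (lam hN h0 h1).complementInDisk) {g : HomeoPlus}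
    (hg : g ∈ spinFlip hN) {q : ℝ × ℝ} (hq : q ∈ (base N α).leaves) (hlt : q.1 < q.2) :
    orient (g.1 (q.1 : S1)) (g.1 (q.2 : S1)) z ≠ 0 := by
  intro ho
  obtain ⟨l, hl, e⟩ := exists_leaf hN h0 h1 hq hlt
  have hl' := (map_mem_lam hN h0 h1 hg).2 hl
  have e' := Pairs.map_val e g.1
  apply hz.2
  refine mem_iUnion₂.2 ⟨_, hl', ?_⟩
  rw [chord_eq e']
  exact mem_segment_of_orient_eq_zero (Pairs.ne e') (mem_ball_zero_iff.1 hz.1).le ho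

theorem exists_edge_orient_neg {V : Finset S1} (hV : (lam hN h0 h1).IsPolygon V)
    (hz : z ∈ (lam hN h0 h1).complementInDisk)
    (hno : ¬ ∃ V, (lam hN h0 h1).IsPolygon V ∧ z ∈ polygonInterior V) :
    ∃ x y, Edge V x y ∧ orient x y z < 0 := by
  by_contra h
  push Not at h
  refine hno ⟨V, hV, mem_ball_zero_iff.1 hz.1, fun x y hE => ?_⟩
  refine (h x y hE).lt_of_ne fun ho => ?_
  obtain ⟨l, hl, e⟩ := hV.edge x y hE
  apply hz.2
  refine mem_iUnion₂.2 ⟨l, hl, ?_⟩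
  rw [chord_eq e]
  exact mem_segment_of_orient_eq_zero (Pairs.ne e) (mem_ball_zero_iff.1 hz.1).le ho.symm

/-- The rectangle with outer side `(a, d)` and inner side `(b, c)`, moved by `g`, contains `z`. -/
def InRect (σ : Rect) (g : HomeoPlus) (z : ℂ) : Prop :=
  orient (g.1 (σ.a : S1)) (g.1 (σ.d : S1)) z < 0 ∧ 0 ≤ orient (g.1 (σ.b : S1)) (g.1 (σ.c : S1)) z

theorem exists_inRect_child (hz : z ∈ (lam hN h0 h1).complementInDisk)
    (hno : ¬ ∃ V, (lam hN h0 h1).IsPolygon V ∧ z ∈ polygonInterior V) {g : HomeoPlus}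
    (hg : g ∈ spinFlip hN) (w : List (Fin 4)) (h : InRect ((base N α).sub w) g z) :
    ∃ i, InRect (((base N α).sub w).child i) g z := by
  classical
  have hlen := base_length hN (α := α)
  have hok := base_ok hN h0 h1
  obtain ⟨x, y, hE, ho⟩ := exists_edge_orient_neg hN h0 h1
    ((isPolygon_quad hN h0 h1 w).image g fun l => map_mem_lam hN h0 h1 hg) hz hno
  obtain ⟨x, y, hE', rfl, rfl⟩ := exists_of_edge_image g hE
  clear hE
  have hsub := Rect.supp_sub hok w
  obtain ⟨o1, o2, o3⟩ := hok.sub w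
  have ha := (Rect.supp_subset hok (hsub (Or.inl ⟨le_rfl, o1.le⟩))).1
  have hd := (Rect.supp_subset hok (hsub (Or.inr ⟨o3.le, le_rfl⟩))).2
  generalize (base N α).sub w = σ at *
  rw [edge_quad_iff (by simp only [Rect.s, Rect.t]; linarith)
    (by simp only [Rect.t', Rect.t]; linarith) (by simp only [Rect.t', Rect.s']; linarith)
    (by simp only [Rect.s, Rect.s']; linarith)] at hE'
  have hself : ∀ t : S1, (0 : ℝ) ≤ orient t t z := by
    intro t
    have := orient_swap t t z
    linarith
  rcases hE' with ⟨rfl, rfl⟩ | ⟨rfl, rfl⟩ | ⟨rfl, rfl⟩ | ⟨rfl, rfl⟩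
  · exact ⟨2, ho, hself _⟩
  · exact ⟨1, ho, h.2⟩
  · exact ⟨3, ho, hself _⟩
  · refine ⟨0, h.1, ?_⟩
    rw [orient_swap] at ho
    simp only [Rect.child]
    linarith

/-- The leaves and the polygons fill the translates of the base rectangle: a point off the polygons
would lie in a nested sequence of subrectangles, whose outer and inner sides have the same limit. -/
theorem not_inRect (hz : z ∈ (lam hN h0 h1).complementInDisk)
    (hno : ¬ ∃ V, (lam hN h0 h1).IsPolygon V ∧ z ∈ polygonInterior V) {g : HomeoPlus}
    (hg : g ∈ spinFlip hN) : ¬ InRect (base N α) g z := by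
  intro h
  have hlen := base_length hN (α := α)
  have hok := base_ok hN h0 h1
  have hz1 : ‖z‖ < 1 := mem_ball_zero_iff.1 hz.1
  have hseq : ∀ n : ℕ, ∃ w : List (Fin 4), w.length = n ∧ InRect ((base N α).sub w) g z := by
    intro n
    induction n with
    | zero => exact ⟨[], rfl, h⟩
    | succ n ih =>
      obtain ⟨w, hw, hr⟩ := ih
      obtain ⟨i, hi⟩ := exists_inRect_child hN h0 h1 hz hno hg w hr
      exact ⟨w ++ [i], by simp [hw], by rw [Rect.sub_append]; exact hi⟩
  choose w hw hr using hseq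
  -- The outer sides accumulate at a leaf or at a point of the circle.
  let p : ℕ → ℝ × ℝ := fun n => (((base N α).sub (w n)).a, ((base N α).sub (w n)).d)
  have hsupp : ∀ n, ∀ x ∈ ((base N α).sub (w n)).supp, x ∈ Icc (base N α).a (base N α).d :=
    fun n x hx => Rect.supp_subset hok (Rect.supp_sub hok _ hx)
  have hK : IsCompact (((base N α).leaves ∪ {q | q.1 = q.2}) ∩
      (Icc (base N α).a (base N α).d ×ˢ Icc (base N α).a (base N α).d)) :=
    (isCompact_Icc.prod isCompact_Icc).inter_left (Rect.isClosed_leaves hok)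
  obtain ⟨⟨x, y⟩, ⟨hxy, hx, hy⟩, φ, hφ, hlim⟩ := hK.tendsto_subseq (x := p) fun n =>
    ⟨Or.inl (Rect.leaves_sub (w n) Rect.outer_mem_leaves),
      hsupp n _ (Or.inl ⟨le_rfl, (hok.sub _).ab.le⟩),
      hsupp n _ (Or.inr ⟨(hok.sub _).cd.le, le_rfl⟩)⟩
  have la : Filter.Tendsto (fun n => ((base N α).sub (w (φ n))).a) Filter.atTop (𝓝 x) :=
    (continuous_fst.tendsto _).comp hlim
  have ld : Filter.Tendsto (fun n => ((base N α).sub (w (φ n))).d) Filter.atTop (𝓝 y) :=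
    (continuous_snd.tendsto _).comp hlim
  have hsize : Filter.Tendsto (fun n => (base N α).size * (1 / 2 : ℝ) ^ φ n) Filter.atTop
      (𝓝 0) := by
    simpa using ((tendsto_pow_atTop_nhds_zero_of_lt_one (r := (1 / 2 : ℝ)) (by norm_num)
      (by norm_num)).comp hφ.tendsto_atTop).const_mul (base N α).size
  have hsz : ∀ n, ((base N α).sub (w (φ n))).size ≤ (base N α).size * (1 / 2 : ℝ) ^ φ n := by
    intro n
    have := Rect.size_sub hok (w (φ n))
    rwa [hw] at this
  have lb : Filter.Tendsto (fun n => ((base N α).sub (w (φ n))).b) Filter.atTop (𝓝 x) := by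
    have h2 := la.add hsize
    rw [add_zero] at h2
    refine tendsto_of_tendsto_of_tendsto_of_le_of_le la h2 (fun n => (hok.sub _).ab.le) fun n => ?_
    have := (le_max_left _ _).trans (hsz n)
    simp only
    linarith
  have lc : Filter.Tendsto (fun n => ((base N α).sub (w (φ n))).c) Filter.atTop (𝓝 y) := by
    have h2 := ld.sub hsize
    rw [sub_zero] at h2
    refine tendsto_of_tendsto_of_tendsto_of_le_of_le h2 ld (fun n => ?_) fun n => (hok.sub _).cd.le
    have := (le_max_right _ _).trans (hsz n)
    simp only
    linarith
  have hcont : Continuous fun q : ℝ × ℝ => orient (g.1 (q.1 : S1)) (g.1 (q.2 : S1)) z := by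
    refine continuous_orient.comp (f := fun q : ℝ × ℝ =>
      ((g.1 (q.1 : S1), g.1 (q.2 : S1)), z)) ?_
    exact ((g.1.continuous.comp ((AddCircle.continuous_mk' 1).comp continuous_fst)).prodMk
      (g.1.continuous.comp ((AddCircle.continuous_mk' 1).comp continuous_snd))).prodMk
      continuous_const
  have ho : orient (g.1 (x : S1)) (g.1 (y : S1)) z = 0 := by
    apply le_antisymm
    · exact le_of_tendsto ((hcont.tendsto (x, y)).comp (la.prodMk_nhds ld))
        (Filter.Eventually.of_forall fun n => (hr (φ n)).1.le)
    · exact ge_of_tendsto ((hcont.tendsto (x, y)).comp (lb.prodMk_nhds lc))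
        (Filter.Eventually.of_forall fun n => (hr (φ n)).2)
  have hle : x ≤ y := le_of_tendsto_of_tendsto' la ld fun n => by
    have := hok.sub (w (φ n))
    linarith [this.ab, this.bc, this.cd]
  rcases hle.eq_or_lt with rfl | hlt
  · obtain ⟨δ, hδ, hδ'⟩ := exists_le_of_orient_neg hz1 g
    have h2 := ld.sub la
    rw [sub_self] at h2
    obtain ⟨n, hn⟩ := (h2.eventually (gt_mem_nhds hδ)).exists
    have o := hok.sub (w (φ n))
    have s1 := hsupp (φ n) _ (Or.inl ⟨le_rfl, o.ab.le⟩)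
    have s2 := hsupp (φ n) _ (Or.inr ⟨o.cd.le, le_rfl⟩)
    have := hδ' _ _ (by linarith [o.ab, o.bc, o.cd]) (by linarith [s1.1, s2.2]) (hr (φ n)).1
    linarith
  · refine orient_ne_zero hN h0 h1 hz hg (hxy.resolve_right fun e => ?_) hlt ho
    exact hlt.ne e

/-- The gaps are the interiors of the polygons. Since the point is in no polygon and in no
rectangle, it is beyond an edge of the regular polygon, then beyond the inner side of the rectangle
at that edge, hence beyond another edge of the next translate of the regular polygon, and so on; but
these edges get arbitrarily short. -/
theorem exists_polygon (hz : z ∈ (lam hN h0 h1).complementInDisk) :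
    ∃ V, (lam hN h0 h1).IsPolygon V ∧ z ∈ polygonInterior V := by
  classical
  by_contra hno
  have hN0 : N ≠ 0 := by omega
  have h5 := slope_ge hN
  have hlen := base_length hN (α := α)
  have hok := base_ok hN h0 h1
  have hlt : (base N α).a < (base N α).d := by linarith [hok.ab, hok.bc, hok.cd]
  have hz1 : ‖z‖ < 1 := mem_ball_zero_iff.1 hz.1
  -- Some edge of a translate of the regular polygon separates the polygon from `z`.
  have hpoly : ∀ g ∈ spinFlip hN, ∃ i, orient ((g * spin N i).1 ((base N α).a : S1))
      ((g * spin N i).1 ((base N α).d : S1)) z < 0 := by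
    intro g hg
    obtain ⟨x, y, hE, ho⟩ := exists_edge_orient_neg hN h0 h1
      ((isPolygon_regular hN h0 h1).image g fun l => map_mem_lam hN h0 h1 hg) hz hno
    obtain ⟨x, y, hE', rfl, rfl⟩ := exists_of_edge_image g hE
    obtain ⟨i, rfl, rfl⟩ := (edge_regular_base hN).1 hE'
    exact ⟨i, ho⟩
  have hin : ∀ g ∈ spinFlip hN, orient (g.1 ((base N α).a : S1)) (g.1 ((base N α).d : S1)) z < 0 →
      orient (g.1 ((base N α).b : S1)) (g.1 ((base N α).c : S1)) z < 0 := by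
    intro g hg ho
    by_contra h
    exact not_inRect hN h0 h1 hz hno hg ⟨ho, not_lt.1 h⟩
  have hseq : ∀ n : ℕ, ∃ j : ℤ, ∃ u : List ℤ, Reduced N u ∧ u.length = n ∧
      orient ((spin N j * steps hN u).1 ((base N α).a : S1))
        ((spin N j * steps hN u).1 ((base N α).d : S1)) z < 0 := by
    intro n
    induction n with
    | zero =>
      obtain ⟨i, hi⟩ := hpoly 1 (one_mem _)
      exact ⟨i, [], by simp [Reduced], rfl, by simpa [steps] using hi⟩
    | succ n ih =>
      obtain ⟨j, u, hu, hn, ho⟩ := ih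
      have hg := mul_mem (spin_mem hN j) (steps_mem hN u)
      have hg' := mul_mem hg (flip_mem hN)
      have hbc := hin _ hg ho
      obtain ⟨i, hi⟩ := hpoly _ hg'
      refine ⟨j, u ++ [i], ?_, by simp [hn], ?_⟩
      · intro k hk
        rcases List.mem_append.1 hk with hk | hk
        · exact hu k hk
        · obtain rfl := List.mem_singleton.1 hk
          -- Otherwise `z` would be on both sides of the inner side of the base rectangle.
          intro hdvd
          rw [spin_eq_one hN0 hdvd, mul_one] at hi
          have := hin _ hg' hi
          rw [mul_apply _ (flip hN), mul_apply _ (flip hN), flip_b hN h0 h1, flip_c hN h0 h1,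
            orient_swap] at this
          linarith
      · rw [steps_append]
        convert hi using 3 <;> simp [steps, step, mul_assoc]
  obtain ⟨δ, hδ, hδ'⟩ := exists_le_of_orient_neg hz1 1
  obtain ⟨n, hn⟩ := exists_pow_lt_of_lt_one hδ (show (1 / 5 : ℝ) < 1 by norm_num)
  obtain ⟨j, u, hu, hlu, ho⟩ := hseq n
  obtain ⟨c, hc⟩ := steps_coe hN h0 h1 hu
  rw [mul_apply, mul_apply, (hc _ ⟨le_rfl, hlt.le⟩).1, (hc _ ⟨hlt.le, le_rfl⟩).1, spin_coe,
    spin_coe, hlu] at ho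
  have hp : (1 : ℝ) ≤ (2 * N - 1) ^ n := one_le_pow₀ (by linarith)
  have e1 : (c + (base N α).d / (2 * N - 1 : ℝ) ^ n + j / N) -
      (c + (base N α).a / (2 * N - 1 : ℝ) ^ n + j / N) =
      ((base N α).d - (base N α).a) / (2 * N - 1 : ℝ) ^ n := by ring
  have e2 : ((base N α).d - (base N α).a) / (2 * N - 1 : ℝ) ^ n ≤ (1 / 5) ^ n := by
    rw [one_div_pow]
    exact div_le_div₀ zero_le_one (by linarith) (by positivity)
      (pow_le_pow_left₀ (by norm_num) h5 _)
  have e3 : 0 ≤ ((base N α).d - (base N α).a) / (2 * N - 1 : ℝ) ^ n :=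
    div_nonneg (by linarith) (by linarith)
  have e4 : ((base N α).d - (base N α).a) / (2 * N - 1 : ℝ) ^ n < 1 :=
    (div_le_self (by linarith) hp).trans_lt (by linarith)
  have := hδ' _ _ (by linarith) (by linarith) ho
  linarith

theorem isVeryFull_lam : (lam hN h0 h1).IsVeryFull :=
  Lamination.isVeryFull_of_forall_mem fun _ hz => exists_polygon hN h0 h1 hz

theorem isDense_lam : (lam hN h0 h1).IsDense :=
  Lamination.isDense_of_forall_mem fun _ hz => exists_polygon hN h0 h1 hz

/-! ### Leaves with a common endpoint -/

/-- The two points of `l` are joined by an edge of the polygon with vertex set `V`. -/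
def IsSide (V : Finset S1) (l : Pairs) : Prop := ∃ x y, Edge V x y ∧ l.1 = s(x, y)

/-- Leaves with a common endpoint are sides of one polygon: of a quadrilateral if they are in the
same rectangle, and otherwise they are outer sides of rectangles on the same regular polygon, since
a common inner side is one leaf. -/
theorem exists_isSide_translate {γ : HomeoPlus} (hγ : γ ∈ spinFlip hN) {q r : ℝ × ℝ}
    (hq : q ∈ (base N α).leaves) (hr : r ∈ (base N α).leaves) {l m : Pairs}
    (hl : l.1 = s((q.1 : S1), (q.2 : S1))) (hm : m.1 = s(γ.1 (r.1 : S1), γ.1 (r.2 : S1)))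
    (hne : l ≠ m) {t : S1} (htl : t ∈ l.1) (htm : t ∈ m.1) :
    ∃ V, (lam hN h0 h1).IsPolygon V ∧ IsSide V l ∧ IsSide V m := by
  have hlen := base_length hN (α := α)
  have hok := base_ok hN h0 h1
  have o := hok
  obtain ⟨o1, o2, o3⟩ := o
  obtain ⟨x, hxq, rfl⟩ : ∃ x, (q.1 = x ∨ q.2 = x) ∧ t = (x : S1) := by
    rw [hl, Sym2.mem_iff] at htl
    rcases htl with rfl | rfl
    exacts [⟨_, Or.inl rfl, rfl⟩, ⟨_, Or.inr rfl, rfl⟩]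
  obtain ⟨y, hyr, hxy⟩ : ∃ y, (r.1 = y ∨ r.2 = y) ∧ (x : S1) = γ.1 (y : S1) := by
    rw [hm, Sym2.mem_iff] at htm
    rcases htm with h | h
    exacts [⟨_, Or.inl rfl, h⟩, ⟨_, Or.inr rfl, h⟩]
  have hx : x ∈ (base N α).supp := by
    rcases hxq with rfl | rfl
    exacts [(Rect.mem_supp_of_mem_leaves hok hq).1, (Rect.mem_supp_of_mem_leaves hok hq).2]
  have hy : y ∈ (base N α).supp := by
    rcases hyr with rfl | rfl
    exacts [(Rect.mem_supp_of_mem_leaves hok hr).1, (Rect.mem_supp_of_mem_leaves hok hr).2]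
  have hx' := Rect.supp_subset hok hx
  have hy' := Rect.supp_subset hok hy
  have hwin : ∀ u ∈ Ico (base N α).a ((base N α).a + 1), (x : S1) = (u : S1) → x = u :=
    fun u hu e => (coe_eq_coe_iff_of_window hx'.1 (by linarith [hx'.2]) hu.1 hu.2).1 e
  -- A point of the boundary intervals that lies between them is an inner corner.
  have hinner : ∀ q ∈ (base N α).leaves, ∀ x ∈ (base N α).supp, (q.1 = x ∨ q.2 = x) →
      (base N α).b ≤ x → x ≤ (base N α).c → q = ((base N α).b, (base N α).c) := by
    intro q hq x hx hxq x1 x2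
    have hbc : x = (base N α).b ∨ x = (base N α).c := by
      rcases hx with ⟨y1, y2⟩ | ⟨y1, y2⟩
      exacts [Or.inl (le_antisymm y2 x1), Or.inr (le_antisymm x2 y1)]
    apply Rect.eq_inner_of_mem hok hq
    rcases hxq with rfl | rfl <;> rcases hbc with h | h <;> simp [h]
  rcases classify hN h0 h1 hγ with rfl | rfl | ⟨j, hj, rfl⟩ | h | ⟨j, hj, h⟩
  · have hxy' : x = y := hwin y ⟨hy'.1, by linarith [hy'.2]⟩ hxy
    subst hxy'
    rcases Rect.compare_leaves hok hq hr with rfl | ⟨-, h⟩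
    · exact absurd (Subtype.ext (hl.trans hm.symm)) hne
    · obtain ⟨w, hqw, hrw⟩ := h ⟨x, hxq, hyr⟩
      refine ⟨_, isPolygon_quad hN h0 h1 w, ?_⟩
      have hsub := Rect.supp_sub hok w
      obtain ⟨p1, p2, p3⟩ := hok.sub w
      have ha := (Rect.supp_subset hok (hsub (Or.inl ⟨le_rfl, p1.le⟩))).1
      have hd := (Rect.supp_subset hok (hsub (Or.inr ⟨p3.le, le_rfl⟩))).2
      generalize (base N α).sub w = σ at *
      have key : ∀ q : ℝ × ℝ, σ.QuadSide q → ∀ l : Pairs, l.1 = s((q.1 : S1), (q.2 : S1)) →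
          IsSide (quad σ.s σ.t σ.t' σ.s') l := by
        have hin := fun x y => edge_quad_iff (x := x) (y := y)
          (show σ.s < σ.t by simp only [Rect.s, Rect.t]; linarith)
          (show σ.t < σ.t' by simp only [Rect.t', Rect.t]; linarith)
          (show σ.t' < σ.s' by simp only [Rect.t', Rect.s']; linarith)
          (by simp only [Rect.s, Rect.s']; linarith)
        rintro q (rfl | rfl | rfl | rfl) l hl
        · exact ⟨_, _, (hin _ _).2 (Or.inl ⟨rfl, rfl⟩), hl⟩
        · exact ⟨_, _, (hin _ _).2 (Or.inr (Or.inl ⟨rfl, rfl⟩)), hl⟩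
        · exact ⟨_, _, (hin _ _).2 (Or.inr (Or.inr (Or.inl ⟨rfl, rfl⟩))), hl⟩
        · exact ⟨_, _, (hin _ _).2 (Or.inr (Or.inr (Or.inr ⟨rfl, rfl⟩))), by
            rw [hl, Sym2.eq_swap]⟩
      exact ⟨key q hqw l hl, key r hrw m hm⟩
  · obtain ⟨u, u1, u2, hu⟩ := flip_supp hN h0 h1 hy
    obtain ⟨v, v1, v2, hv⟩ := flip_supp hN h0 h1 hx
    have e1 : x = u := hwin u ⟨by linarith, by linarith⟩ (hxy.trans hu)
    have e2 : y = v := by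
      rw [hxy, ← mul_apply, flip_mul_flip, one_apply] at hv
      exact (coe_eq_coe_iff_of_window hy'.1 (by linarith [hy'.2])
        (show (base N α).a ≤ v by linarith) (by linarith)).1 hv
    have q1 := hinner q hq x hx hxq (by linarith) (by linarith)
    have r1 := hinner r hr y hy hyr (by linarith) (by linarith)
    refine absurd (Subtype.ext ?_) hne
    rw [hl, hm, q1, r1, flip_b hN h0 h1, flip_c hN h0 h1, Sym2.eq_swap]
  · obtain ⟨u, u1, u2, hu, e1, e2⟩ := spin_edge hN hj hy'
    rw [hu] at hxy
    have hcor : (x = (base N α).a ∨ x = (base N α).d) ∧ (y = (base N α).a ∨ y = (base N α).d) := by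
      rcases u2.eq_or_lt with h | h
      · refine ⟨Or.inl (hwin _ ⟨le_rfl, by linarith⟩ ?_), Or.inr (e2 h)⟩
        rw [hxy, h, coe_add_one]
      · have e3 : x = u := hwin u ⟨by linarith, h⟩ hxy
        have e4 : u = (base N α).d := le_antisymm (by linarith [hx'.2]) u1
        exact ⟨Or.inr (e3.trans e4), Or.inl (e1 e4)⟩
    have q1 : q = ((base N α).a, (base N α).d) := by
      apply Rect.eq_outer_of_mem hok hq
      rcases hxq with rfl | rfl <;> rcases hcor.1 with h | h <;> simp [h]
    have r1 : r = ((base N α).a, (base N α).d) := by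
      apply Rect.eq_outer_of_mem hok hr
      rcases hyr with rfl | rfl <;> rcases hcor.2 with h | h <;> simp [h]
    refine ⟨_, isPolygon_regular hN h0 h1, ⟨_, _, (edge_regular_base hN).2 ⟨0, rfl, rfl⟩, ?_⟩,
      ⟨_, _, (edge_regular_base hN).2 ⟨j, rfl, rfl⟩, ?_⟩⟩
    · rw [hl, q1, spin_eq_one (by omega) (dvd_zero _), one_apply, one_apply]
    · rw [hm, r1]
  · exfalso
    obtain ⟨u, u1, u2, hu⟩ := h y hy
    have := hwin u ⟨by linarith, by linarith⟩ (hxy.trans hu)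
    rcases hx with ⟨x1, x2⟩ | ⟨x1, x2⟩ <;> linarith
  · exfalso
    obtain ⟨u, u1, u2, hu⟩ := h y hy
    obtain ⟨v, v1, v2, hv, e1, e2⟩ := spin_edge hN hj ⟨u1.le, u2.le⟩
    have v3 : v < (base N α).a + 1 := v2.lt_of_ne fun e => by linarith [e2 e]
    have v4 : (base N α).d < v := v1.lt_of_ne fun e => by linarith [e1 e.symm]
    have := hwin v ⟨by linarith, v3⟩ (by rw [hxy, hu, hv])
    linarith [hx'.2]

theorem isLoose_lam : (lam hN h0 h1).IsLoose := by
  classical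
  rintro l ⟨γ, hγ, q, hq, hl⟩ m ⟨γ', hγ', r, hr, hm⟩ hne ⟨t, htl, htm⟩
  obtain ⟨V, hV, hVl, hVm⟩ := exists_isSide_translate hN h0 h1 (mul_mem (inv_mem hγ) hγ') hq hr
    (l := l.map (γ⁻¹).1) (m := m.map (γ⁻¹).1) (t := (γ⁻¹).1 t)
    (by rw [Pairs.map_val hl, ← mul_apply, ← mul_apply, inv_mul_cancel, one_apply, one_apply])
    (by rw [Pairs.map_val hm, ← mul_apply, ← mul_apply])
    (fun e => hne (by
      have e' := congrArg (Pairs.map γ.1) e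
      rwa [← Pairs.map_mul, ← Pairs.map_mul, mul_inv_cancel, Pairs.map_one, Pairs.map_one] at e'))
    (Sym2.mem_map.2 ⟨t, htl, rfl⟩) (Sym2.mem_map.2 ⟨t, htm, rfl⟩)
  have hV' := hV.image γ fun l => map_mem_lam hN h0 h1 hγ
  have key : ∀ l : Pairs, IsSide V (l.map (γ⁻¹).1) →
      Lamination.IsEdge l (convexHull ℝ (toPlane '' (V.image γ.1 : Set S1))) := by
    rintro l ⟨x, y, hE, e⟩
    have e' := Pairs.map_val e γ.1
    rw [← Pairs.map_mul, mul_inv_cancel, Pairs.map_one] at e'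
    have := Lamination.isEdge_of_edge (hE.image γ) hV'.card e'
    simpa using this
  exact ⟨_, hV'.isGap, by simpa using key l hVl, by simpa using key m hVm⟩

end Gaps

/-! ### Distinct endpoints -/

section Distinct

variable {N : ℕ} (hN : 3 ≤ N)

theorem exists_lift_dist (s t : S1) :
    ∃ x y : ℝ, s = (x : S1) ∧ t = (y : S1) ∧ |x - y| = dist s t := by
  obtain ⟨x, -, -, rfl⟩ := exists_coe_Ico 0 s
  obtain ⟨y, -, -, rfl⟩ := exists_coe_Ico 0 t
  refine ⟨x - round (x - y), y, ?_, rfl, ?_⟩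
  · rw [sub_eq_add_neg, ← Int.cast_neg, coe_add_int]
  · rw [dist_eq_norm, ← AddCircle.coe_sub, AddCircle.norm_eq, inv_one, one_mul, mul_one]
    congr 1
    ring

theorem exists_lipschitz {γ : HomeoPlus} (hγ : γ ∈ spinFlip hN) :
    ∃ K, LipschitzWith K γ.1 := by
  have h5 := slope_ge hN
  have hflip : LipschitzWith (Real.toNNReal (2 * N - 1)) (flip hN).1 := by
    refine LipschitzWith.of_dist_le_mul fun s t => ?_
    obtain ⟨x, y, rfl, rfl, e⟩ := exists_lift_dist s t
    rw [flip_coe, flip_coe, ← e, Real.coe_toNNReal _ (by linarith)]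
    refine (dist_coe_le _ _).trans ?_
    have hmono := (flipLift_strictMono hN).monotone
    rcases le_total x y with h | h
    · have := flipLift_sub_le hN h
      rw [abs_sub_comm, abs_of_nonneg (sub_nonneg.2 (hmono h)), abs_sub_comm,
        abs_of_nonneg (sub_nonneg.2 h)]
      exact this
    · have := flipLift_sub_le hN h
      rw [abs_of_nonneg (sub_nonneg.2 (hmono h)), abs_of_nonneg (sub_nonneg.2 h)]
      exact this
  have hspin : ∀ i, LipschitzWith 1 (spin N i).1 := fun i =>
    LipschitzWith.of_dist_le_mul fun s t => by rw [dist_spin, NNReal.coe_one, one_mul]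
  have hmul : ∀ g g' : HomeoPlus, (∃ K, LipschitzWith K g.1) → (∃ K, LipschitzWith K g'.1) →
      ∃ K, LipschitzWith K (g * g').1 := by
    rintro g g' ⟨K, hK⟩ ⟨K', hK'⟩
    exact ⟨K * K', hK.comp hK'⟩
  have hone : ∃ K, LipschitzWith K (1 : HomeoPlus).1 := ⟨1, LipschitzWith.id⟩
  have hsteps : ∀ u, ∃ K, LipschitzWith K (steps hN u).1 := by
    intro u
    induction u with
    | nil => exact hone
    | cons i u ih =>
      rw [steps_cons, step]
      exact hmul _ _ (hmul _ _ ⟨_, hflip⟩ ⟨_, hspin i⟩) ih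
  obtain ⟨j, u, e, -, he, rfl⟩ := exists_normal_form hN hγ
  refine hmul _ _ (hmul _ _ ⟨_, hspin j⟩ (hsteps u)) ?_
  rcases he with rfl | rfl
  · rw [pow_zero]; exact hone
  · rw [pow_one]; exact ⟨_, hflip⟩

/-- One of the two coordinates of a pair. -/
def coord (i : Bool) (q : ℝ × ℝ) : ℝ := if i then q.1 else q.2

include hN in
theorem base_size {α : ℝ} (h0 : 0 ≤ α) (h1 : α ≤ 1 / (8 * N)) : (base N α).size ≤ 1 := by
  have hlen := base_length hN (α := α)
  obtain ⟨o1, o2, o3⟩ := base_ok hN h0 h1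
  exact max_le (by linarith) (by linarith)

include hN in
theorem coord_mem {α : ℝ} (h0 : 0 ≤ α) (h1 : α ≤ 1 / (8 * N)) (w : List (Fin 4)) {k : ℝ}
    (hk : k ∈ cantor) (i : Bool) :
    coord i (((base N α).sub w).leaf k) ∈ 
      Icc (-(3 * (1 / (8 * N))) : ℝ) (6 * (1 / (8 * N))) := by
  have hok := base_ok hN h0 h1
  obtain ⟨b1, -, -, -, -, -, b7, -⟩ := base_bounds hN h0 h1
  have h := Rect.mem_supp_of_mem_leaves hok ⟨w, k, hk, rfl⟩
  have e1 := Rect.supp_subset hok h.1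
  have e2 := Rect.supp_subset hok h.2
  cases i
  exacts [⟨b1.trans e2.1, e2.2.trans b7⟩, ⟨b1.trans e1.1, e1.2.trans b7⟩]

/-- The endpoints of the leaves with a fixed address move at a definite speed with the parameter,
so that they meet a given translate of the leaves of the base rectangle for the parameter `0` only
for a null set of parameters: a Lipschitz image of the product of two small Cantor sets. -/
theorem volume_meet {γ : HomeoPlus} (hγ : γ ∈ spinFlip hN) (w w' : List (Fin 4)) (i i' : Bool) :
    volume {α : ℝ | ∃ k ∈ cantor, ∃ l ∈ cantor, (0 ≤ α ∧ α ≤ 1 / (8 * N)) ∧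
      (coord i (((base N α).sub w).leaf k) : S1) =
        γ.1 (coord i' (((base N 0).sub w').leaf l) : S1)} = 0 := by
  obtain ⟨K, hK⟩ := exists_lipschitz hN hγ
  have h5 := slope_ge hN
  have h2 := eighth_le hN
  have h3 := eighth_pos hN
  have hok := base_ok hN le_rfl h3.le
  apply volume_eq_zero_of_cantor (C := (2 * N - 1) * max 1 (K : ℝ))
  have key : ∀ α k l α' k' l' : ℝ, α ≤ α' → (0 ≤ α ∧ α ≤ 1 / (8 * N)) ∧
      (coord i (((base N α).sub w).leaf k) : S1) =
        γ.1 (coord i' (((base N 0).sub w').leaf l) : S1) → (0 ≤ α' ∧ α' ≤ 1 / (8 * N)) ∧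
      (coord i (((base N α').sub w).leaf k') : S1) =
        γ.1 (coord i' (((base N 0).sub w').leaf l') : S1) → k ∈ cantor → k' ∈ cantor →
      α' - α ≤ (2 * N - 1) * max 1 (K : ℝ) * (|k - k'| + |l - l'|) := by
    rintro α k l α' k' l' hle ⟨⟨a0, a1⟩, e⟩ ⟨⟨a0', a1'⟩, e'⟩ hk hk'
    have hok' := base_ok hN a0' a1'
    set δ := (α' - α) / (2 * N - 1 : ℝ) with hδ
    have hδ' : δ ≤ α' - α := div_le_self (by linarith) (by linarith)
    -- Both sides of the equation are close to their values at the other parameter.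
    have f1 : coord i (((base N α).sub w).leaf k) + δ ≤ coord i (((base N α').sub w).leaf k) := by
      have := Rect.le_leaf_sub (ρ := base N α) (σ := base N α') (δ := δ)
        (by simp only [base]; linarith) (by simp only [base]; linarith)
        (by simp only [base, hδ, add_div, sub_div]; linarith) (by simp only [base]; linarith) w hk
      cases i
      exacts [this.2, this.1]
    have f2 : |coord i (((base N α').sub w).leaf k) - coord i (((base N α').sub w).leaf k')| ≤
        |k - k'| := by
      have := Rect.abs_leaf_sub_le hok' (base_size hN a0' a1') w k k'
      cases i
      exacts [this.2, this.1]
    have f3 : |coord i' (((base N 0).sub w').leaf l) - coord i' (((base N 0).sub w').leaf l')| ≤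
        |l - l'| := by
      have := Rect.abs_leaf_sub_le hok (base_size hN le_rfl h3.le) w' l l'
      cases i'
      exacts [this.2, this.1]
    have m1 := coord_mem hN a0 a1 w hk i
    have m2 := coord_mem hN a0' a1' w hk' i
    generalize coord i (((base N α).sub w).leaf k) = x at *
    generalize coord i (((base N α').sub w).leaf k') = x' at *
    generalize coord i (((base N α').sub w).leaf k) = x'' at *
    have f4 : |x - x'| ≤ K * |l - l'| := by
      have hx : |x - x'| ≤ |(1 : ℝ)| / 2 := by
        rw [abs_one, abs_le]
        constructor <;> linarith [m1.1, m1.2, m2.1, m2.2]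
      rw [← (AddCircle.norm_coe_eq_abs_iff (1 : ℝ) one_ne_zero).2 hx, AddCircle.coe_sub,
        ← dist_eq_norm, e, e']
      refine (hK.dist_le_mul _ _).trans ?_
      exact mul_le_mul_of_nonneg_left ((dist_coe_le _ _).trans f3) K.2
    have f5 : δ ≤ |k - k'| + K * |l - l'| := by
      have := (abs_le.1 f2).2
      have := (abs_le.1 f4).1
      linarith
    have f6 : |k - k'| + K * |l - l'| ≤ max 1 (K : ℝ) * (|k - k'| + |l - l'|) := by
      have g1 := mul_le_mul_of_nonneg_right (le_max_left 1 (K : ℝ)) (abs_nonneg (k - k'))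
      have g2 := mul_le_mul_of_nonneg_right (le_max_right 1 (K : ℝ)) (abs_nonneg (l - l'))
      linarith
    have f7 : α' - α = (2 * N - 1) * δ := by
      rw [hδ, mul_div_cancel₀ _ (by linarith)]
    rw [f7, mul_assoc]
    exact mul_le_mul_of_nonneg_left (f5.trans f6) (by linarith)
  intro α k l α' k' l' hR hR' hk hl hk' hl'
  rcases le_total α α' with h | h
  · rw [abs_sub_comm, abs_of_nonneg (sub_nonneg.2 h)]
    exact key α k l α' k' l' h hR hR' hk hk'
  · rw [abs_of_nonneg (sub_nonneg.2 h), abs_sub_comm k, abs_sub_comm l]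
    exact key α' k' l' α k l h hR' hR hk' hk

theorem exists_distinctEndpoints : ∃ (α : ℝ) (h0 : 0 ≤ α) (h1 : α ≤ 1 / (8 * N)),
    (lam hN le_rfl (eighth_pos hN).le).DistinctEndpoints (lam hN h0 h1) := by
  have h3 := eighth_pos hN
  have := (countable_spinFlip hN).to_subtype
  let B : spinFlip hN × (List (Fin 4) × List (Fin 4)) × (Bool × Bool) → Set ℝ := fun p =>
    {α : ℝ | ∃ k ∈ cantor, ∃ l ∈ cantor, (0 ≤ α ∧ α ≤ 1 / (8 * N)) ∧
      (coord p.2.2.1 (((base N α).sub p.2.1.1).leaf k) : S1) =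
        p.1.1.1 (coord p.2.2.2 (((base N 0).sub p.2.1.2).leaf l) : S1)}
  have hB : volume (⋃ p, B p) = 0 :=
    measure_iUnion_null fun p => volume_meet hN p.1.2 p.2.1.1 p.2.1.2 p.2.2.1 p.2.2.2
  obtain ⟨α, ⟨h0, h1⟩, hα⟩ : ∃ α ∈ Icc (0 : ℝ) (1 / (8 * N)), α ∉ ⋃ p, B p := by
    by_contra h
    push Not at h
    have := measure_mono_null (show Icc (0 : ℝ) (1 / (8 * N)) ⊆ ⋃ p, B p from h) hB
    rw [Real.volume_Icc, sub_zero, ENNReal.ofReal_eq_zero] at this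
    linarith
  refine ⟨α, h0, h1, disjoint_left.2 ?_⟩
  rintro t ⟨l, ⟨γ, hγ, q, ⟨w', κ', hκ', rfl⟩, hl⟩, htl⟩ ⟨m, ⟨γ', hγ', r, ⟨w, κ, hκ, rfl⟩, hm⟩, htm⟩
  have hcoord : ∀ (γ : HomeoPlus) (q : ℝ × ℝ) (l : Pairs), l.1 = s(γ.1 (q.1 : S1), γ.1 (q.2 : S1)) →
      t ∈ l.1 → ∃ i, t = γ.1 (coord i q : S1) := by
    intro γ q l hl ht
    rw [hl, Sym2.mem_iff] at ht
    exact ht.elim (fun h => ⟨true, h⟩) fun h => ⟨false, h⟩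
  obtain ⟨i', hi'⟩ := hcoord _ _ _ hl htl
  obtain ⟨i, hi⟩ := hcoord _ _ _ hm htm
  refine hα (mem_iUnion.2 ⟨(⟨γ'⁻¹ * γ, mul_mem (inv_mem hγ') hγ⟩, (w, w'), (i, i')), κ, hκ, κ', hκ',
    ⟨h0, h1⟩, ?_⟩)
  simp only
  rw [mul_apply, ← hi', hi, ← mul_apply, inv_mul_cancel, one_apply]

end Distinct

/-! ### Discreteness -/

section Discrete

variable {N : ℕ} (hN : 3 ≤ N)

theorem discreteTopology_of_le {Γ : Subgroup HomeoPlus} (hΓ : Γ ≤ spinFlip hN) :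
    DiscreteTopology Γ := by
  have h3 := eighth_pos hN
  have hok := base_ok hN le_rfl h3.le
  have hlen := base_length hN (α := 0)
  obtain ⟨o1, o2, o3⟩ := hok
  -- The translates of the interior of a boundary interval are disjoint.
  let x : ℝ := ((base N 0).a + (base N 0).b) / 2
  have hO : IsOpen ((fun x : ℝ => (x : S1)) '' Ioo (base N 0).a (base N 0).b) :=
    QuotientAddGroup.isOpenMap_coe _ isOpen_Ioo
  have key : ∀ g ∈ spinFlip hN,
      g.1 (x : S1) ∈ (fun x : ℝ => (x : S1)) '' Ioo (base N 0).a (base N 0).b → g = 1 := by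
    rintro g hg ⟨u, ⟨u1, u2⟩, hu⟩
    have hx : x ∈ (base N 0).supp := Or.inl ⟨by simp only [x]; linarith, by simp only [x]; linarith⟩
    refine (sep_translate hN le_rfl h3.le hg).resolve_right fun h => ?_
    obtain ⟨y, hy, y', -, hs, e, -⟩ := h x hx x hx
    have e' : (u : S1) = (y : S1) := hu.trans e
    rcases hy.2.eq_or_lt with h | h
    · rw [h, coe_add_one] at e'
      exact coe_ne_coe u1 (by linarith) e'.symm
    · rw [coe_eq_coe_iff_of_window u1.le (by linarith) hy.1 h] at e'
      rcases hs with ⟨h, -⟩ | ⟨h | h, -⟩ <;> linarith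
  rw [discreteTopology_iff_isOpen_singleton]
  intro g
  have hcont : Continuous fun g' : Γ => (g⁻¹.1 * g'.1).1 (x : S1) := by
    have c1 : Continuous fun g' : HomeoPlus => ((g' : S1 ≃ₜ S1) : C(S1, S1)) :=
      continuous_induced_dom
    have c2 : Continuous fun g' : Γ => g'.1.1 (x : S1) :=
      (continuous_eval_const (F := C(S1, S1)) (x : S1)).comp (c1.comp continuous_subtype_val)
    exact (g⁻¹.1.1.continuous).comp c2
  convert hO.preimage hcont using 1
  ext g'
  constructor
  · rintro rfl
    refine ⟨x, ⟨by simp only [x]; linarith, by simp only [x]; linarith⟩, ?_⟩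
    change _ = (((g' : Γ)⁻¹ * g' : Γ) : HomeoPlus).1 (x : S1)
    rw [inv_mul_cancel]
    rfl
  · intro h
    have := key _ (mul_mem (hΓ (g⁻¹).2) (hΓ g'.2)) h
    exact Subtype.ext (inv_mul_eq_one.1 this).symm

end Discrete

/-! ### The representation of the free product -/

section Representation

variable {N : ℕ} (hN : 3 ≤ N) {G H : Type*} [Group G] [Group H]

/-- The homomorphism that is `f` on the first factor and the conjugate of `f'` by the involution on
the second factor. -/
def rep (f : G →* HomeoPlus) (f' : H →* HomeoPlus) : Monoid.Coprod G H →* HomeoPlus :=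
  Monoid.Coprod.lift f ((MulAut.conj (flip hN)).toMonoidHom.comp f')

variable {f : G →* HomeoPlus} {f' : H →* HomeoPlus}
  (hf : ∀ g, ∃ i, f g = spin N i ∧ (g ≠ 1 → ¬ (N : ℤ) ∣ i))
  (hf' : ∀ h, ∃ i, f' h = spin N i ∧ (h ≠ 1 → ¬ (N : ℤ) ∣ i))

theorem rep_inl (g : G) : rep hN f f' (Monoid.Coprod.inl g) = f g :=
  Monoid.Coprod.lift_apply_inl _ _ _

theorem rep_inr (h : H) :
    rep hN f f' (Monoid.Coprod.inr h) = flip hN * f' h * (flip hN)⁻¹ :=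
  Monoid.Coprod.lift_apply_inr _ _ _

include hf hf'

theorem range_rep_le : (rep hN f f').range ≤ spinFlip hN := by
  rw [rep, Monoid.Coprod.range_lift, sup_le_iff]
  constructor
  · rintro _ ⟨g, rfl⟩
    obtain ⟨i, e, -⟩ := hf g
    rw [e]
    exact spin_mem hN i
  · rintro _ ⟨h, rfl⟩
    obtain ⟨i, e, -⟩ := hf' h
    change flip hN * f' h * (flip hN)⁻¹ ∈ _
    rw [e]
    exact mul_mem (mul_mem (flip_mem hN) (spin_mem hN i)) (inv_mem (flip_mem hN))

theorem exists_rep_altProd {L : List (G × H)} (hL : Alt L) : ∃ u, Reduced N u ∧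
    (L ≠ [] → u ≠ []) ∧ flip hN * rep hN f f' (altProd L) * (flip hN)⁻¹ = steps hN u := by
  induction L with
  | nil => exact ⟨[], by simp [Reduced], fun h => absurd rfl h, by simp [altProd, steps]⟩
  | cons x L ih =>
    obtain ⟨u, hu, -, e⟩ := ih fun y hy => hL y (List.mem_cons_of_mem _ hy)
    obtain ⟨i, ei, hi⟩ := hf x.1
    obtain ⟨j, ej, hj⟩ := hf' x.2
    have hx := hL x List.mem_cons_self
    refine ⟨i :: j :: u, (hu.cons (hj hx.2)).cons (hi hx.1), by simp, ?_⟩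
    rw [altProd_cons, map_mul, map_mul, rep_inl, rep_inr, ei, ej, steps_cons, steps_cons, ← e, step,
      step]
    rw [flip_inv]
    simp only [mul_assoc]

/-- A conjugate of the image of a nontrivial element is a nontrivial rotation or a nonempty
composition of contractions. -/
theorem encard_Fix_rep_le {w : Monoid.Coprod G H} (hw : w ≠ 1) :
    (Fix (rep hN f f' w)).encard ≤ 2 := by
  have hN0 : N ≠ 0 := by omega
  obtain ⟨c, x, rfl, h⟩ := exists_conj hw
  rw [map_mul, map_mul, map_inv, encard_Fix_conj]
  rcases h with ⟨g, hg, rfl⟩ | ⟨h, hh, rfl⟩ | ⟨L, hne, hL, rfl⟩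
  · obtain ⟨i, e, hi⟩ := hf g
    rw [rep_inl, e, Fix_spin hN0 (hi hg), encard_empty]
    exact zero_le
  · obtain ⟨i, e, hi⟩ := hf' h
    rw [rep_inr, encard_Fix_conj, e, Fix_spin hN0 (hi hh), encard_empty]
    exact zero_le
  · obtain ⟨u, hu, hne', e⟩ := exists_rep_altProd hN hf hf' hL
    rw [← encard_Fix_conj (flip hN), e]
    exact Fix_steps hN le_rfl (eighth_pos hN).le hu (hne' hne)

theorem injective_rep : Function.Injective (rep hN f f') := by
  rw [injective_iff_map_eq_one]
  intro w hw
  by_contra hne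
  have h := encard_Fix_rep_le hN hf hf' hne
  have huniv : Fix (1 : HomeoPlus) = univ := eq_univ_of_forall fun t => rfl
  rw [hw, huniv] at h
  have hfin : (univ : Set S1).Finite := finite_of_encard_le_coe (k := 2) (by exact_mod_cast h)
  have hinj : InjOn (fun x : ℝ => (x : S1)) (Ico 0 1) := by
    intro x hx y hy e
    exact (coe_eq_coe_iff_of_window (w := 0) hx.1 (by linarith [hx.2]) hy.1
      (by linarith [hy.2])).1 e
  exact Ico_infinite (zero_lt_one' ℝ)
    (Finite.of_finite_image (hfin.subset (subset_univ _)) hinj)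

theorem isPseudoFibered_rep [Finite G] [Finite H] :
    IsPseudoFibered (rep hN f f').range := by
  have hle := range_rep_le hN hf hf'
  have h0 := (eighth_pos hN).le
  obtain ⟨α, a0, a1, hd⟩ := exists_distinctEndpoints hN
  have hfg : (rep hN f f').range.FG := by
    rw [rep, Monoid.Coprod.range_lift]
    exact ((Group.fg_iff_subgroup_fg _).1 inferInstance).sup
      ((Group.fg_iff_subgroup_fg _).1 inferInstance)
  refine ⟨lam hN le_rfl h0, lam hN a0 a1, hfg,
    ⟨discreteTopology_of_le hN hle, _, isDense_lam hN a0 a1, isInvariant_lam hN a0 a1 hle⟩,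
    isVeryFull_lam hN _ _, isVeryFull_lam hN _ _, isLoose_lam hN _ _, isLoose_lam hN _ _,
    isInvariant_lam hN _ _ hle, isInvariant_lam hN _ _ hle, hd, ?_⟩
  rintro _ ⟨w, rfl⟩ hne
  have hw : w ≠ 1 := by
    rintro rfl
    exact hne (map_one _)
  exact (finite_of_encard_le_coe (k := 2)
    (by exact_mod_cast encard_Fix_rep_le hN hf hf' hw)).countable

end Representation

end CircleLamination

end

theorem mainTheorem4 (G H : Type*) [Group G] [Group H] [Finite G] [Finite H]
    [IsCyclic G] [IsCyclic H] :
    ∃ ρ : Monoid.Coprod G H →* CircleLamination.HomeoPlus,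
      Function.Injective ρ ∧
      CircleLamination.IsPseudoFibered ρ.range ∧
      ∀ w : Monoid.Coprod G H, w ≠ 1 → (CircleLamination.Fix (ρ w)).encard ≤ 2 := by
  have hG : 0 < Nat.card G := Nat.card_pos
  have hH : 0 < Nat.card H := Nat.card_pos
  have hN : 3 ≤ 3 * (Nat.card G * Nat.card H) :=
    Nat.le_mul_of_pos_right 3 (Nat.mul_pos hG hH)
  obtain ⟨f, hf⟩ := CircleLamination.exists_spin_hom G (N := 3 * (Nat.card G * Nat.card H))
    (by omega) (Dvd.intro_left (3 * Nat.card H) (by ring))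
  obtain ⟨f', hf'⟩ := CircleLamination.exists_spin_hom H (N := 3 * (Nat.card G * Nat.card H))
    (by omega) (Dvd.intro_left (3 * Nat.card G) (by ring))
  exact ⟨CircleLamination.rep hN f f', CircleLamination.injective_rep hN hf hf',
    CircleLamination.isPseudoFibered_rep hN hf hf',
    fun w hw => CircleLamination.encard_Fix_rep_le hN hf hf' hw⟩
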